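/- Consider a system of $k$ ordinary differential equations $$y_\mu^{(o_\mu)}=\omega_\mu\big(x,(y_\nu^{(j)})_{1\le\nu\le k,\;0\le j<o_\nu}\big),\qquad \mu=1,\dots,k,\quad o_\mu\ge 1,$$ with $\omega$ smooth on an open set $U$ of the phase space with coordinates $x$ and $y_\mu^{(j)}$, $j<o_\mu$. Let $m=\max_\mu o_\mu$, let $c_{(j)}$ be the number of equations of order $j$, and let $N=\sum_{j=1}^m j\,c_{(j)}$ be the dimension of the system. Let $A=\partial_x+\sum y_\mu^{(j+1)}\partial_{y_\mu^{(j)}}$ (with $y_\mu^{(o_\mu)}$ replaced by $\omega_\mu$) be its operator. Suppose the system admits a Lie algebra $\mathfrak g$ of Lie point symmetries of dimension $r\le N$, i.e. of linearly independent smooth vector fields $Z=\xi\,\partial_x+\sum\eta_\mu\partial_{y_\mu}$ in the variables $(x,y)$, closed under the bracket, whose prolongations $\hat Z$ to the phase space (derivatives being taken along solutions) satisfy $[\hat Z,A]=-(A\xi)A$. Suppose $\mathfrak g$ is $n$-level solvable: its derived series is $\mathfrak g=\mathfrak g^{(0)}\supsetneq\mathfrak g^{(1)}\supsetneq\dots\supsetneq\mathfrak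 g^{(n)}=0$. For $i<j$, the generators of the coset $B^{(i)}_{(j)}=\mathfrak g^{(i)}-\mathfrak g^{(j)}$ are elements of $\mathfrak g^{(i)}$ that form a basis modulo $\mathfrak g^{(j)}$. Let $p_0\in U$ be a point at which each coset $B^{(i)}_{(i+1)}$, $0\le i<n$, acts transitively on a space of dependent variables of dimension $\dim\mathfrak g^{(i)}/\mathfrak g^{(i+1)}$, in this sense: if $Z\in\mathfrak g^{(i)}$ and $\hat Z(p_0)$ lies in the span of $A(p_0)$ and of the $\hat Y(p_0)$, $Y\in\mathfrak g^{(i+1)}$, then $Z\in\mathfrak g^{(i+1)}$. One application of the first integration method to a system $q'=f(x,q)$ consists in the following. New smooth coordinates $(t,s_1,\dots,s_d,v)$ on the domain of the system in the space of $(x,q)$ are chosen, $t$ being the new independent variable, such that the $d$ generators of a coset become $\partial_{s_1},\dots,\partial_{s_d}$ and the operator of the system becomes a nowhere zero multiple of $\partial_t+\sum F_i(t,v)\partial_{s_i}+\sum g_a(t,v)\partial_{v_a}$. The result is the reduced system $v'=g(t,v)$ and the $d$ quadratures $s_i=c_i+\int F_i(t,v(t))\,dt$. All elements of $\mathfrak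 g$ are inherited: the reduced generators $\hat Z(t)\partial_t+\sum\hat Z(v_a)\partial_{v_a}$ depend on $(t,v)$ only, are symmetries of the reduced system, and satisfy the commutation relations of $\mathfrak g$. Then: (1) On some open neighbourhood $W\subseteq U$ of $p_0$ the first integration method can be applied $n$ times in succession, along the cosets $$B^{(n-1)}_{(n)}\to B^{(n-2)}_{(n-1)}\to\dots\to B^{(0)}_{(1)},$$ at each step to the system that the previous step has left and with the reduced prolongations of the generators. This leaves a system of ordinary differential equations of dimension $N-r$, and the number of quadratures is $r$ in total. The curves in the phase space obtained from the solutions of that last system, on open intervals, by performing the quadratures (with arbitrary integration constants) and returning to the old coordinates step by step are exactly the curves $x\mapsto(x,(y_\mu^{(j)}(x))_{j<o_\mu})$ in $W$ given by the solutions $y$ of the original system on open intervals. (2) If $n\ge1$ and the generators of the first coset act transitively already on the space of the variables $(x,y)$, i.e. no nonzero $Z\in\mathfrak g^{(n-1)}$ has its value at the projection of $p_0$ to this space parallel to the projection of $A(p_0)$, then the first step can be taken to come from a point transformation: there are coordinates $t,s_1,\dots,s_d,s_{d+1},\dots,s_k$ on an open set of the space of $(x,y)$, in which the unprolonged generators are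 $\partial_{s_1},\dots,\partial_{s_d}$, such that $t,s_1,\dots,s_d$ are those of the first step and $s_{d+1},\dots,s_k$ are among the $v_a$. (3) At least $n$ applications are needed: let $\mathfrak g=h_0\supseteq h_1\supseteq\dots\supseteq h_l=0$ be subspaces, and let the first integration method be applied $l$ times, starting from the system on some nonempty subset of $U$, the step number $l-j$ (for $j=l-1,\dots,0$) transforming into normal form the reduced prolongations of a basis of $h_j$ modulo $h_{j+1}$. Then $l\ge n$. -/

import Mathlib

open scoped ContDiff

noncomputable section

/-- Points `(x, q)`: one independent variable and `N` dependent variables. -/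
abbrev Phase (N : ℕ) : Type := ℝ × (Fin N → ℝ)

/-! ### A system of `k` ordinary differential equations of mixed orders

The `μ`-th equation is `y_μ^(ord μ) = Ω_μ (x, (y_ν^(j))_{ν, j < ord ν})`. Its phase space has the
coordinates `x` and `y_μ^(j)`, `j < ord μ`; there are `∑ μ, ord μ` of the latter. -/

section Jets

variable {k : ℕ} (ord : Fin k → ℕ)

/-- The dimension `m c_(m) + ... + 2 c_(2) + 1 c_(1)` of a system, where `c_(j)` is the number of
equations of order `j` and `m` is the maximal order. -/
def systemDim : ℕ :=
  ∑ j ∈ Finset.Icc 1 (Finset.univ.sup ord), j * (Finset.univ.filter fun μ => ord μ = j).card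

theorem systemDim_eq_sum : systemDim ord = ∑ μ, ord μ := by
  have h : ∀ μ ∈ (Finset.univ : Finset (Fin k)),
      ord μ ∈ Finset.Icc 0 (Finset.univ.sup ord) := fun μ _ =>
    Finset.mem_Icc.2 ⟨Nat.zero_le _, Finset.le_sup (f := ord) (Finset.mem_univ μ)⟩
  rw [← Finset.sum_fiberwise_of_maps_to h, systemDim]
  have h2 : Finset.Icc 1 (Finset.univ.sup ord) ⊆ Finset.Icc 0 (Finset.univ.sup ord) :=
    Finset.Icc_subset_Icc_left (Nat.zero_le _)
  rw [← Finset.sum_subset h2]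
  · refine Finset.sum_congr rfl fun j _ => ?_
    rw [Finset.sum_congr rfl (g := fun _ => j) (fun μ hμ => (Finset.mem_filter.1 hμ).2)]
    simp [mul_comm]
  · intro j hj hj'
    have h0 : j = 0 := by
      simp only [Finset.mem_Icc] at hj hj'
      omega
    subst h0
    exact Finset.sum_eq_zero fun μ hμ => (Finset.mem_filter.1 hμ).2

/-- The coordinate `y_μ^(j)` of a point of the phase space (zero when `j ≥ ord μ`). -/
def jetCoord (μ : Fin k) (j : ℕ) (p : Phase (∑ ν, ord ν)) : ℝ :=
  if h : j < ord μ then p.2 (finSigmaFinEquiv ⟨μ, ⟨j, h⟩⟩) else 0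

/-- The projection `(x, y_μ^(j)) ↦ (x, y_μ)` to the space of independent and dependent
variables. -/
def baseProj (p : Phase (∑ ν, ord ν)) : Phase k :=
  (p.1, fun μ => jetCoord ord μ 0 p)

/-- The right-hand side of the equivalent first order system
`(y_μ^(j))' = y_μ^(j+1)` for `j + 1 < ord μ`, and `(y_μ^(ord μ - 1))' = Ω_μ`. -/
def firstOrderRhs (Ω : Phase (∑ ν, ord ν) → Fin k → ℝ) (p : Phase (∑ ν, ord ν)) :
    Fin (∑ ν, ord ν) → ℝ := fun a =>
  let s := finSigmaFinEquiv.symm a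
  if (s.2 : ℕ) + 1 < ord s.1 then jetCoord ord s.1 (s.2 + 1) p else Ω p s.1

/-- The operator `A = ∂_x + ∑ y_μ^(j+1) ∂_{y_μ^(j)} + ∑ Ω_μ ∂_{y_μ^(ord μ - 1)}` of the system, as
a vector field on the phase space. -/
def odeField (Ω : Phase (∑ ν, ord ν) → Fin k → ℝ) (p : Phase (∑ ν, ord ν)) :
    Phase (∑ ν, ord ν) := (1, firstOrderRhs ord Ω p)

/-- The coefficients `η_μ^(j)` of the prolongation of the point vector field
`Z = ξ ∂_x + ∑ η_μ ∂_{y_μ}`: `η_μ^(0) = η_μ` and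
`η_μ^(j+1) = d η_μ^(j) / dx - y_μ^(j+1) d ξ / dx`, with `d / dx` the derivative along solutions of
the system, that is, the operator `A`. -/
def prolongCoeff (Ω : Phase (∑ ν, ord ν) → Fin k → ℝ) (Z : Phase k → Phase k) (μ : Fin k) :
    ℕ → Phase (∑ ν, ord ν) → ℝ
  | 0 => fun p => (Z (baseProj ord p)).2 μ
  | j + 1 => fun p =>
      fderiv ℝ (prolongCoeff Ω Z μ j) p (odeField ord Ω p)
        - jetCoord ord μ (j + 1) p *
          fderiv ℝ (fun q => (Z (baseProj ord q)).1) p (odeField ord Ω p)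

/-- The prolongation of a point vector field to the phase space of the system. -/
def prolong (Ω : Phase (∑ ν, ord ν) → Fin k → ℝ) (Z : Phase k → Phase k)
    (p : Phase (∑ ν, ord ν)) : Phase (∑ ν, ord ν) :=
  ((Z (baseProj ord p)).1, fun a =>
    prolongCoeff ord Ω Z (finSigmaFinEquiv.symm a).1 (finSigmaFinEquiv.symm a).2 p)

/-- The point `(x, (y_μ^(j)(x))_{μ, j < ord μ})` of the phase space. -/
def jetOf (y : ℝ → Fin k → ℝ) (x : ℝ) : Phase (∑ ν, ord ν) :=
  (x, fun a =>
    let s := finSigmaFinEquiv.symm a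
    iteratedDeriv s.2 (fun t => y t s.1) x)

/-- `y` solves the system with right-hand side `Ω`, defined on `U`, on the open interval `I`. -/
structure IsODESolution (U : Set (Phase (∑ ν, ord ν))) (Ω : Phase (∑ ν, ord ν) → Fin k → ℝ)
    (I : Set ℝ) (y : ℝ → Fin k → ℝ) : Prop where
  contDiff : ∀ μ, ContDiffOn ℝ (ord μ) (fun x => y x μ) I
  mem : ∀ x ∈ I, jetOf ord y x ∈ U
  eq : ∀ x ∈ I, ∀ μ, iteratedDeriv (ord μ) (fun t => y t μ) x = Ω (jetOf ord y x) μ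

/-- A Lie algebra of Lie point symmetries of the system `(U, Ω)`, realized by `ρ` as linearly
independent vector fields on the open set `D` of the space of independent and dependent
variables. -/
structure IsPointSymmetryAlgebra {L : Type*} [LieRing L] [LieAlgebra ℝ L]
    (U : Set (Phase (∑ ν, ord ν))) (Ω : Phase (∑ ν, ord ν) → Fin k → ℝ)
    (D : Set (Phase k)) (ρ : L →ₗ[ℝ] (Phase k → Phase k)) : Prop where
  smooth : ∀ X, ContDiffOn ℝ ∞ (ρ X) D
  lie : ∀ X Y, ∀ q ∈ D, VectorField.lieBracket ℝ (ρ X) (ρ Y) q = ρ ⁅X, Y⁆ q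
  independent : ∀ X, (∀ q ∈ D, ρ X q = 0) → X = 0
  symm : ∀ X, ∀ p ∈ U,
    VectorField.lieBracket ℝ (prolong ord Ω (ρ X)) (odeField ord Ω) p =
      -(fderiv ℝ (fun q => (ρ X (baseProj ord q)).1) p (odeField ord Ω p)) • odeField ord Ω p

end Jets

/-! ### Systems in first order form, with the generators acting on them -/

/-- An open interval (possibly unbounded). -/
def IsOpenInterval (I : Set ℝ) : Prop := IsOpen I ∧ I.OrdConnected ∧ I.Nonempty

/-- The data of a system `v' = rhs (t, v)` of dimension `N` on a domain of its phase space, with one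
vector field for each element of `L`. -/
structure SymSystem (L : Type*) (N : ℕ) where
  dom : Set (Phase N)
  rhs : Phase N → Fin N → ℝ
  gen : L → Phase N → Phase N

namespace SymSystem

variable {L : Type*} {N : ℕ} (S : SymSystem L N)

/-- The operator `∂_t + ∑ rhs_a ∂_{v_a}` of the system. -/
def field (p : Phase N) : Phase N := (1, S.rhs p)

/-- The data are smooth, and the vector fields are symmetries of the system that represent the Lie
algebra `L` (not necessarily faithfully). -/
structure IsSymmetric [LieRing L] [LieAlgebra ℝ L] : Prop where
  isOpen : IsOpen S.dom
  smooth_rhs : ContDiffOn ℝ ∞ S.rhs S.dom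
  smooth_gen : ∀ X, ContDiffOn ℝ ∞ (S.gen X) S.dom
  add : ∀ X Y, ∀ p ∈ S.dom, S.gen (X + Y) p = S.gen X p + S.gen Y p
  smul : ∀ (c : ℝ) X, ∀ p ∈ S.dom, S.gen (c • X) p = c • S.gen X p
  lie : ∀ X Y, ∀ p ∈ S.dom,
    VectorField.lieBracket ℝ (S.gen X) (S.gen Y) p = S.gen ⁅X, Y⁆ p
  symm : ∀ X, ∀ p ∈ S.dom,
    VectorField.lieBracket ℝ (S.gen X) S.field p =
      -(fderiv ℝ (fun q => (S.gen X q).1) p (S.field p)) • S.field p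

/-- `v` solves the system on `I`. -/
def IsSolution (I : Set ℝ) (v : ℝ → Fin N → ℝ) : Prop :=
  ∀ t ∈ I, (t, v t) ∈ S.dom ∧ HasDerivAt v (S.rhs (t, v t)) t

/-- At the point `p` each of the cosets `g^(i) - g^(i+1)`, `i < n`, acts transitively on a space of
dependent variables whose dimension is the number of its generators, once the generators in
`g^(i+1)` have been used: modulo their directions at `p`, which are those along which the system has
been reduced, the generators of the coset are pointwise linearly independent of each other and of
the operator of the system. -/
def CosetsTransitiveAt [LieRing L] [LieAlgebra ℝ L] (n : ℕ) (p : Phase N) : Prop :=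
  ∀ i < n, ∀ X ∈ LieAlgebra.derivedSeries ℝ L i,
    S.gen X p ∈ Submodule.span ℝ
      ({S.field p} ∪ (fun Y => S.gen Y p) '' (LieAlgebra.derivedSeries ℝ L (i + 1) : Set L)) →
    X ∈ LieAlgebra.derivedSeries ℝ L (i + 1)

end SymSystem

/-- The system of `k` equations in first order form, restricted to `W`, with the prolonged
generators. -/
def odeSymSystem {k : ℕ} (ord : Fin k → ℕ) {L : Type*} [LieRing L] [LieAlgebra ℝ L]
    (Ω : Phase (∑ ν, ord ν) → Fin k → ℝ) (ρ : L →ₗ[ℝ] (Phase k → Phase k))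
    (W : Set (Phase (∑ ν, ord ν))) : SymSystem L (∑ ν, ord ν) where
  dom := W
  rhs := firstOrderRhs ord Ω
  gen := fun X => prolong ord Ω (ρ X)

/-! ### The first integration method -/

/-- The projection `(t, s, v) ↦ (t, v)` to the hypersurfaces `s = constant`. -/
def dropNormal {d e : ℕ} (z : ℝ × (Fin d → ℝ) × (Fin e → ℝ)) : Phase e := (z.1, z.2.2)

/-- One application of the first integration method to the system `S`. The generators in `h` have
been used before; now the generators `b` of the coset `h' - h` are transformed, all at once, into
their normal form by new coordinates `(t, s, v) = Φ (x, q)`, with `t` independent and `s`, `v`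
dependent variables. Then the system splits into the reduced system `v' = S'.rhs (t, v)` and
`s' = F (t, v)`, that is, `d` quadratures. The generators of `S'` are the reduced ones. -/
structure IsFirstIntegration {L : Type*} [LieRing L] [LieAlgebra ℝ L] {N d e : ℕ}
    (h h' : Submodule ℝ L) (S : SymSystem L N) (b : Fin d → L)
    (Φ : OpenPartialHomeomorph (Phase N) (ℝ × (Fin d → ℝ) × (Fin e → ℝ)))
    (F : Phase e → Fin d → ℝ) (S' : SymSystem L e) : Prop where
  le : h ≤ h'
  mem : ∀ i, b i ∈ h'
  basis : ∀ X ∈ h', ∃! c : Fin d → ℝ, X - ∑ i, c i • b i ∈ h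
  source : Φ.source = S.dom
  smooth : ContDiffOn ℝ ∞ Φ Φ.source
  smooth_symm : ContDiffOn ℝ ∞ Φ.symm Φ.target
  smooth_quad : ContDiffOn ℝ ∞ F S'.dom
  dom : S'.dom = dropNormal '' Φ.target
  /-- in the new coordinates the generator `b i` is `∂_{s_i}` -/
  normal : ∀ i, ∀ p ∈ S.dom, fderiv ℝ Φ p (S.gen (b i) p) = (0, Pi.single i 1, 0)
  /-- in the new coordinates the operator of the system is a multiple of
  `∂_t + ∑ F_i (t, v) ∂_{s_i} + ∑ rhs_a (t, v) ∂_{v_a}` -/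
  split : ∀ p ∈ S.dom, ∃ c : ℝ, c ≠ 0 ∧
    fderiv ℝ Φ p (S.field p) =
      c • ((1, F (dropNormal (Φ p)), S'.rhs (dropNormal (Φ p))) : ℝ × (Fin d → ℝ) × (Fin e → ℝ))
  /-- the reduced generators are `Z(t) ∂_t + ∑ Z(v_a) ∂_{v_a}` -/
  reduced : ∀ X, ∀ p ∈ S.dom,
    S'.gen X (dropNormal (Φ p)) = dropNormal (fderiv ℝ Φ p (S.gen X p))

/-- Successive applications of the first integration method along the cosets
`h (j-1) - h j, ..., h 1 - h 2, h 0 - h 1`, all reduced generators being inherited as symmetries at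
each step; `FirstIntegrationChain h S j` are the possible ways to do the `j` steps that start from
the system `S`, on which the generators in `h j` have been used. -/
inductive FirstIntegrationChain {L : Type*} [LieRing L] [LieAlgebra ℝ L] (h : ℕ → Submodule ℝ L) :
    {N : ℕ} → SymSystem L N → ℕ → Type _
  | done {N : ℕ} (S : SymSystem L N) (hS : S.IsSymmetric) : FirstIntegrationChain h S 0
  | step {N d e j : ℕ} (S : SymSystem L N) (hS : S.IsSymmetric) (b : Fin d → L)
      (Φ : OpenPartialHomeomorph (Phase N) (ℝ × (Fin d → ℝ) × (Fin e → ℝ)))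
      (F : Phase e → Fin d → ℝ) (S' : SymSystem L e)
      (hstep : IsFirstIntegration (h (j + 1)) (h j) S b Φ F S')
      (tail : FirstIntegrationChain h S' j) : FirstIntegrationChain h S (j + 1)

namespace FirstIntegrationChain

variable {L : Type*} [LieRing L] [LieAlgebra ℝ L] {h : ℕ → Submodule ℝ L}

/-- The dimension of the system of ordinary differential equations that is left at the end. -/
def finalDim : {N : ℕ} → {S : SymSystem L N} → {j : ℕ} → FirstIntegrationChain h S j → ℕ
  | N, _, _, done _ _ => N
  | _, _, _, step _ _ _ _ _ _ _ tail => tail.finalDim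

/-- The total number of quadratures. -/
def quadratures : {N : ℕ} → {S : SymSystem L N} → {j : ℕ} → FirstIntegrationChain h S j → ℕ
  | _, _, _, done _ _ => 0
  | _, _, _, step (d := d) _ _ _ _ _ _ _ tail => d + tail.quadratures

/-- `C.Produces G`: the curve `G` in the phase space is obtained from a solution of the final system
by going back through all the steps. To go back through one step, take a curve `v = w(t)`, `t ∈ I`,
produced by the later steps, put `s_i (t) = c_i + ∫ F_i (τ, w(τ)) dτ` with integration constants
`c_i`, and return to the old coordinates. -/
def Produces : {N : ℕ} → {S : SymSystem L N} → {j : ℕ} → FirstIntegrationChain h S j →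
    Set (Phase N) → Prop
  | N, _, _, done S _ => fun G => ∃ (I : Set ℝ) (w : ℝ → Fin N → ℝ),
      IsOpenInterval I ∧ S.IsSolution I w ∧ G = (fun t => (t, w t)) '' I
  | _, _, _, step (d := d) (e := e) _ _ _ Φ F _ _ tail => fun G =>
      ∃ (I : Set ℝ) (w : ℝ → Fin e → ℝ) (t₀ : ℝ) (c : Fin d → ℝ) (s : ℝ → Fin d → ℝ),
        IsOpenInterval I ∧ t₀ ∈ I ∧ tail.Produces ((fun t => (t, w t)) '' I) ∧
        (∀ t i, s t i = c i + ∫ τ in t₀..t, F (τ, w τ) i) ∧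
        (∀ t ∈ I, (t, s t, w t) ∈ Φ.target) ∧
        G = (fun t => Φ.symm (t, s t, w t)) '' I

/-- The coordinates `(t, s, v)` of the first step come from a point transformation `Ψ`: `t`, the
`s_i` and further dependent variables among the `v_a`, as many as make a coordinate system together
with them, are functions of the original independent and dependent variables only, and the
unprolonged generators are already in normal form. Here `π` is the projection from the phase space
to the space of these variables. -/
def StartsWithPointTransformation {k : ℕ} (ρ : L → Phase k → Phase k) :
    {N : ℕ} → {S : SymSystem L N} → {j : ℕ} → FirstIntegrationChain h S j →
    (Phase N → Phase k) → Prop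
  | _, _, _, done _ _ => fun _ => True
  | _, _, _, step (d := d) (e := e) S _ b Φ _ _ _ _ => fun π =>
      ∃ (m : ℕ) (Ψ : OpenPartialHomeomorph (Phase k) (ℝ × (Fin d → ℝ) × (Fin m → ℝ)))
        (a : Fin m → Fin e),
        ContDiffOn ℝ ∞ Ψ Ψ.source ∧ ContDiffOn ℝ ∞ Ψ.symm Ψ.target ∧ Function.Injective a ∧
        (∀ i, ∀ q ∈ Ψ.source, fderiv ℝ Ψ q (ρ (b i) q) = (0, Pi.single i 1, 0)) ∧
        ∀ p ∈ S.dom, π p ∈ Ψ.source ∧ (Φ p).1 = (Ψ (π p)).1 ∧ (Φ p).2.1 = (Ψ (π p)).2.1 ∧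
          ∀ l, (Φ p).2.2 (a l) = (Ψ (π p)).2.2 l

end FirstIntegrationChain

end

/-! The mechanism is the simultaneous straightening of commuting fields. When the generators in
`g^(j+1)` already act as zero on a system, the generators `b i` of the next coset commute on it,
since `[b i, b l]` lies in `g^(j+1)`. Transitivity makes them independent of each other and of the
operator `A` at the point, so near it there are coordinates `(t, s, v)` in which they are `∂_{s_i}`
(`exists_exponential`, `exists_straightening`).

In these coordinates, differentiating a pushed-forward field along `s_i` is bracketing with `b i`.
For a generator `X` the bracket lies in the ideal `g^(j)`, whose elements have `s`-components only,
so the `t`- and `v`-components of `X` do not depend on `s`. For `A` the bracket is a multiple of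
`A`, so `A` divided by its `t`-component does not depend on `s`. Forgetting `s` therefore leaves a
system on which the whole algebra acts and `g^(j)` acts as zero (`exists_isFirstIntegration`,
`IsFirstIntegration.gen_eq_zero`). The directions lost are those of generators already used, so
transitivity of the remaining cosets survives (`IsFirstIntegration.cosetsTransitiveAt`). Induction
gives the `n` steps (`hasChains`), and the numbers of quadratures add up to the dimension of the
algebra.

Solution curves correspond at each step because `Φ` carries a solution to a curve whose velocity is
a nowhere zero multiple of `(1, F, rhs)`. After reparametrization by `t` it is a graph, and its
`s`-part is an integral by the fundamental theorem of calculus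
(`IsFirstIntegration.isSolutionGraph_iff`).

For the point transformation, the unprolonged fields are straightened first, and the transversal in
the phase space is chosen over the slice `s = 0` downstairs. Both coordinate systems then agree
along the flows of the generators (`exists_straightening_over`).

For the lower bound, the elements used in one step become constant fields, hence commute on the
system. The elements acting as zero there are exactly those used before, so `[h_i, h_i] ⊆ h_{i+1}`.
Thus `h_i` contains the `i`-th derived algebra, and `h_l = 0` forces `l ≥ n`
(`FirstIntegrationChain.mem_and_lie_mem`). -/

noncomputable section

open Set Filter Topology

/-! ### The inverse function theorem for smooth maps -/

section InverseFunction

universe u v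

variable {X : Type u} {Y : Type v} [NormedAddCommGroup X] [NormedSpace ℝ X] [CompleteSpace X]
  [NormedAddCommGroup Y] [NormedSpace ℝ Y]

/-- The inverse function theorem for smooth maps, with an inverse that is smooth on an open set. -/
theorem exists_openPartialHomeomorph_of_contDiffOn {f : X → Y} {O : Set X} (hO : IsOpen O)
    (hf : ContDiffOn ℝ ∞ f O) {a : X} (ha : a ∈ O) {f' : X ≃L[ℝ] Y}
    (hf' : HasFDerivAt f (f' : X →L[ℝ] Y) a) :
    ∃ Φ : OpenPartialHomeomorph X Y, (Φ : X → Y) = f ∧ a ∈ Φ.source ∧ Φ.source ⊆ O ∧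
      ContDiffOn ℝ ∞ Φ.symm Φ.target := by
  have hfa : ContDiffAt ℝ ∞ f a := hf.contDiffAt (hO.mem_nhds ha)
  let Φ₁ := hfa.toOpenPartialHomeomorph f hf' (by simp)
  have hcont : ContinuousOn (fderiv ℝ f) O :=
    (hf.fderiv_of_isOpen (m := ∞) hO (by simp)).continuousOn
  -- Invertible operators form an open set. Restricting to the points with invertible derivative
  -- makes the inverse smooth on its whole domain, not only at the image of `a`.
  let O' : Set X := O ∩ fderiv ℝ f ⁻¹' (range ((↑) : (X ≃L[ℝ] Y) → X →L[ℝ] Y))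
  have hO' : IsOpen O' := hcont.isOpen_inter_preimage hO ContinuousLinearEquiv.isOpen
  refine ⟨Φ₁.restrOpen O' hO', rfl, ⟨?_, ha, ?_⟩, fun x hx => hx.2.1, ?_⟩
  · exact hfa.mem_toOpenPartialHomeomorph_source hf' (by simp)
  · exact ⟨f', hf'.fderiv.symm⟩
  · intro y hy
    have hsrc := (Φ₁.restrOpen O' hO').map_target hy
    set x := (Φ₁.restrOpen O' hO').symm y with hx
    obtain ⟨e, he⟩ := hsrc.2.2
    have hxf : ContDiffAt ℝ ∞ f x := hf.contDiffAt (hO.mem_nhds hsrc.2.1)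
    refine ((Φ₁.restrOpen O' hO').contDiffAt_symm (f₀' := e) hy ?_ hxf).contDiffWithinAt
    rw [he]
    exact (hxf.differentiableAt (by simp)).hasFDerivAt

end InverseFunction

/-! ### Composition operators on spaces of continuous maps -/

section Superposition

universe u

variable {K : Type*} [TopologicalSpace K] [CompactSpace K]
  {E F : Type u} [NormedAddCommGroup E] [NormedSpace ℝ E] [NormedAddCommGroup F] [NormedSpace ℝ F]

/-- Pointwise application of a continuous family of linear maps. -/
def pointwiseApply : C(K, E →L[ℝ] F) →L[ℝ] C(K, E) →L[ℝ] C(K, F) :=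
  LinearMap.mkContinuous₂ (E := C(K, E →L[ℝ] F)) (F := C(K, E)) (G := C(K, F))
    (σ₂₃ := RingHom.id ℝ) (σ₁₃ := RingHom.id ℝ)
    (LinearMap.mk₂ ℝ (fun (A : C(K, E →L[ℝ] F)) (γ : C(K, E)) =>
        (⟨fun x => A x (γ x), A.continuous.clm_apply γ.continuous⟩ : C(K, F)))
      (fun _ _ _ => by ext; simp) (fun _ _ _ => by ext; simp) (fun _ _ _ => by ext; simp)
      (fun _ _ _ => by ext; simp)) 1 (fun A γ => by
        refine (ContinuousMap.norm_le _ (by positivity)).2 fun x => ?_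
        simp only [one_mul, LinearMap.mk₂_apply, ContinuousMap.coe_mk]
        exact (A x).le_of_opNorm_le_of_le (A.norm_coe_le_norm x) (γ.norm_coe_le_norm x))

/-- The mean value inequality at each point of `K`, with a radius `δ` that serves all points at
once. Its uniformity comes from the continuity of `γ ↦ f' ∘ γ` in the sup norm. -/
theorem hasFDerivAt_postcomp (f : C(E, F)) (f' : C(E, E →L[ℝ] F))
    (h : ∀ x, HasFDerivAt f (f' x) x) (γ : C(K, E)) :
    HasFDerivAt (fun γ : C(K, E) => f.comp γ) (pointwiseApply (f'.comp γ)) γ := by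
  rw [hasFDerivAt_iff_isLittleO, Asymptotics.isLittleO_iff]
  intro c hc
  have hcont : Continuous fun γ : C(K, E) => f'.comp γ := ContinuousMap.continuous_postcomp f'
  obtain ⟨δ, hδ, hball⟩ := (Metric.continuous_iff (α := C(K, E)) (β := C(K, E →L[ℝ] F))).1 hcont γ c hc
  filter_upwards [Metric.ball_mem_nhds γ hδ] with η hη
  rw [ContinuousMap.norm_le _ (by positivity)]
  intro x
  have hηx : η x ∈ Metric.ball (γ x) δ :=
    lt_of_le_of_lt (ContinuousMap.dist_apply_le_dist x) hη
  have key := (convex_ball (γ x) δ).norm_image_sub_le_of_norm_hasFDerivWithin_le' (f := f)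
    (f' := f') (φ := f' (γ x)) (C := c) (x := γ x) (y := η x)
    (fun z _ => (h z).hasFDerivWithinAt) (fun z hz => ?_) (Metric.mem_ball_self hδ) hηx
  · refine key.trans ?_
    gcongr
    simpa using (η - γ).norm_coe_le_norm x
  · let ζ : C(K, E) := γ + ContinuousMap.const K (z - γ x)
    have hζ : dist ζ γ < δ := by
      have : dist ζ γ ≤ dist z (γ x) := by
        rw [ContinuousMap.dist_le dist_nonneg]
        intro w
        simp [ζ, dist_eq_norm]
      exact this.trans_lt hz
    have h1 := (ContinuousMap.dist_apply_le_dist x).trans_lt (hball ζ hζ)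
    simp only [ContinuousMap.comp_apply, ContinuousMap.add_apply, ContinuousMap.const_apply, ζ,
      add_sub_cancel, dist_eq_norm] at h1
    exact h1.le

/-- The derivative is again composition with a smooth map, namely `fderiv ℝ f`, followed by a
bounded linear map. Hence the induction on the order, for all target spaces at once. -/
theorem contDiff_postcomp {f : E → F} (hf : ContDiff ℝ ∞ f) :
    ContDiff ℝ ∞ (fun γ : C(K, E) => (⟨f, hf.continuous⟩ : C(E, F)).comp γ) := by
  rw [contDiff_infty]
  intro n
  induction n generalizing F with
  | zero => exact contDiff_zero.2 (ContinuousMap.continuous_postcomp _)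
  | succ n ih =>
    have hf' : ContDiff ℝ ∞ (fderiv ℝ f) := hf.fderiv_right (by simp)
    push_cast
    rw [contDiff_succ_iff_hasFDerivAt]
    refine ⟨_, pointwiseApply.contDiff.comp (ih hf'), fun γ => ?_⟩
    exact hasFDerivAt_postcomp ⟨f, hf.continuous⟩ ⟨_, hf'.continuous⟩
      (fun x => (hf.differentiable (by simp) x).hasFDerivAt) γ

end Superposition

/-! ### Primitives of paths on the unit interval -/

section Primitive

variable {E : Type*} [NormedAddCommGroup E]

local notation "𝕀" => Set.Icc (0 : ℝ) 1

/-- The extension of a path to the real line by constants. -/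
def extendPath (γ : C(𝕀, E)) : ℝ → E := fun t => γ (Set.projIcc 0 1 zero_le_one t)

theorem continuous_extendPath (γ : C(𝕀, E)) : Continuous (extendPath γ) :=
  γ.continuous.comp continuous_projIcc

theorem extendPath_coe (γ : C(𝕀, E)) (τ : 𝕀) : extendPath γ τ = γ τ := by
  simp [extendPath]

variable [NormedSpace ℝ E]

/-- The primitive of a path that vanishes at `0`. -/
def primitive : C(𝕀, E) →L[ℝ] C(𝕀, E) :=
  LinearMap.mkContinuous
    { toFun := fun γ => ⟨fun τ => ∫ u in (0 : ℝ)..τ, extendPath γ u,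
        (intervalIntegral.continuous_primitive
          (fun _ _ => (continuous_extendPath γ).intervalIntegrable _ _) 0).comp
          continuous_subtype_val⟩
      map_add' := fun γ η => by
        ext τ
        exact intervalIntegral.integral_add ((continuous_extendPath γ).intervalIntegrable _ _)
          ((continuous_extendPath η).intervalIntegrable _ _)
      map_smul' := fun c γ => by
        ext τ
        exact intervalIntegral.integral_smul c _ } 1 (fun γ => by
    rw [ContinuousMap.norm_le _ (by positivity)]
    intro τ
    have := intervalIntegral.norm_integral_le_of_norm_le_const (a := 0) (b := (τ : ℝ)) (C := ‖γ‖)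
      (f := extendPath γ) (fun u _ => γ.norm_coe_le_norm _)
    refine this.trans ?_
    rw [sub_zero, abs_of_nonneg τ.2.1, one_mul]
    exact mul_le_of_le_one_right (norm_nonneg _) τ.2.2)

theorem primitive_apply (γ : C(𝕀, E)) (τ : 𝕀) :
    primitive γ τ = ∫ u in (0 : ℝ)..τ, extendPath γ u := rfl

theorem hasDerivAt_primitive [CompleteSpace E] (γ : C(𝕀, E)) (t : ℝ) :
    HasDerivAt (fun t => ∫ u in (0 : ℝ)..t, extendPath γ u) (extendPath γ t) t :=
  (continuous_extendPath γ).integral_hasStrictDerivAt 0 t |>.hasDerivAt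

end Primitive

/-! ### The simultaneous flow of commuting vector fields -/

section Exponential

universe u

variable {E : Type u} [NormedAddCommGroup E] [NormedSpace ℝ E] [CompleteSpace E] {d : ℕ}

local notation "𝕀" => Set.Icc (0 : ℝ) 1

/-- The linearization along the path `γ` of the integral equation of the flow of `∑ sⱼ Zⱼ` is solved
by `τ ↦ τ Zᵢ(γ τ)`, if `Zᵢ` commutes with all `Zⱼ`. -/
theorem smul_comp_path_eq_integral {Z : Fin d → E → E} (hZ : ∀ i, ContDiff ℝ ∞ (Z i))
    (N : Fin d → C(𝕀, E)) (D : Fin d → C(𝕀, E)) (s : Fin d → ℝ) (γ : C(𝕀, E)) (x : E) (i : Fin d)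
    (hN : ∀ j τ, N j τ = Z j (γ τ))
    (hD : ∀ j τ, D j τ = fderiv ℝ (Z j) (γ τ) ((τ : ℝ) • Z i (γ τ)))
    (hcomm : ∀ j τ, fderiv ℝ (Z i) (γ τ) (Z j (γ τ)) = fderiv ℝ (Z j) (γ τ) (Z i (γ τ)))
    (hγ : γ = ContinuousMap.const _ x + ∑ j, s j • primitive (N j)) (τ : 𝕀) :
    (τ : ℝ) • Z i (γ τ) = ∑ j, s j • primitive (D j) τ + primitive (N i) τ := by
  let g : ℝ → E := fun t => x + ∑ j, s j • ∫ u in (0 : ℝ)..t, extendPath (N j) u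
  have hgγ : ∀ τ : 𝕀, g τ = γ τ := by
    intro τ
    conv_rhs => rw [hγ]
    simp [g, primitive_apply]
  have hg : ∀ t, HasDerivAt g (∑ j, s j • extendPath (N j) t) t := fun t =>
    (HasDerivAt.fun_sum fun j _ => (hasDerivAt_primitive (N j) t).const_smul (s j)).const_add x
  let m : ℝ → E := fun t => t • Z i (g t)
  let R : ℝ → E := fun t => ∑ j, s j • (∫ u in (0 : ℝ)..t, extendPath (D j) u) +
    ∫ u in (0 : ℝ)..t, extendPath (N i) u
  have hm : ∀ t, HasDerivAt m
      (t • fderiv ℝ (Z i) (g t) (∑ j, s j • extendPath (N j) t) + (1 : ℝ) • Z i (g t)) t := by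
    intro t
    refine (hasDerivAt_id t).smul ?_
    exact ((hZ i).differentiable (by simp) (g t)).hasFDerivAt.comp_hasDerivAt t (hg t)
  have hR : ∀ t, HasDerivAt R (∑ j, s j • extendPath (D j) t + extendPath (N i) t) t := fun t =>
    (HasDerivAt.fun_sum fun j _ => (hasDerivAt_primitive (D j) t).const_smul (s j)).add
      (hasDerivAt_primitive (N i) t)
  -- Commutativity turns `t • DZᵢ(∑ sⱼ Zⱼ)` into `∑ sⱼ DZⱼ(t • Zᵢ)`, so both sides of the claim have
  -- the same derivative; both vanish at `0`.
  have hderiv : ∀ t ∈ Ico (0 : ℝ) 1,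
      t • fderiv ℝ (Z i) (g t) (∑ j, s j • extendPath (N j) t) + (1 : ℝ) • Z i (g t) =
        ∑ j, s j • extendPath (D j) t + extendPath (N i) t := by
    intro t ht
    obtain ⟨τ, rfl⟩ : ∃ τ : 𝕀, (τ : ℝ) = t := ⟨⟨t, ht.1, ht.2.le⟩, rfl⟩
    simp only [extendPath_coe, hgγ, hN, hD, map_sum, map_smul, one_smul, Finset.smul_sum, hcomm]
    congr 1
    refine Finset.sum_congr rfl fun j _ => smul_comm _ _ _
  have := eq_of_has_deriv_right_eq (f := m) (g := R) (a := 0) (b := 1)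
    (fun t _ => (hm t).hasDerivWithinAt)
    (fun t ht => by rw [hderiv t ht]; exact (hR t).hasDerivWithinAt)
    (fun t _ => (hm t).continuousAt.continuousWithinAt)
    (fun t _ => (hR t).continuousAt.continuousWithinAt) (by simp [m, R]) τ τ.2
  simpa [m, R, hgγ, primitive_apply] using this

/-- The path `τ ↦ exp (τ ∑ sⱼ Zⱼ) x` solves an integral equation in the Banach space of paths, and
the inverse function theorem makes the solution depend smoothly on `(s, x)`. Its derivative in `sᵢ`
solves the linearized equation, whose solution `τ ↦ τ Zᵢ` takes the value `Zᵢ` at the end of the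
path. -/
theorem exists_exponential_of_contDiff {Z : Fin d → E → E} (hZ : ∀ i, ContDiff ℝ ∞ (Z i))
    {O : Set E} (hO : IsOpen O) {p₀ : E} (hp₀ : p₀ ∈ O)
    (hcomm : ∀ i j, ∀ p ∈ O, fderiv ℝ (Z i) p (Z j p) = fderiv ℝ (Z j) p (Z i p)) :
    ∃ (V : Set ((Fin d → ℝ) × E)) (γ : (Fin d → ℝ) × E → E), IsOpen V ∧ (0, p₀) ∈ V ∧
      ContDiffOn ℝ ∞ γ V ∧ (∀ x, (0, x) ∈ V → γ (0, x) = x) ∧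
      ∀ p ∈ V, γ p ∈ O ∧ ∀ i, fderiv ℝ γ p (Pi.single i 1, 0) = Z i (γ p) := by
  let N : Fin d → C(𝕀, E) → C(𝕀, E) := fun i γ =>
    (⟨Z i, (hZ i).continuous⟩ : C(E, E)).comp γ
  have hN : ∀ i, ContDiff ℝ ∞ (N i) := fun i => contDiff_postcomp (hZ i)
  have hDZ : ∀ i, ContDiff ℝ ∞ (fderiv ℝ (Z i)) := fun i => (hZ i).fderiv_right (by simp)
  let DN : Fin d → C(𝕀, E) → C(𝕀, E) →L[ℝ] C(𝕀, E) := fun i γ =>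
    pointwiseApply ((⟨fderiv ℝ (Z i), (hDZ i).continuous⟩ : C(E, E →L[ℝ] E)).comp γ)
  have hDN : ∀ i γ, HasFDerivAt (N i) (DN i γ) γ := fun i γ =>
    hasFDerivAt_postcomp _ ⟨fderiv ℝ (Z i), (hDZ i).continuous⟩
      (fun x => ((hZ i).differentiable (by simp) x).hasFDerivAt) γ
  let T := (Fin d → ℝ) × E
  let cst : E →L[ℝ] C(𝕀, E) := ContinuousLinearMap.const ℝ 𝕀
  -- The zeros of `G` are the solutions of `γ = x + ∑ sⱼ ∫ Zⱼ ∘ γ`.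
  let G : T × C(𝕀, E) → C(𝕀, E) := fun q =>
    q.2 - cst q.1.2 - ∑ j, q.1.1 j • primitive (N j q.2)
  let S : Fin d → T × C(𝕀, E) →L[ℝ] ℝ := fun j =>
    (ContinuousLinearMap.proj j).comp
      ((ContinuousLinearMap.fst ℝ (Fin d → ℝ) E).comp (ContinuousLinearMap.fst ℝ T C(𝕀, E)))
  let G' : T × C(𝕀, E) → T × C(𝕀, E) →L[ℝ] C(𝕀, E) := fun q =>
    ContinuousLinearMap.snd ℝ T C(𝕀, E) - cst.comp ((ContinuousLinearMap.snd ℝ (Fin d → ℝ) E).comp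
      (ContinuousLinearMap.fst ℝ T C(𝕀, E))) -
    ∑ j, (q.1.1 j • (primitive.comp ((DN j q.2).comp (ContinuousLinearMap.snd ℝ T C(𝕀, E)))) +
      (S j).smulRight (primitive (N j q.2)))
  have hG' : ∀ q, HasFDerivAt G (G' q) q := by
    intro q
    refine HasFDerivAt.sub (HasFDerivAt.sub hasFDerivAt_snd
      (ContinuousLinearMap.hasFDerivAt (cst.comp ((ContinuousLinearMap.snd ℝ (Fin d → ℝ) E).comp
        (ContinuousLinearMap.fst ℝ T C(𝕀, E)))))) (HasFDerivAt.fun_sum fun j _ => ?_)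
    have h : HasFDerivAt (fun q : T × C(𝕀, E) => primitive (N j q.2))
        (primitive.comp ((DN j q.2).comp (ContinuousLinearMap.snd ℝ T C(𝕀, E)))) q :=
      (primitive (E := E)).hasFDerivAt.comp q ((hDN j q.2).comp q hasFDerivAt_snd)
    exact (S j).hasFDerivAt.smul h
  have hG : ContDiff ℝ ∞ G := by
    refine ContDiff.sub (ContDiff.sub contDiff_snd (cst.contDiff.comp contDiff_fst.snd))
      (ContDiff.sum fun j _ => ?_)
    have h : ContDiff ℝ ∞ (fun q : T × C(𝕀, E) => primitive (N j q.2)) :=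
      (primitive (E := E)).contDiff.comp ((hN j).comp contDiff_snd)
    exact (S j).contDiff.smul h
  let H : T × C(𝕀, E) → T × C(𝕀, E) := fun q => (q.1, G q)
  have hH : ContDiff ℝ ∞ H := contDiff_fst.prodMk hG
  have hH' : ∀ q, HasFDerivAt H ((ContinuousLinearMap.fst ℝ T C(𝕀, E)).prod (G' q)) q := fun q =>
    hasFDerivAt_fst.prodMk (hG' q)
  -- At `s = 0` the constant path is the solution, and the derivative of `G` in the path variable is
  -- the identity. So the derivative of `H` is triangular, with inverse provided by `skewProd`.
  let q₀ : T × C(𝕀, E) := ((0, p₀), cst p₀)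
  let ℓ : T →L[ℝ] C(𝕀, E) := cst.comp (ContinuousLinearMap.snd ℝ (Fin d → ℝ) E) +
    ∑ j, ((ContinuousLinearMap.proj j).comp
      (ContinuousLinearMap.fst ℝ (Fin d → ℝ) E)).smulRight (primitive (N j (cst p₀)))
  let e : (T × C(𝕀, E)) ≃L[ℝ] T × C(𝕀, E) := ContinuousLinearEquiv.skewProd
    (ContinuousLinearEquiv.refl ℝ T) (ContinuousLinearEquiv.refl ℝ C(𝕀, E)) (-ℓ)
  have he : HasFDerivAt H (e : T × C(𝕀, E) →L[ℝ] T × C(𝕀, E)) q₀ := by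
    convert hH' q₀ using 1
    refine ContinuousLinearMap.ext fun q => Prod.ext rfl ?_
    simp [e, G', q₀, ℓ, S, T]
    abel
  obtain ⟨Φ, hΦ, hq₀, -, hsymm⟩ := exists_openPartialHomeomorph_of_contDiffOn isOpen_univ
    hH.contDiffOn (mem_univ q₀) he
  have hHΦ : ∀ z ∈ Φ.target, H (Φ.symm z) = z := fun z hz => by
    rw [← hΦ]; exact Φ.right_inv hz
  let inl : T → T × C(𝕀, E) := fun p => (p, 0)
  have hinl : ContDiff ℝ ∞ inl := contDiff_id.prodMk contDiff_const
  let Γ : T → C(𝕀, E) := fun p => (Φ.symm (inl p)).2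
  have hΓsmooth : ContDiffOn ℝ ∞ Γ (inl ⁻¹' Φ.target) :=
    (hsymm.comp hinl.contDiffOn fun p hp => hp).snd
  have hV₁ : IsOpen (inl ⁻¹' Φ.target) := Φ.open_target.preimage hinl.continuous
  have hΓ : ∀ p, inl p ∈ Φ.target → Φ.symm (inl p) = (p, Γ p) := fun p hp => by
    have := congrArg Prod.fst (hHΦ (inl p) hp)
    exact Prod.ext this rfl
  have hGΓ : ∀ p, inl p ∈ Φ.target → G (p, Γ p) = 0 := fun p hp => by
    rw [← hΓ p hp]; exact congrArg Prod.snd (hHΦ _ hp)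
  have hHq₀ : H q₀ = inl (0, p₀) := by simp [H, q₀, inl, G, T]
  have hbase : inl (0, p₀) ∈ Φ.target := by
    rw [← hHq₀, ← hΦ]; exact Φ.map_source hq₀
  have hΓ₀ : Γ (0, p₀) = cst p₀ := by
    have : Φ.symm (inl (0, p₀)) = q₀ := by rw [← hHq₀, ← hΦ]; exact Φ.left_inv hq₀
    exact congrArg Prod.snd this
  -- The fields commute only on `O`, so whole paths must stay there; by compactness this is an open
  -- condition.
  let M : Set C(𝕀, E) := {γ | MapsTo γ univ O}
  have hM : IsOpen M := ContinuousMap.isOpen_setOfPred_mapsTo isCompact_univ hO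
  refine ⟨inl ⁻¹' Φ.target ∩ Γ ⁻¹' M, fun p => Γ p 1,
    hΓsmooth.continuousOn.isOpen_inter_preimage hV₁ hM, ⟨hbase, ?_⟩, ?_, ?_, ?_⟩
  · intro τ _
    rw [hΓ₀]
    exact hp₀
  · exact (ContinuousMap.evalCLM ℝ (1 : 𝕀)).contDiff.comp_contDiffOn
      (hΓsmooth.mono inter_subset_left)
  · intro x hx
    have := hGΓ _ hx.1
    simp only [G, Pi.zero_apply, zero_smul, Finset.sum_const_zero, sub_zero, sub_eq_zero] at this
    exact congrArg (fun γ : C(𝕀, E) => γ 1) this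
  · rintro p ⟨hp, hpM⟩
    refine ⟨hpM (mem_univ 1), fun i => ?_⟩
    let K : C(𝕀, E) := ⟨fun τ => (τ : ℝ) • Z i (Γ p τ),
      continuous_subtype_val.smul ((hZ i).continuous.comp (Γ p).continuous)⟩
    have hγ : Γ p = ContinuousMap.const _ p.2 + ∑ j, p.1 j • primitive (N j (Γ p)) := by
      have := hGΓ p hp
      simp only [G, sub_sub, sub_eq_zero] at this
      exact this
    have hK : G' (p, Γ p) ((Pi.single i 1, 0), K) = 0 := by
      ext τ
      have := smul_comp_path_eq_integral hZ (fun j => N j (Γ p)) (fun j => DN j (Γ p) K) p.1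
        (Γ p) p.2 i (fun _ _ => rfl) (fun _ _ => rfl)
        (fun j τ => hcomm i j _ (hpM (mem_univ τ))) hγ τ
      simp only [G', S, T, sub_apply, ContinuousLinearMap.coe_snd',
        ContinuousLinearMap.comp_apply, ContinuousLinearMap.coe_fst', map_zero, sub_zero,
        sum_apply, add_apply, smul_apply,
        ContinuousLinearMap.smulRight_apply, ContinuousLinearMap.proj_apply, Pi.single_apply,
        ite_smul, one_smul, zero_smul, Finset.sum_add_distrib, Finset.sum_ite_eq',
        Finset.mem_univ, if_true, ContinuousMap.sub_apply, ContinuousMap.add_apply,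
        ContinuousMap.zero_apply, ContinuousMap.sum_apply, ContinuousMap.smul_apply]
      rw [sub_eq_zero]
      exact this
    have hsrc : (p, Γ p) ∈ Φ.source := by rw [← hΓ p hp]; exact Φ.map_target hp
    have hΦp : HasFDerivAt Φ ((ContinuousLinearMap.fst ℝ T C(𝕀, E)).prod (G' (p, Γ p))) (p, Γ p) := by
      rw [hΦ]; exact hH' _
    have hB : HasFDerivAt Φ.symm (fderiv ℝ Φ.symm (inl p)) (inl p) :=
      ((hsymm.contDiffAt (Φ.open_target.mem_nhds hp)).differentiableAt (by simp)).hasFDerivAt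
    have hΦinl : Φ (p, Γ p) = inl p := by rw [← hΓ p hp]; exact Φ.right_inv hp
    have hid : HasFDerivAt (fun q => Φ.symm (Φ q)) (ContinuousLinearMap.id ℝ (T × C(𝕀, E)))
        (p, Γ p) := by
      refine (hasFDerivAt_id _).congr_of_eventuallyEq ?_
      filter_upwards [Φ.open_source.mem_nhds hsrc] with q hq using Φ.left_inv hq
    have hcomp := (HasFDerivAt.comp (p, Γ p) (hΦinl.symm ▸ hB) hΦp).unique hid
    -- The derivative of `H` sends `((eᵢ, 0), K)` to `((eᵢ, 0), 0)` by `hK`, so the derivative of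
    -- the inverse sends it back. Thus `K` is the derivative of the solution path in `sᵢ`.
    have hBv : fderiv ℝ Φ.symm (inl p) ((Pi.single i 1, 0), 0) = ((Pi.single i 1, 0), K) := by
      have := congrArg (fun A => A (((Pi.single i 1, 0), K) : T × C(𝕀, E))) hcomp
      simp only [ContinuousLinearMap.comp_apply, ContinuousLinearMap.prod_apply, hK, hΦinl,
        ContinuousLinearMap.coe_fst'] at this
      exact this
    have hinl' : HasFDerivAt inl (ContinuousLinearMap.inl ℝ T C(𝕀, E)) p :=
      (ContinuousLinearMap.inl ℝ T C(𝕀, E)).hasFDerivAt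
    have hγ' : HasFDerivAt (fun p => Γ p 1)
        ((ContinuousMap.evalCLM ℝ (1 : 𝕀)).comp ((ContinuousLinearMap.snd ℝ T C(𝕀, E)).comp
          ((fderiv ℝ Φ.symm (inl p)).comp (ContinuousLinearMap.inl ℝ T C(𝕀, E))))) p :=
      (ContinuousMap.evalCLM ℝ (1 : 𝕀) : C(𝕀, E) →L[ℝ] E).hasFDerivAt.comp p
        ((ContinuousLinearMap.snd ℝ T C(𝕀, E)).hasFDerivAt.comp p (hB.comp p hinl'))
    rw [hγ'.fderiv]
    change (fderiv ℝ Φ.symm (inl p) ((Pi.single i 1, 0), 0)).2 1 = _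
    rw [hBv]
    simp [K]

/-- Smooth vector fields that commute have a smooth simultaneous exponential
`γ (s, x) = exp (∑ sᵢ Zᵢ) x` near any point, with the partial derivatives `∂γ/∂sᵢ = Zᵢ ∘ γ`. -/
theorem exists_exponential [FiniteDimensional ℝ E] {Z : Fin d → E → E} {O : Set E} (hO : IsOpen O)
    (hZ : ∀ i, ContDiffOn ℝ ∞ (Z i) O) {p₀ : E} (hp₀ : p₀ ∈ O)
    (hcomm : ∀ i j, ∀ p ∈ O, fderiv ℝ (Z i) p (Z j p) = fderiv ℝ (Z j) p (Z i p)) :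
    ∃ (V : Set ((Fin d → ℝ) × E)) (γ : (Fin d → ℝ) × E → E), IsOpen V ∧ (0, p₀) ∈ V ∧
      ContDiffOn ℝ ∞ γ V ∧ (∀ x, (0, x) ∈ V → γ (0, x) = x) ∧
      ∀ p ∈ V, γ p ∈ O ∧ ∀ i, fderiv ℝ γ p (Pi.single i 1, 0) = Z i (γ p) := by
  obtain ⟨ε, hε, hball⟩ := Metric.isOpen_iff.1 hO p₀ hp₀
  -- A cutoff makes the fields globally smooth without changing them on the ball of radius `ε / 3`,
  -- to which the exponential is then confined.
  let χ : ContDiffBump p₀ := ⟨ε / 3, ε / 2, by positivity, by linarith⟩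
  have hsupp : tsupport χ ⊆ O := by
    rw [χ.tsupport_eq]
    exact (Metric.closedBall_subset_ball (by simp only [χ]; linarith)).trans hball
  let Z' : Fin d → E → E := fun i p => χ p • Z i p
  have hZ' : ∀ i, ContDiff ℝ ∞ (Z' i) := by
    intro i
    rw [contDiff_iff_contDiffAt]
    intro x
    by_cases hx : x ∈ tsupport χ
    · exact χ.contDiff.contDiffAt.smul ((hZ i).contDiffAt (hO.mem_nhds (hsupp hx)))
    · have : Z' i =ᶠ[𝓝 x] fun _ => 0 := by
        filter_upwards [(isClosed_tsupport χ).isOpen_compl.mem_nhds hx] with y hy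
        simp [Z', image_eq_zero_of_notMem_tsupport hy]
      exact contDiffAt_const.congr_of_eventuallyEq this
  have hball' : Metric.ball p₀ (ε / 3) ⊆ O :=
    (Metric.ball_subset_ball (by linarith)).trans hball
  have hZZ' : ∀ i, ∀ p ∈ Metric.ball p₀ (ε / 3), Z' i p = Z i p := fun i p hp => by
    have : χ p = 1 := χ.one_of_mem_closedBall (Metric.ball_subset_closedBall hp)
    simp [Z', this]
  have hDZ' : ∀ i, ∀ p ∈ Metric.ball p₀ (ε / 3), fderiv ℝ (Z' i) p = fderiv ℝ (Z i) p :=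
    fun i p hp => Filter.EventuallyEq.fderiv_eq (by
      filter_upwards [Metric.isOpen_ball.mem_nhds hp] with q hq using hZZ' i q hq)
  obtain ⟨V, γ, hV, h0, hγ, hγ0, hγZ⟩ := exists_exponential_of_contDiff hZ' Metric.isOpen_ball
    (Metric.mem_ball_self (x := p₀) (by positivity : 0 < ε / 3)) (fun i j p hp => by
      rw [hDZ' i p hp, hDZ' j p hp, hZZ' i p hp, hZZ' j p hp]
      exact hcomm i j p (hball' hp))
  exact ⟨V, γ, hV, h0, hγ, hγ0, fun p hp => ⟨hball' (hγZ p hp).1, fun i => by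
    rw [(hγZ p hp).2 i, hZZ' i _ (hγZ p hp).1]⟩⟩

end Exponential

/-! ### Straightening commuting fields along a transversal -/

section Straightening

universe u

variable {E : Type u} [NormedAddCommGroup E] [NormedSpace ℝ E]
  {F : Type*} [NormedAddCommGroup F] [NormedSpace ℝ F]

namespace OpenPartialHomeomorph

variable {Φ : OpenPartialHomeomorph E F}

theorem hasFDerivAt_of_smooth (h : ContDiffOn ℝ ∞ Φ Φ.source) {p : E} (hp : p ∈ Φ.source) :
    HasFDerivAt Φ (fderiv ℝ Φ p) p :=
  ((h.contDiffAt (Φ.open_source.mem_nhds hp)).differentiableAt (by simp)).hasFDerivAt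

theorem fderiv_symm_fderiv (h : ContDiffOn ℝ ∞ Φ Φ.source)
    (h' : ContDiffOn ℝ ∞ Φ.symm Φ.target) {p : E} (hp : p ∈ Φ.source) (v : E) :
    fderiv ℝ Φ.symm (Φ p) (fderiv ℝ Φ p v) = v := by
  have h1 := hasFDerivAt_of_smooth h hp
  have h2 := hasFDerivAt_of_smooth (Φ := Φ.symm) h' (Φ.map_source hp)
  have hid : HasFDerivAt (Φ.symm ∘ Φ) (ContinuousLinearMap.id ℝ E) p := by
    refine (hasFDerivAt_id _).congr_of_eventuallyEq ?_
    filter_upwards [Φ.open_source.mem_nhds hp] with q hq using Φ.left_inv hq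
  exact congrArg (fun A => A v) ((h2.comp p h1).unique hid)

theorem fderiv_fderiv_symm (h : ContDiffOn ℝ ∞ Φ Φ.source)
    (h' : ContDiffOn ℝ ∞ Φ.symm Φ.target) {p : E} (hp : p ∈ Φ.source) (w : F) :
    fderiv ℝ Φ p (fderiv ℝ Φ.symm (Φ p) w) = w := by
  have := fderiv_symm_fderiv (Φ := Φ.symm) h' h (Φ.map_source hp) w
  rwa [Φ.symm_symm, Φ.left_inv hp] at this

end OpenPartialHomeomorph

variable [FiniteDimensional ℝ E] {d e : ℕ}

/-- The projection `(t, s, v) ↦ (t, v)` as a continuous linear map. -/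
def dropNormalL (d e : ℕ) : ℝ × (Fin d → ℝ) × (Fin e → ℝ) →L[ℝ] Phase e :=
  (ContinuousLinearMap.fst ℝ ℝ ((Fin d → ℝ) × (Fin e → ℝ))).prod
    ((ContinuousLinearMap.snd ℝ (Fin d → ℝ) (Fin e → ℝ)).comp
      (ContinuousLinearMap.snd ℝ ℝ ((Fin d → ℝ) × (Fin e → ℝ))))

theorem hasFDerivAt_dropNormal (z : ℝ × (Fin d → ℝ) × (Fin e → ℝ)) :
    HasFDerivAt dropNormal (dropNormalL d e) z :=
  (dropNormalL d e).hasFDerivAt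

theorem contDiff_dropNormal : ContDiff ℝ ∞ (dropNormal (d := d) (e := e)) :=
  (dropNormalL d e).contDiff

theorem sum_smul_single (s : Fin d → ℝ) :
    ∑ i, s i • ((0, Pi.single i 1, 0) : ℝ × (Fin d → ℝ) × (Fin e → ℝ)) = (0, s, 0) := by
  refine Prod.ext ?_ (Prod.ext ?_ ?_)
  · simp [Prod.fst_sum]
  · ext j
    simp [Prod.snd_sum, Prod.fst_sum, Finset.sum_apply, Pi.single_apply]
  · simp [Prod.snd_sum]

/-- Commuting smooth vector fields `Z₁, …, Z_d` become `∂_{s₁}, …, ∂_{s_d}` in suitable coordinates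
`(t, s, v)`, in which a given transversal `σ` is the slice `s = 0`. -/
theorem exists_straightening {Z : Fin d → E → E} {O : Set E} (hO : IsOpen O)
    (hZ : ∀ i, ContDiffOn ℝ ∞ (Z i) O)
    (hcomm : ∀ i j, ∀ p ∈ O, fderiv ℝ (Z i) p (Z j p) = fderiv ℝ (Z j) p (Z i p))
    {σ : Phase e → E} {Q : Set (Phase e)} (hQ : IsOpen Q) (hσ : ContDiffOn ℝ ∞ σ Q)
    {a₀ : Phase e} (ha₀ : a₀ ∈ Q) (hσO : σ a₀ ∈ O)
    (hinj : ∀ (s : Fin d → ℝ) (a : Phase e),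
      ∑ i, s i • Z i (σ a₀) + fderiv ℝ σ a₀ a = 0 → s = 0 ∧ a = 0)
    (hdim : Module.finrank ℝ E = d + e + 1) :
    ∃ Φ : OpenPartialHomeomorph E (ℝ × (Fin d → ℝ) × (Fin e → ℝ)),
      σ a₀ ∈ Φ.source ∧ Φ.source ⊆ O ∧ ContDiffOn ℝ ∞ Φ Φ.source ∧
      ContDiffOn ℝ ∞ Φ.symm Φ.target ∧
      (∀ i, ∀ p ∈ Φ.source, fderiv ℝ Φ p (Z i p) = (0, Pi.single i 1, 0)) ∧
      Φ (σ a₀) = (a₀.1, 0, a₀.2) ∧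
      (∀ t v, (t, 0, v) ∈ Φ.target → (t, v) ∈ Q ∧ Φ.symm (t, 0, v) = σ (t, v)) ∧
      ∀ a, fderiv ℝ Φ (σ a₀) (fderiv ℝ σ a₀ a) = (a.1, 0, a.2) := by
  obtain ⟨V, γ, hV, h0V, hγ, hγ0, hγZ⟩ := exists_exponential hO hZ hσO hcomm
  let T := ℝ × (Fin d → ℝ) × (Fin e → ℝ)
  let m : T → (Fin d → ℝ) × E := fun z => (z.2.1, σ (dropNormal z))
  have hQ' : IsOpen (dropNormal (d := d) ⁻¹' Q) := hQ.preimage contDiff_dropNormal.continuous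
  have hm : ContDiffOn ℝ ∞ m (dropNormal ⁻¹' Q) :=
    (contDiff_snd.fst.contDiffOn).prodMk (hσ.comp contDiff_dropNormal.contDiffOn fun z hz => hz)
  let O₁ : Set T := dropNormal ⁻¹' Q ∩ m ⁻¹' V
  have hO₁ : IsOpen O₁ := hm.continuousOn.isOpen_inter_preimage hQ' hV
  -- The inverse of the coordinate system: start on the transversal at `σ (t, v)` and flow for the
  -- times `s`.
  let Ψ : T → E := fun z => γ (m z)
  have hΨ : ContDiffOn ℝ ∞ Ψ O₁ := hγ.comp (hm.mono inter_subset_left) fun z hz => hz.2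
  let z₀ : T := (a₀.1, 0, a₀.2)
  have hz₀ : z₀ ∈ O₁ := ⟨ha₀, h0V⟩
  have hΨ' : ∀ z ∈ O₁, ∀ w : T, fderiv ℝ Ψ z w =
      fderiv ℝ γ (m z) (w.2.1, fderiv ℝ σ (dropNormal z) (dropNormal w)) := by
    intro z hz w
    have h1 : HasFDerivAt γ (fderiv ℝ γ (m z)) (m z) :=
      ((hγ.contDiffAt (hV.mem_nhds hz.2)).differentiableAt (by simp)).hasFDerivAt
    have h2 : HasFDerivAt σ (fderiv ℝ σ (dropNormal z)) (dropNormal z) :=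
      ((hσ.contDiffAt (hQ.mem_nhds hz.1)).differentiableAt (by simp)).hasFDerivAt
    have h3 : HasFDerivAt m _ z := HasFDerivAt.prodMk
      ((ContinuousLinearMap.fst ℝ (Fin d → ℝ) (Fin e → ℝ)).comp
          (ContinuousLinearMap.snd ℝ ℝ ((Fin d → ℝ) × (Fin e → ℝ)))).hasFDerivAt
      (h2.comp z (hasFDerivAt_dropNormal z))
    exact congrArg (fun A => A w) (h1.comp z h3).fderiv
  have hΨZ : ∀ z ∈ O₁, ∀ i, fderiv ℝ Ψ z (0, Pi.single i 1, 0) = Z i (Ψ z) := by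
    intro z hz i
    rw [hΨ' z hz]
    have : dropNormal ((0, Pi.single i 1, 0) : T) = 0 := rfl
    rw [this, map_zero]
    exact (hγZ _ hz.2).2 i
  have hΨz₀ : Ψ z₀ = σ a₀ := hγ0 _ h0V
  have hslice : ∀ z ∈ O₁, z.2.1 = 0 → ∀ a : Phase e,
      fderiv ℝ Ψ z (a.1, 0, a.2) = fderiv ℝ σ (dropNormal z) a := by
    intro z hz hz0 a
    rw [hΨ' z hz]
    have hmz : m z = (0, σ (dropNormal z)) := Prod.ext hz0 rfl
    have h1 : HasFDerivAt γ (fderiv ℝ γ (m z)) (0, σ (dropNormal z)) := by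
      rw [hmz]
      exact ((hγ.contDiffAt (hV.mem_nhds (hmz ▸ hz.2))).differentiableAt (by simp)).hasFDerivAt
    have h2 : HasFDerivAt (fun x : E => ((0 : Fin d → ℝ), x)) (ContinuousLinearMap.inr ℝ _ _)
      (σ (dropNormal z)) := (ContinuousLinearMap.inr ℝ (Fin d → ℝ) E).hasFDerivAt
    have h3 : HasFDerivAt (fun x : E => γ (0, x)) (ContinuousLinearMap.id ℝ E)
        (σ (dropNormal z)) := by
      refine (hasFDerivAt_id _).congr_of_eventuallyEq ?_
      have : ∀ᶠ x in 𝓝 (σ (dropNormal z)), ((0 : Fin d → ℝ), x) ∈ V :=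
        h2.continuousAt.eventually (hV.mem_nhds (by
          have := hz.2
          rw [mem_preimage, hmz] at this
          exact this))
      filter_upwards [this] with x hx using hγ0 x hx
    exact congrArg (fun A => A (fderiv ℝ σ (dropNormal z) a)) ((h1.comp _ h2).unique h3)
  have hsplit : ∀ w : T, fderiv ℝ Ψ z₀ w =
      ∑ i, w.2.1 i • Z i (σ a₀) + fderiv ℝ σ a₀ (dropNormal w) := by
    intro w
    have hw : w = ∑ i, w.2.1 i • ((0, Pi.single i 1, 0) : T) + (w.1, 0, w.2.2) := by
      rw [sum_smul_single]
      exact Prod.ext (zero_add w.1).symm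
        (Prod.ext (add_zero w.2.1).symm (zero_add w.2.2).symm)
    conv_lhs => rw [hw]
    rw [map_add, map_sum]
    simp only [map_smul, hΨZ z₀ hz₀, hΨz₀]
    rw [hslice z₀ hz₀ rfl (w.1, w.2.2)]
    rfl
  have hker : ∀ w : T, fderiv ℝ Ψ z₀ w = 0 → w = 0 := by
    intro w hw
    rw [hsplit] at hw
    obtain ⟨h1, h2⟩ := hinj _ _ hw
    exact Prod.ext (congrArg (fun a : Phase e => a.1) h2)
      (Prod.ext h1 (congrArg (fun a : Phase e => a.2) h2))
  have hdim' : Module.finrank ℝ T = Module.finrank ℝ E := by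
    rw [hdim]
    simp only [T, Module.finrank_prod, Module.finrank_self, Module.finrank_fintype_fun_eq_card,
      Fintype.card_fin]
    ring
  -- Transversality gives injectivity of the derivative, and equality of dimensions makes it an
  -- isomorphism.
  let eq : T ≃L[ℝ] E := (LinearEquiv.ofInjectiveOfFinrankEq (fderiv ℝ Ψ z₀).toLinearMap
    ((injective_iff_map_eq_zero _).2 hker) hdim').toContinuousLinearEquiv
  have heq : HasFDerivAt Ψ (eq : T →L[ℝ] E) z₀ := by
    have : (eq : T →L[ℝ] E) = fderiv ℝ Ψ z₀ := ContinuousLinearMap.ext fun w => rfl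
    rw [this]
    exact ((hΨ.contDiffAt (hO₁.mem_nhds hz₀)).differentiableAt (by simp)).hasFDerivAt
  obtain ⟨Θ, hΘ, hz₀Θ, hΘO₁, hΘsymm⟩ := exists_openPartialHomeomorph_of_contDiffOn hO₁ hΨ hz₀ heq
  have hΘsmooth : ContDiffOn ℝ ∞ Θ Θ.source := by rw [hΘ]; exact hΨ.mono hΘO₁
  have hsrc₀ : σ a₀ ∈ Θ.target := by
    rw [← hΨz₀, ← hΘ]; exact Θ.map_source hz₀Θ
  have hval₀ : Θ.symm (σ a₀) = z₀ := by
    rw [← hΨz₀, ← hΘ]; exact Θ.left_inv hz₀Θ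
  refine ⟨Θ.symm, hsrc₀, ?_, hΘsymm, hΘsmooth, ?_, hval₀, ?_, ?_⟩
  · intro p hp
    have := Θ.map_target hp
    have h2 := (hγZ _ (hΘO₁ this).2).1
    have h3 : Θ (Θ.symm p) = p := Θ.right_inv hp
    rw [hΘ] at h3
    rwa [← h3]
  · intro i p hp
    have h1 := Θ.map_target hp
    have h2 := Θ.right_inv hp
    have h3 := OpenPartialHomeomorph.fderiv_symm_fderiv hΘsmooth hΘsymm h1 (0, Pi.single i 1, 0)
    rw [h2, hΘ, hΨZ _ (hΘO₁ h1)] at h3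
    rw [hΘ] at h2
    rwa [h2] at h3
  · intro t v hz
    have hz : (t, 0, v) ∈ Θ.source := hz
    refine ⟨(hΘO₁ hz).1, ?_⟩
    rw [OpenPartialHomeomorph.symm_symm, hΘ]
    exact hγ0 _ (hΘO₁ hz).2
  · intro a
    have h3 := OpenPartialHomeomorph.fderiv_symm_fderiv hΘsmooth hΘsymm hz₀Θ (a.1, 0, a.2)
    rw [hΘ, hslice z₀ hz₀ rfl, hΨz₀] at h3
    exact h3

end Straightening

/-! ### Brackets of related fields and of symmetries -/

section Bracket

variable {E : Type*} [NormedAddCommGroup E] [NormedSpace ℝ E]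
  {F : Type*} [NormedAddCommGroup F] [NormedSpace ℝ F]

theorem minSmoothness_two_le_infty : minSmoothness ℝ 2 ≤ ∞ := by
  rw [minSmoothness_of_isRCLikeNormedField]
  exact WithTop.coe_le_coe.2 le_top

theorem ContDiffOn.hasFDerivAt_of_isOpen {f : E → F} {O : Set E} (hf : ContDiffOn ℝ ∞ f O)
    (hO : IsOpen O) {p : E} (hp : p ∈ O) : HasFDerivAt f (fderiv ℝ f p) p :=
  ((hf.contDiffAt (hO.mem_nhds hp)).differentiableAt (by simp)).hasFDerivAt

theorem ContDiffOn.fderiv_apply {f : E → F} {V : E → E} {O : Set E} (hf : ContDiffOn ℝ ∞ f O)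
    (hO : IsOpen O) (hV : ContDiffOn ℝ ∞ V O) : ContDiffOn ℝ ∞ (fun p => fderiv ℝ f p (V p)) O :=
  (hf.fderiv_of_isOpen hO (by simp)).clm_apply hV

theorem contDiffOn_lieBracket {V W : E → E} {O : Set E} (hO : IsOpen O)
    (hV : ContDiffOn ℝ ∞ V O) (hW : ContDiffOn ℝ ∞ W O) :
    ContDiffOn ℝ ∞ (VectorField.lieBracket ℝ V W) O :=
  (hW.fderiv_apply hO hV).sub (hV.fderiv_apply hO hW)

theorem lieBracket_congr_of_isOpen {V V' W W' : E → E} {O : Set E} (hO : IsOpen O) {p : E}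
    (hp : p ∈ O) (hV : ∀ q ∈ O, V q = V' q) (hW : ∀ q ∈ O, W q = W' q) :
    VectorField.lieBracket ℝ V W p = VectorField.lieBracket ℝ V' W' p :=
  Filter.EventuallyEq.lieBracket_vectorField_eq (Filter.eventually_of_mem (hO.mem_nhds hp) hV)
    (Filter.eventually_of_mem (hO.mem_nhds hp) hW)

/-- The bracket of related vector fields is related to the bracket. -/
theorem fderiv_lieBracket_of_related {f : E → F} {O : Set E} (hO : IsOpen O)
    (hf : ContDiffOn ℝ ∞ f O) {V W : E → E} {V' W' : F → F} {p : E} (hp : p ∈ O)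
    (hV : DifferentiableAt ℝ V p) (hW : DifferentiableAt ℝ W p)
    (hV' : DifferentiableAt ℝ V' (f p)) (hW' : DifferentiableAt ℝ W' (f p))
    (hVf : ∀ q ∈ O, fderiv ℝ f q (V q) = V' (f q)) (hWf : ∀ q ∈ O, fderiv ℝ f q (W q) = W' (f q)) :
    fderiv ℝ f p (VectorField.lieBracket ℝ V W p) = VectorField.lieBracket ℝ V' W' (f p) := by
  have hfp := hf.hasFDerivAt_of_isOpen hO hp
  have key : ∀ {X : E → E} {X' : F → F}, DifferentiableAt ℝ X' (f p) →
      (∀ q ∈ O, fderiv ℝ f q (X q) = X' (f q)) → ∀ v,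
      fderiv ℝ (fun q => fderiv ℝ f q (X q)) p v = fderiv ℝ X' (f p) (fderiv ℝ f p v) := by
    intro X X' hX' hX v
    have h1 : (fun q => fderiv ℝ f q (X q)) =ᶠ[𝓝 p] fun q => X' (f q) :=
      Filter.eventually_of_mem (hO.mem_nhds hp) hX
    rw [h1.fderiv_eq]
    exact congrArg (fun A => A v) (hX'.hasFDerivAt.comp p hfp).fderiv
  -- The second derivatives of `f` cancel by symmetry; what remains are the derivatives of the two
  -- relations.
  rw [VectorField.fderiv_apply_lieBracket (hf.contDiffAt (hO.mem_nhds hp))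
    minSmoothness_two_le_infty hW hV,
    key hW' hWf, key hV' hVf, hVf p hp, hWf p hp]
  rfl

/-- If `[X, A]` and `[Y, A]` are multiples of `A`, then so is `[[X, Y], A]`. -/
theorem lieBracket_lieBracket_eq_smul {X Y A : E → E} {f g : E → ℝ} {O : Set E}
    (hO : IsOpen O) (hX : ContDiffOn ℝ ∞ X O) (hY : ContDiffOn ℝ ∞ Y O) (hA : ContDiffOn ℝ ∞ A O)
    (hf : ContDiffOn ℝ ∞ f O) (hg : ContDiffOn ℝ ∞ g O)
    (hXA : ∀ p ∈ O, VectorField.lieBracket ℝ X A p = f p • A p)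
    (hYA : ∀ p ∈ O, VectorField.lieBracket ℝ Y A p = g p • A p) {p : E} (hp : p ∈ O) :
    VectorField.lieBracket ℝ (VectorField.lieBracket ℝ X Y) A p =
      (fderiv ℝ g p (X p) - fderiv ℝ f p (Y p)) • A p := by
  have hA' := (hA.hasFDerivAt_of_isOpen hO hp).differentiableAt
  have hJ := VectorField.leibniz_identity_lieBracket (𝕜 := ℝ) minSmoothness_two_le_infty
    (hX.contDiffAt (hO.mem_nhds hp)) (hY.contDiffAt (hO.mem_nhds hp))
    (hA.contDiffAt (hO.mem_nhds hp))
  rw [lieBracket_congr_of_isOpen hO hp (fun _ _ => rfl) hYA,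
    lieBracket_congr_of_isOpen hO hp (fun _ _ => rfl) hXA,
    VectorField.lieBracket_smul_right (hg.hasFDerivAt_of_isOpen hO hp).differentiableAt hA',
    VectorField.lieBracket_smul_right (hf.hasFDerivAt_of_isOpen hO hp).differentiableAt hA',
    hXA p hp, hYA p hp] at hJ
  rw [← sub_eq_iff_eq_add] at hJ
  rw [← hJ]
  module

end Bracket

/-! ### Coordinates of the phase space and prolongation -/

section Jets

variable {k : ℕ} (ord : Fin k → ℕ)

/-- The coordinate `y_μ^(j)` as a continuous linear function. -/
def jetCoordL (μ : Fin k) (j : ℕ) : Phase (∑ ν, ord ν) →L[ℝ] ℝ :=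
  if h : j < ord μ then
    (ContinuousLinearMap.proj (finSigmaFinEquiv ⟨μ, ⟨j, h⟩⟩)).comp
      (ContinuousLinearMap.snd ℝ ℝ (Fin (∑ ν, ord ν) → ℝ))
  else 0

theorem coe_jetCoordL (μ : Fin k) (j : ℕ) : ⇑(jetCoordL ord μ j) = jetCoord ord μ j := by
  funext p
  unfold jetCoordL jetCoord
  split_ifs <;> rfl

/-- The projection to the space of independent and dependent variables as a continuous linear
map. -/
def baseProjL : Phase (∑ ν, ord ν) →L[ℝ] Phase k :=
  (ContinuousLinearMap.fst ℝ ℝ (Fin (∑ ν, ord ν) → ℝ)).prod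
    (ContinuousLinearMap.pi fun μ => jetCoordL ord μ 0)

theorem coe_baseProjL : ⇑(baseProjL ord) = baseProj ord := by
  funext p
  refine Prod.ext rfl (funext fun μ => ?_)
  exact congrFun (coe_jetCoordL ord μ 0) p

theorem contDiff_jetCoord (μ : Fin k) (j : ℕ) : ContDiff ℝ ∞ (jetCoord ord μ j) := by
  rw [← coe_jetCoordL]; exact (jetCoordL ord μ j).contDiff

theorem contDiff_baseProj : ContDiff ℝ ∞ (baseProj ord) := by
  rw [← coe_baseProjL]; exact (baseProjL ord).contDiff

theorem fderiv_baseProj (p : Phase (∑ ν, ord ν)) : fderiv ℝ (baseProj ord) p = baseProjL ord := by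
  rw [← coe_baseProjL]; exact (baseProjL ord).fderiv

theorem jetCoord_finSigmaFinEquiv_symm (a : Fin (∑ ν, ord ν)) (p : Phase (∑ ν, ord ν)) :
    jetCoord ord (finSigmaFinEquiv.symm a).1 (finSigmaFinEquiv.symm a).2 p = p.2 a := by
  unfold jetCoord
  rw [dif_pos (finSigmaFinEquiv.symm a).2.2]
  exact congrArg p.2 (finSigmaFinEquiv.apply_symm_apply a)

theorem phase_ext {p q : Phase (∑ ν, ord ν)} (h : p.1 = q.1)
    (h' : ∀ μ j, j < ord μ → jetCoord ord μ j p = jetCoord ord μ j q) : p = q := by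
  refine Prod.ext h (funext fun a => ?_)
  rw [← jetCoord_finSigmaFinEquiv_symm, ← jetCoord_finSigmaFinEquiv_symm]
  exact h' _ _ (finSigmaFinEquiv.symm a).2.2

theorem jetCoord_mk (t : ℝ) (g : (μ : Fin k) → ℕ → ℝ) (μ : Fin k) {j : ℕ} (hj : j < ord μ) :
    jetCoord ord μ j ((t, fun a => g (finSigmaFinEquiv.symm a).1 (finSigmaFinEquiv.symm a).2) :
      Phase (∑ ν, ord ν)) = g μ j := by
  unfold jetCoord
  rw [dif_pos hj]
  exact congrArg (fun s : (μ : Fin k) × Fin (ord μ) => g s.1 s.2)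
    (finSigmaFinEquiv.symm_apply_apply ⟨μ, ⟨j, hj⟩⟩)

theorem jetCoord_prolong (Ω : Phase (∑ ν, ord ν) → Fin k → ℝ) (Z : Phase k → Phase k)
    (p : Phase (∑ ν, ord ν)) (μ : Fin k) {j : ℕ} (hj : j < ord μ) :
    jetCoord ord μ j (prolong ord Ω Z p) = prolongCoeff ord Ω Z μ j p :=
  jetCoord_mk ord _ (fun μ j => prolongCoeff ord Ω Z μ j p) μ hj

theorem jetCoord_odeField (Ω : Phase (∑ ν, ord ν) → Fin k → ℝ)
    (p : Phase (∑ ν, ord ν)) (μ : Fin k) {j : ℕ} (hj : j < ord μ) :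
    jetCoord ord μ j (odeField ord Ω p) =
      if j + 1 < ord μ then jetCoord ord μ (j + 1) p else Ω p μ :=
  jetCoord_mk ord _ (fun μ j => if j + 1 < ord μ then jetCoord ord μ (j + 1) p else Ω p μ) μ hj

variable {ord}
variable {U : Set (Phase (∑ ν, ord ν))} {Ω : Phase (∑ ν, ord ν) → Fin k → ℝ} {D : Set (Phase k)}

theorem baseProj_prolong (hord : ∀ μ, 1 ≤ ord μ) (Z : Phase k → Phase k)
    (p : Phase (∑ ν, ord ν)) : baseProj ord (prolong ord Ω Z p) = Z (baseProj ord p) :=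
  Prod.ext rfl (funext fun μ => jetCoord_prolong ord Ω Z p μ (hord μ))

theorem contDiffOn_firstOrderRhs (hΩ : ContDiffOn ℝ ∞ Ω U) :
    ContDiffOn ℝ ∞ (firstOrderRhs ord Ω) U := by
  rw [contDiffOn_pi]
  intro a
  unfold firstOrderRhs
  by_cases h : ((finSigmaFinEquiv.symm a).2 : ℕ) + 1 < ord (finSigmaFinEquiv.symm a).1
  · simp only [h, if_true]
    exact (contDiff_jetCoord ord _ _).contDiffOn
  · simp only [h, if_false]
    exact contDiffOn_pi.1 hΩ _

theorem contDiffOn_odeField (hΩ : ContDiffOn ℝ ∞ Ω U) : ContDiffOn ℝ ∞ (odeField ord Ω) U :=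
  contDiffOn_const.prodMk (contDiffOn_firstOrderRhs hΩ)

theorem contDiffOn_comp_baseProj (hUD : MapsTo (baseProj ord) U D) {Z : Phase k → Phase k}
    (hZ : ContDiffOn ℝ ∞ Z D) : ContDiffOn ℝ ∞ (fun p => Z (baseProj ord p)) U :=
  hZ.comp (contDiff_baseProj ord).contDiffOn hUD

theorem contDiffOn_prolongCoeff (hU : IsOpen U) (hΩ : ContDiffOn ℝ ∞ Ω U)
    (hUD : MapsTo (baseProj ord) U D) {Z : Phase k → Phase k} (hZ : ContDiffOn ℝ ∞ Z D)
    (μ : Fin k) (j : ℕ) : ContDiffOn ℝ ∞ (prolongCoeff ord Ω Z μ j) U := by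
  have hA := contDiffOn_odeField hΩ
  have hZ' := contDiffOn_comp_baseProj hUD hZ
  induction j with
  | zero => exact contDiffOn_pi.1 hZ'.snd μ
  | succ j ih =>
    exact (ih.fderiv_apply hU hA).sub
      ((contDiff_jetCoord ord μ (j + 1)).contDiffOn.mul (hZ'.fst.fderiv_apply hU hA))

theorem contDiffOn_prolong (hU : IsOpen U) (hΩ : ContDiffOn ℝ ∞ Ω U)
    (hUD : MapsTo (baseProj ord) U D) {Z : Phase k → Phase k} (hZ : ContDiffOn ℝ ∞ Z D) :
    ContDiffOn ℝ ∞ (prolong ord Ω Z) U :=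
  (contDiffOn_comp_baseProj hUD hZ).fst.prodMk
    (contDiffOn_pi.2 fun _ => contDiffOn_prolongCoeff hU hΩ hUD hZ _ _)

/-- A vector field on the phase space whose bracket with the operator of the system is a multiple
of the operator is the prolongation of its projection to the space of variables. -/
theorem eq_prolong_of_lieBracket (hU : IsOpen U) (hΩ : ContDiffOn ℝ ∞ Ω U)
    {V : Phase (∑ ν, ord ν) → Phase (∑ ν, ord ν)} (hV : ContDiffOn ℝ ∞ V U)
    {Z : Phase k → Phase k} (hVZ : ∀ p ∈ U, baseProj ord (V p) = Z (baseProj ord p))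
    (hsymm : ∀ p ∈ U, ∃ c : ℝ,
      VectorField.lieBracket ℝ V (odeField ord Ω) p = c • odeField ord Ω p)
    {p : Phase (∑ ν, ord ν)} (hp : p ∈ U) : V p = prolong ord Ω Z p := by
  have hA := contDiffOn_odeField hΩ
  -- The bracket relation read in one linear coordinate `f`: `V (A f) - A (V f) = c (A f)`.
  have key : ∀ (f : Phase (∑ ν, ord ν) →L[ℝ] ℝ) (g h : Phase (∑ ν, ord ν) → ℝ),
      (∀ q ∈ U, f (odeField ord Ω q) = g q) → (∀ q ∈ U, f (V q) = h q) → ∀ q ∈ U, ∀ c : ℝ,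
      VectorField.lieBracket ℝ V (odeField ord Ω) q = c • odeField ord Ω q →
      fderiv ℝ g q (V q) - fderiv ℝ h q (odeField ord Ω q) = c * g q := by
    intro f g h hg hh q hq c hc
    have h1 : g =ᶠ[𝓝 q] fun q => f (odeField ord Ω q) :=
      Filter.eventually_of_mem (hU.mem_nhds hq) fun q hq => (hg q hq).symm
    have h2 : h =ᶠ[𝓝 q] fun q => f (V q) :=
      Filter.eventually_of_mem (hU.mem_nhds hq) fun q hq => (hh q hq).symm
    have h3 : fderiv ℝ (fun q => f (odeField ord Ω q)) q = _ :=
      (f.hasFDerivAt.comp q (hA.hasFDerivAt_of_isOpen hU hq)).fderiv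
    have h4 : fderiv ℝ (fun q => f (V q)) q = _ :=
      (f.hasFDerivAt.comp q (hV.hasFDerivAt_of_isOpen hU hq)).fderiv
    rw [h1.fderiv_eq, h2.fderiv_eq, h3, h4, ← hg q hq]
    have := congrArg f hc
    rw [map_smul, VectorField.lieBracket, map_sub] at this
    exact this
  -- The coordinate `x`, with `A x = 1`, determines the factor.
  have hc : ∀ q ∈ U, VectorField.lieBracket ℝ V (odeField ord Ω) q =
      (-(fderiv ℝ (fun q => (Z (baseProj ord q)).1) q (odeField ord Ω q))) • odeField ord Ω q := by
    intro q hq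
    obtain ⟨c, hc⟩ := hsymm q hq
    have := key (ContinuousLinearMap.fst ℝ ℝ (Fin (∑ ν, ord ν) → ℝ)) (fun _ => 1)
      (fun q => (Z (baseProj ord q)).1) (fun _ _ => rfl)
      (fun q hq => congrArg Prod.fst (hVZ q hq)) q hq c hc
    simp only [fderiv_fun_const, Pi.zero_apply, zero_apply, zero_sub, mul_one] at this
    rw [this, hc]
  -- With the factor known, the coordinate `y_μ^(j)` gives the recursion that defines the
  -- prolongation coefficients.
  have hcoord : ∀ μ j, j < ord μ → ∀ q ∈ U,
      jetCoord ord μ j (V q) = prolongCoeff ord Ω Z μ j q := by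
    intro μ j
    induction j with
    | zero => exact fun _ q hq => congrFun (congrArg Prod.snd (hVZ q hq)) μ
    | succ j ih =>
      intro hj q hq
      have := key (jetCoordL ord μ j) (jetCoord ord μ (j + 1)) (prolongCoeff ord Ω Z μ j)
        (fun q _ => by
          rw [coe_jetCoordL, jetCoord_odeField _ _ _ _ (by omega), if_pos hj])
        (fun q hq => by rw [coe_jetCoordL]; exact ih (by omega) q hq) q hq _ (hc q hq)
      rw [← coe_jetCoordL, ContinuousLinearMap.fderiv, coe_jetCoordL] at this
      rw [prolongCoeff]
      linarith
  have h₁ : (V p).1 = (prolong ord Ω Z p).1 :=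
    congrArg (fun z : Phase k => z.1) (hVZ p hp)
  refine phase_ext ord h₁ fun μ j hj => ?_
  rw [hcoord μ j hj p hp, jetCoord_prolong _ _ _ _ _ hj]

variable {L : Type*} [LieRing L] [LieAlgebra ℝ L] {ρ : L →ₗ[ℝ] (Phase k → Phase k)}

/-- The prolongations of a Lie algebra of point symmetries are symmetries that represent it. -/
theorem IsPointSymmetryAlgebra.isSymmetric (hord : ∀ μ, 1 ≤ ord μ) (hU : IsOpen U)
    (hΩ : ContDiffOn ℝ ∞ Ω U) (hD : IsOpen D) (hUD : MapsTo (baseProj ord) U D)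
    (hρ : IsPointSymmetryAlgebra ord U Ω D ρ) : (odeSymSystem ord Ω ρ U).IsSymmetric := by
  have hA := contDiffOn_odeField hΩ
  have hsm : ∀ X, ContDiffOn ℝ ∞ (prolong ord Ω (ρ X)) U := fun X =>
    contDiffOn_prolong hU hΩ hUD (hρ.smooth X)
  have hξ : ∀ X, ContDiffOn ℝ ∞
      (fun p => fderiv ℝ (fun q => (ρ X (baseProj ord q)).1) p (odeField ord Ω p)) U := fun X =>
    (contDiffOn_comp_baseProj hUD (hρ.smooth X)).fst.fderiv_apply hU hA
  -- A linear combination of prolongations satisfies the bracket condition, so it is the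
  -- prolongation of its projection. Brackets are treated in the same way below, with the Jacobi
  -- identity.
  have hlin : ∀ (X Y : L) (c : ℝ), ∀ p ∈ U, prolong ord Ω (ρ (c • X + Y)) p =
      c • prolong ord Ω (ρ X) p + prolong ord Ω (ρ Y) p := by
    intro X Y c p hp
    refine (eq_prolong_of_lieBracket hU hΩ (V := fun p => c • prolong ord Ω (ρ X) p +
      prolong ord Ω (ρ Y) p) (((hsm X).const_smul c).add (hsm Y))
      (fun q _ => ?_) (fun q hq => ?_) hp).symm
    · rw [← coe_baseProjL, map_add, map_smul, coe_baseProjL, baseProj_prolong hord,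
        baseProj_prolong hord, map_add, map_smul]
      rfl
    · have hX := ((hsm X).hasFDerivAt_of_isOpen hU hq).differentiableAt
      have hY := ((hsm Y).hasFDerivAt_of_isOpen hU hq).differentiableAt
      have h1 := VectorField.lieBracket_add_left (W := odeField ord Ω) (hX.const_smul c) hY
      have h2 := VectorField.lieBracket_const_smul_left (W := odeField ord Ω) (c := c) hX
      have hX' := hρ.symm X q hq
      have hY' := hρ.symm Y q hq
      rw [h2, hX', hY', smul_smul, ← add_smul] at h1
      exact ⟨_, h1⟩
  refine ⟨hU, contDiffOn_firstOrderRhs hΩ, hsm, fun X Y p hp => ?_, fun c X p hp => ?_,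
    fun X Y p hp => ?_, hρ.symm⟩
  · have := hlin X Y 1 p hp
    rwa [one_smul, one_smul] at this
  · have h0 : prolong ord Ω (ρ (0 : L)) p = 0 := by
      have := hlin 0 0 1 p hp
      rw [one_smul, one_smul, add_zero] at this
      simpa using this
    have := hlin X 0 c p hp
    rwa [add_zero, h0, add_zero] at this
  · refine eq_prolong_of_lieBracket hU hΩ (contDiffOn_lieBracket hU (hsm X) (hsm Y))
      (fun q hq => ?_) (fun q hq => ⟨_, lieBracket_lieBracket_eq_smul hU (hsm X) (hsm Y) hA
        (hξ X).neg (hξ Y).neg (hρ.symm X) (hρ.symm Y) hq⟩) hp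
    have hd : ∀ X, DifferentiableAt ℝ (ρ X) (baseProj ord q) := fun X =>
      ((hρ.smooth X).hasFDerivAt_of_isOpen hD (hUD hq)).differentiableAt
    have := fderiv_lieBracket_of_related hU (contDiff_baseProj ord).contDiffOn hq
      ((hsm X).hasFDerivAt_of_isOpen hU hq).differentiableAt
      ((hsm Y).hasFDerivAt_of_isOpen hU hq).differentiableAt (hd X) (hd Y)
      (fun q _ => by rw [fderiv_baseProj, coe_baseProjL, baseProj_prolong hord])
      (fun q _ => by rw [fderiv_baseProj, coe_baseProjL, baseProj_prolong hord])
    rw [fderiv_baseProj, coe_baseProjL, hρ.lie X Y _ (hUD hq)] at this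
    exact this

end Jets

/-! ### Systems with symmetries -/

namespace SymSystem

variable {L : Type*} {N : ℕ}

/-- The system restricted to a smaller domain. -/
def restrict (S : SymSystem L N) (W : Set (Phase N)) : SymSystem L N := { S with dom := W }

theorem contDiffOn_field {S : SymSystem L N} (h : ContDiffOn ℝ ∞ S.rhs S.dom) :
    ContDiffOn ℝ ∞ S.field S.dom := contDiffOn_const.prodMk h

section

variable [LieRing L] [LieAlgebra ℝ L] {S : SymSystem L N}

namespace IsSymmetric

theorem restrict (hS : S.IsSymmetric) {W : Set (Phase N)} (hW : IsOpen W) (h : W ⊆ S.dom) :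
    (S.restrict W).IsSymmetric :=
  ⟨hW, hS.smooth_rhs.mono h, fun X => (hS.smooth_gen X).mono h,
    fun X Y p hp => hS.add X Y p (h hp), fun c X p hp => hS.smul c X p (h hp),
    fun X Y p hp => hS.lie X Y p (h hp), fun X p hp => hS.symm X p (h hp)⟩

theorem smooth_field (hS : S.IsSymmetric) : ContDiffOn ℝ ∞ S.field S.dom :=
  contDiffOn_field hS.smooth_rhs

theorem gen_zero (hS : S.IsSymmetric) {p : Phase N} (hp : p ∈ S.dom) : S.gen 0 p = 0 := by
  simpa using hS.smul 0 0 p hp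

/-- The values of the generators at a point, as a linear map. -/
def genL (hS : S.IsSymmetric) {p : Phase N} (hp : p ∈ S.dom) : L →ₗ[ℝ] Phase N where
  toFun X := S.gen X p
  map_add' X Y := hS.add X Y p hp
  map_smul' c X := hS.smul c X p hp

theorem gen_sum (hS : S.IsSymmetric) {p : Phase N} (hp : p ∈ S.dom) {d : ℕ} (c : Fin d → ℝ)
    (b : Fin d → L) : S.gen (∑ i, c i • b i) p = ∑ i, c i • S.gen (b i) p := by
  have := map_sum (hS.genL hp) (fun i => c i • b i) Finset.univ
  simp only [map_smul] at this
  exact this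

theorem gen_sub (hS : S.IsSymmetric) {p : Phase N} (hp : p ∈ S.dom) (X Y : L) :
    S.gen (X - Y) p = S.gen X p - S.gen Y p := map_sub (hS.genL hp) X Y

/-- Elements already used vanish on the system, so the field of `X` depends only on its class modulo
`h`. -/
theorem gen_eq_sum (hS : S.IsSymmetric) {h : Submodule ℝ L}
    (hz : ∀ X ∈ h, ∀ p ∈ S.dom, S.gen X p = 0) {d : ℕ} {b : Fin d → L} {X : L} {c : Fin d → ℝ}
    (hc : X - ∑ i, c i • b i ∈ h) {p : Phase N} (hp : p ∈ S.dom) :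
    S.gen X p = ∑ i, c i • S.gen (b i) p := by
  rw [← hS.gen_sum hp, ← sub_eq_zero, ← hS.gen_sub hp]
  exact hz _ hc p hp

end IsSymmetric

end

/-- If the bracket of a vector field with the operator of a system is a multiple of the operator,
the factor is determined. -/
theorem lieBracket_field_eq {S : SymSystem L N} {X : Phase N → Phase N} {p : Phase N}
    (hX : DifferentiableAt ℝ X p) (hf : DifferentiableAt ℝ S.field p) {c : ℝ}
    (hc : VectorField.lieBracket ℝ X S.field p = c • S.field p) :
    VectorField.lieBracket ℝ X S.field p =
      -(fderiv ℝ (fun q => (X q).1) p (S.field p)) • S.field p := by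
  -- The operator has constant first component `1`, so the first component of the bracket is just
  -- `-A ξ`.
  have h1 := hf.hasFDerivAt.fst.unique (hasFDerivAt_const (1 : ℝ) p)
  have h2 := hX.hasFDerivAt.fst.fderiv
  have h3 := congrArg Prod.fst hc
  have h4 := congrArg (fun A => A (X p)) h1
  simp only [ContinuousLinearMap.comp_apply, ContinuousLinearMap.coe_fst', zero_apply] at h4
  rw [h2, hc]
  congr 1
  simp only [VectorField.lieBracket, Prod.fst_sub, h4, zero_sub, Prod.smul_fst, smul_eq_mul] at h3
  rw [ContinuousLinearMap.comp_apply, ContinuousLinearMap.coe_fst', h3]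
  exact (mul_one c).symm

end SymSystem

/-! ### Functions that do not depend on `s` -/

section Normal

variable {d e : ℕ}

/-- A function on a box that is annihilated by all `∂_{s_i}` does not depend on `s`. -/
theorem eq_of_fderiv_normal_eq_zero {G : Type*} [NormedAddCommGroup G] [NormedSpace ℝ G]
    {g : ℝ × (Fin d → ℝ) × (Fin e → ℝ) → G} {K : Set (Fin d → ℝ)} (hK : Convex ℝ K) (t : ℝ)
    (v : Fin e → ℝ) (hg : ∀ s ∈ K, DifferentiableAt ℝ g (t, s, v))
    (h0 : ∀ s ∈ K, ∀ i, fderiv ℝ g (t, s, v) (0, Pi.single i 1, 0) = 0)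
    {s s' : Fin d → ℝ} (hs : s ∈ K) (hs' : s' ∈ K) : g (t, s, v) = g (t, s', v) := by
  let inc : (Fin d → ℝ) →L[ℝ] ℝ × (Fin d → ℝ) × (Fin e → ℝ) :=
    (ContinuousLinearMap.inr ℝ ℝ _).comp (ContinuousLinearMap.inl ℝ (Fin d → ℝ) (Fin e → ℝ))
  have hinc : ∀ u : Fin d → ℝ, ∀ s ∈ K, fderiv ℝ g (t, s, v) (inc u) = 0 := by
    intro u s hs
    have : inc u = ∑ i, u i • ((0, Pi.single i 1, 0) : ℝ × (Fin d → ℝ) × (Fin e → ℝ)) := by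
      rw [sum_smul_single]; rfl
    rw [this, map_sum]
    exact Finset.sum_eq_zero fun i _ => by rw [map_smul, h0 s hs i, smul_zero]
  have hder : ∀ s ∈ K, HasFDerivWithinAt (fun s => g (t, s, v))
      ((fderiv ℝ g (t, s, v)).comp inc) K s := by
    intro s hs
    have h0 : (fun s : Fin d → ℝ => (t, s, v)) = fun s => (t, 0, v) + inc s := by
      funext s
      simp [inc]
    have h1 : HasFDerivAt (fun s : Fin d → ℝ => (t, s, v)) inc s := by
      rw [h0]
      exact inc.hasFDerivAt.const_add _
    exact ((hg s hs).hasFDerivAt.comp s h1).hasFDerivWithinAt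
  have := hK.norm_image_sub_le_of_norm_hasFDerivWithin_le (C := 0) hder (fun s hs => by
    rw [show (fderiv ℝ g (t, s, v)).comp inc = 0 from
      ContinuousLinearMap.ext fun u => hinc u s hs, norm_zero]) hs hs'
  rw [zero_mul, norm_le_zero_iff, sub_eq_zero] at this
  exact this.symm

theorem dropNormal_image_ball (z : ℝ × (Fin d → ℝ) × (Fin e → ℝ)) {ε : ℝ} (hε : 0 < ε) :
    dropNormal '' Metric.ball z ε = Metric.ball (dropNormal z) ε := by
  ext w
  constructor
  · rintro ⟨z', hz', rfl⟩
    rw [← ball_prod_same, ← ball_prod_same] at hz'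
    rw [Metric.mem_ball, Prod.dist_eq, max_lt_iff]
    exact ⟨hz'.1, hz'.2.2⟩
  · intro hw
    rw [Metric.mem_ball, Prod.dist_eq, max_lt_iff] at hw
    refine ⟨(w.1, z.2.1, w.2), ?_, rfl⟩
    rw [← ball_prod_same, ← ball_prod_same]
    exact ⟨hw.1, Metric.mem_ball_self hε, hw.2⟩

end Normal

/-! ### One step of the first integration method -/

section Reduction

variable {L : Type*} [LieRing L] [LieAlgebra ℝ L] {N d e : ℕ}

/-- The elements of the algebra that have been used up vanish on the reduced system. -/
theorem IsFirstIntegration.gen_eq_zero {h h' : Submodule ℝ L} {S : SymSystem L N} {b : Fin d → L}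
    {Φ : OpenPartialHomeomorph (Phase N) (ℝ × (Fin d → ℝ) × (Fin e → ℝ))}
    {F : Phase e → Fin d → ℝ} {S' : SymSystem L e} (H : IsFirstIntegration h h' S b Φ F S')
    (hS : S.IsSymmetric) (hz : ∀ X ∈ h, ∀ p ∈ S.dom, S.gen X p = 0) {X : L} (hX : X ∈ h')
    {w : Phase e} (hw : w ∈ S'.dom) : S'.gen X w = 0 := by
  rw [H.dom] at hw
  obtain ⟨z, hz', rfl⟩ := hw
  have hp : Φ.symm z ∈ S.dom := H.source ▸ Φ.map_target hz'
  obtain ⟨c, hc, -⟩ := H.basis X hX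
  have := H.reduced X _ hp
  rw [Φ.right_inv hz'] at this
  rw [this, hS.gen_eq_sum hz hc hp, map_sum]
  simp only [map_smul, H.normal _ _ hp, sum_smul_single]
  rfl

/-- A step of the first integration method can be restricted to any part of the reduced system. -/
theorem IsFirstIntegration.restrict {h h' : Submodule ℝ L} {S : SymSystem L N} {b : Fin d → L}
    {Φ : OpenPartialHomeomorph (Phase N) (ℝ × (Fin d → ℝ) × (Fin e → ℝ))}
    {F : Phase e → Fin d → ℝ} {S' : SymSystem L e} (H : IsFirstIntegration h h' S b Φ F S')
    {W' : Set (Phase e)} (hsub : W' ⊆ S'.dom)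
    (hW : IsOpen (dropNormal (d := d) (e := e) ⁻¹' W')) :
    IsFirstIntegration h h' (S.restrict (Φ.source ∩ Φ ⁻¹' (dropNormal ⁻¹' W'))) b
      (Φ.symm.restrOpen _ hW).symm F (S'.restrict W') := by
  have hsrc : (Φ.symm.restrOpen _ hW).symm.source =
      Φ.source ∩ Φ ⁻¹' (dropNormal ⁻¹' W') := rfl
  have hsub' : Φ.source ∩ Φ ⁻¹' (dropNormal ⁻¹' W') ⊆ Φ.source := inter_subset_left
  refine ⟨H.le, H.mem, H.basis, hsrc, H.smooth.mono hsub', ?_, H.smooth_quad.mono hsub, ?_,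
    fun i p hp => H.normal i p (H.source ▸ hp.1), fun p hp => H.split p (H.source ▸ hp.1),
    fun X p hp => H.reduced X p (H.source ▸ hp.1)⟩
  · exact H.smooth_symm.mono inter_subset_left
  · change W' = dropNormal '' (Φ.target ∩ dropNormal ⁻¹' W')
    rw [image_inter_preimage, ← H.dom, inter_eq_self_of_subset_right hsub]

/-- One step of the first integration method near a point, in given coordinates in which the
generators of the coset have their normal form. -/
theorem exists_isFirstIntegration {h h' : Submodule ℝ L} (hle : h ≤ h')
    (hideal : ∀ X ∈ h', ∀ Y, ⁅X, Y⁆ ∈ h') {S : SymSystem L N} (hS : S.IsSymmetric)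
    (hz : ∀ X ∈ h, ∀ p ∈ S.dom, S.gen X p = 0) {b : Fin d → L} (hb : ∀ i, b i ∈ h')
    (hbasis : ∀ X ∈ h', ∃! c : Fin d → ℝ, X - ∑ i, c i • b i ∈ h)
    {Φ : OpenPartialHomeomorph (Phase N) (ℝ × (Fin d → ℝ) × (Fin e → ℝ))}
    (hsource : Φ.source ⊆ S.dom) (hsmooth : ContDiffOn ℝ ∞ Φ Φ.source)
    (hsymm : ContDiffOn ℝ ∞ Φ.symm Φ.target)
    (hnormal : ∀ i, ∀ p ∈ Φ.source, fderiv ℝ Φ p (S.gen (b i) p) = (0, Pi.single i 1, 0))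
    {p₀ : Phase N} (hp₀ : p₀ ∈ Φ.source) (ht : (fderiv ℝ Φ p₀ (S.field p₀)).1 ≠ 0) :
    ∃ ε > 0, Metric.ball (Φ p₀) ε ⊆ Φ.target ∧
      ∃ (F : Phase e → Fin d → ℝ) (S' : SymSystem L e), S'.IsSymmetric ∧
        S'.dom = Metric.ball (dropNormal (Φ p₀)) ε ∧
        IsFirstIntegration h h' (S.restrict (Φ.source ∩ Φ ⁻¹' Metric.ball (Φ p₀) ε)) b
          (Φ.symm.restrOpen _ (Metric.isOpen_ball (x := Φ p₀) (ε := ε))).symm F S' := by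
  let T := ℝ × (Fin d → ℝ) × (Fin e → ℝ)
  have hfield := hS.smooth_field
  have hpush : ∀ {V : Phase N → Phase N}, ContDiffOn ℝ ∞ V S.dom →
      ContDiffOn ℝ ∞ (fun z => fderiv ℝ Φ (Φ.symm z) (V (Φ.symm z))) Φ.target := by
    intro V hV
    exact (hsmooth.fderiv_apply Φ.open_source (hV.mono hsource)).comp hsymm
      fun z hz => Φ.map_target hz
  let P : L → T → T := fun X z => fderiv ℝ Φ (Φ.symm z) (S.gen X (Φ.symm z))
  let A : T → T := fun z => fderiv ℝ Φ (Φ.symm z) (S.field (Φ.symm z))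
  have hP : ∀ X, ContDiffOn ℝ ∞ (P X) Φ.target := fun X => hpush (hS.smooth_gen X)
  have hA : ContDiffOn ℝ ∞ A Φ.target := hpush hfield
  have hPΦ : ∀ X, ∀ p ∈ Φ.source, fderiv ℝ Φ p (S.gen X p) = P X (Φ p) := fun X p hp => by
    simp only [P, Φ.left_inv hp]
  have hAΦ : ∀ p ∈ Φ.source, fderiv ℝ Φ p (S.field p) = A (Φ p) := fun p hp => by
    simp only [A, Φ.left_inv hp]
  have hPd : ∀ X, ∀ z ∈ Φ.target, DifferentiableAt ℝ (P X) z := fun X z hz =>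
    ((hP X).hasFDerivAt_of_isOpen Φ.open_target hz).differentiableAt
  have hAd : ∀ z ∈ Φ.target, DifferentiableAt ℝ A z := fun z hz =>
    (hA.hasFDerivAt_of_isOpen Φ.open_target hz).differentiableAt
  have hgd : ∀ X, ∀ p ∈ Φ.source, DifferentiableAt ℝ (S.gen X) p := fun X p hp =>
    ((hS.smooth_gen X).hasFDerivAt_of_isOpen hS.isOpen (hsource hp)).differentiableAt
  have hfd : ∀ p ∈ Φ.source, DifferentiableAt ℝ S.field p := fun p hp =>
    (hfield.hasFDerivAt_of_isOpen hS.isOpen (hsource hp)).differentiableAt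
  -- the derivatives along `s` of the generators and of the operator
  have hbr : ∀ (i : Fin d) {V : Phase N → Phase N} {V' : T → T}, ∀ p ∈ Φ.source,
      DifferentiableAt ℝ V p → DifferentiableAt ℝ V' (Φ p) →
      (∀ q ∈ Φ.source, fderiv ℝ Φ q (V q) = V' (Φ q)) →
      fderiv ℝ V' (Φ p) (0, Pi.single i 1, 0) =
        fderiv ℝ Φ p (VectorField.lieBracket ℝ (S.gen (b i)) V p) := by
    intro i V V' p hp hV hV' hVV'
    rw [fderiv_lieBracket_of_related Φ.open_source hsmooth hp (hgd (b i) p hp) hV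
      (differentiableAt_const ((0, Pi.single i 1, 0) : T)) hV' (hnormal i) hVV']
    simp [VectorField.lieBracket]
  -- The bracket with `b i` lies in `h'`; modulo elements of `h`, which act as zero, it is a
  -- constant combination of the `∂_{s_l}`, and these are killed by `dropNormal`.
  have hPs : ∀ X i, ∀ z ∈ Φ.target,
      dropNormalL d e (fderiv ℝ (P X) z (0, Pi.single i 1, 0)) = 0 := by
    intro X i z hz'
    have hp := Φ.map_target hz'
    obtain ⟨c, hc, -⟩ := hbasis _ (hideal (b i) (hb i) X)
    have := hbr i _ hp (hgd X _ hp) ((Φ.right_inv hz').symm ▸ hPd X z hz') (hPΦ X)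
    rw [Φ.right_inv hz', hS.lie _ _ _ (hsource hp), hS.gen_eq_sum hz hc (hsource hp),
      map_sum] at this
    simp only [map_smul, hnormal _ _ hp, sum_smul_single] at this
    rw [this]
    rfl
  have hAs : ∀ i, ∀ z ∈ Φ.target, ∃ c : ℝ, fderiv ℝ A z (0, Pi.single i 1, 0) = c • A z := by
    intro i z hz'
    have hp := Φ.map_target hz'
    have := hbr i _ hp (hfd _ hp) ((Φ.right_inv hz').symm ▸ hAd z hz') hAΦ
    rw [Φ.right_inv hz', hS.symm _ _ (hsource hp), map_smul] at this
    exact ⟨_, this⟩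
  -- the box
  have hz₀ := Φ.map_source hp₀
  have hO : IsOpen (Φ.target ∩ (fun z => (A z).1) ⁻¹' {0}ᶜ) :=
    hA.fst.continuousOn.isOpen_inter_preimage Φ.open_target isOpen_compl_singleton
  obtain ⟨ε, hε, hball⟩ := Metric.isOpen_iff.1 hO (Φ p₀) ⟨hz₀, by
    change (A (Φ p₀)).1 ∈ ({0}ᶜ : Set ℝ)
    rw [← hAΦ p₀ hp₀]; exact ht⟩
  have hballT : Metric.ball (Φ p₀) ε ⊆ Φ.target := fun z hz => (hball hz).1
  have hA0 : ∀ z ∈ Metric.ball (Φ p₀) ε, (A z).1 ≠ 0 := fun z hz => (hball hz).2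
  set s₀ : Fin d → ℝ := (Φ p₀).2.1 with hs₀
  let slice : Phase e → T := fun w => (w.1, s₀, w.2)
  have hslice : ContDiff ℝ ∞ slice := contDiff_fst.prodMk (contDiff_const.prodMk contDiff_snd)
  have hmemball : ∀ z : T, z ∈ Metric.ball (Φ p₀) ε ↔
      z.1 ∈ Metric.ball (Φ p₀).1 ε ∧ z.2.1 ∈ Metric.ball s₀ ε ∧
        z.2.2 ∈ Metric.ball (Φ p₀).2.2 ε := by
    intro z
    rw [← ball_prod_same, ← ball_prod_same]
    exact Iff.rfl
  have hslicemem : ∀ w ∈ Metric.ball (dropNormal (Φ p₀)) ε, slice w ∈ Metric.ball (Φ p₀) ε := by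
    intro w hw
    rw [Metric.mem_ball, Prod.dist_eq, max_lt_iff] at hw
    exact (hmemball _).2 ⟨hw.1, Metric.mem_ball_self hε, hw.2⟩
  have hdropmem : ∀ z ∈ Metric.ball (Φ p₀) ε,
      dropNormal z ∈ Metric.ball (dropNormal (Φ p₀)) ε := fun z hz =>
    dropNormal_image_ball (Φ p₀) hε ▸ mem_image_of_mem _ hz
  have hconst : ∀ {G : Type} [NormedAddCommGroup G] [NormedSpace ℝ G] (g : T → G),
      (∀ z ∈ Metric.ball (Φ p₀) ε, DifferentiableAt ℝ g z) →
      (∀ z ∈ Metric.ball (Φ p₀) ε, ∀ i, fderiv ℝ g z (0, Pi.single i 1, 0) = 0) →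
      ∀ z ∈ Metric.ball (Φ p₀) ε, g (slice (dropNormal z)) = g z := by
    intro G _ _ g hg hg0 z hz
    obtain ⟨h1, h2, h3⟩ := (hmemball z).1 hz
    have hm : ∀ s ∈ Metric.ball s₀ ε, (z.1, s, z.2.2) ∈ Metric.ball (Φ p₀) ε := fun s hs =>
      (hmemball _).2 ⟨h1, hs, h3⟩
    exact eq_of_fderiv_normal_eq_zero (convex_ball s₀ ε) z.1 z.2.2 (fun s hs => hg _ (hm s hs))
      (fun s hs i => hg0 _ (hm s hs) i) (Metric.mem_ball_self hε) h2
  have hPconst : ∀ X, ∀ z ∈ Metric.ball (Φ p₀) ε,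
      dropNormal (P X (slice (dropNormal z))) = dropNormal (P X z) := by
    intro X
    have hd : ∀ z ∈ Metric.ball (Φ p₀) ε, HasFDerivAt (fun z => dropNormalL d e (P X z))
        ((dropNormalL d e).comp (fderiv ℝ (P X) z)) z := fun z hz =>
      (dropNormalL d e).hasFDerivAt.comp z (hPd X z (hballT hz)).hasFDerivAt
    refine hconst (fun z => dropNormalL d e (P X z)) (fun z hz => (hd z hz).differentiableAt)
      fun z hz i => ?_
    rw [(hd z hz).fderiv]
    exact hPs X i z (hballT hz)
  -- If `∂_{s_i} A = c A`, then the quotient of `A` by its `t`-component has zero derivative along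
  -- `s_i`. This removes the freedom of scaling the operator.
  let A' : T → T := fun z => (A z).1⁻¹ • A z
  have hA' : ContDiffOn ℝ ∞ A' (Metric.ball (Φ p₀) ε) :=
    ((hA.mono hballT).fst.inv hA0).smul (hA.mono hballT)
  have hA'const : ∀ z ∈ Metric.ball (Φ p₀) ε, A' (slice (dropNormal z)) = A' z := by
    refine hconst A' (fun z hz =>
      (hA'.hasFDerivAt_of_isOpen Metric.isOpen_ball hz).differentiableAt) fun z hz i => ?_
    have h1 := (hAd z (hballT hz)).hasFDerivAt
    have h2 := (hasDerivAt_inv (hA0 z hz)).comp_hasFDerivAt z h1.fst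
    have h3 : HasFDerivAt A' _ z := h2.smul h1
    obtain ⟨c, hc⟩ := hAs i z (hballT hz)
    rw [h3.fderiv]
    simp only [add_apply, smul_apply, ContinuousLinearMap.smulRight_apply,
      ContinuousLinearMap.comp_apply, ContinuousLinearMap.coe_fst', hc, smul_smul,
      ← add_smul, smul_eq_mul, Function.comp_apply]
    have h0 := hA0 z hz
    convert zero_smul ℝ (A z) using 2
    have hc1 : (c • A z).1 = c * (A z).1 := rfl
    rw [hc1]
    field_simp
    ring
  have hA'eq : ∀ z ∈ Metric.ball (Φ p₀) ε, A z = (A z).1 • A' z := fun z hz => by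
    simp only [A', smul_smul, mul_inv_cancel₀ (hA0 z hz), one_smul]
  have hA'1 : ∀ z ∈ Metric.ball (Φ p₀) ε, (A' z).1 = 1 := fun z hz =>
    inv_mul_cancel₀ (hA0 z hz)
  -- The data are read off on the slice `s = s₀`; by `hPconst` and `hA'const` any other slice of the
  -- box gives the same.
  let S' : SymSystem L e :=
    { dom := Metric.ball (dropNormal (Φ p₀)) ε
      rhs := fun w => (A' (slice w)).2.2
      gen := fun X w => dropNormal (P X (slice w)) }
  let F : Phase e → Fin d → ℝ := fun w => (A' (slice w)).2.1
  have hA's : ContDiffOn ℝ ∞ (fun w => A' (slice w)) S'.dom :=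
    hA'.comp hslice.contDiffOn hslicemem
  have hrhs : ContDiffOn ℝ ∞ S'.rhs S'.dom := hA's.snd.snd
  have hgen : ∀ X, ContDiffOn ℝ ∞ (S'.gen X) S'.dom := fun X =>
    contDiff_dropNormal.comp_contDiffOn
      ((hP X).comp hslice.contDiffOn fun w hw => hballT (hslicemem w hw))
  have hfield' : ContDiffOn ℝ ∞ S'.field S'.dom := SymSystem.contDiffOn_field hrhs
  have hfieldA' : ∀ z ∈ Metric.ball (Φ p₀) ε, S'.field (dropNormal z) = dropNormal (A' z) := by
    intro z hz
    have h1 := hA'1 z hz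
    rw [← hA'const z hz] at h1 ⊢
    exact Prod.ext h1.symm rfl
  -- the projection to the reduced system
  let π : Phase N → Phase e := fun p => dropNormal (Φ p)
  let W : Set (Phase N) := Φ.source ∩ Φ ⁻¹' Metric.ball (Φ p₀) ε
  have hW : IsOpen W := hsmooth.continuousOn.isOpen_inter_preimage Φ.open_source Metric.isOpen_ball
  have hπ : ContDiffOn ℝ ∞ π W :=
    contDiff_dropNormal.comp_contDiffOn (hsmooth.mono inter_subset_left)
  have hπ' : ∀ p ∈ W, ∀ v, fderiv ℝ π p v = dropNormal (fderiv ℝ Φ p v) := fun p hp v =>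
    congrArg (fun A => A v) ((hasFDerivAt_dropNormal _).comp p
      (OpenPartialHomeomorph.hasFDerivAt_of_smooth hsmooth hp.1)).fderiv
  have hπgen : ∀ X, ∀ p ∈ W, fderiv ℝ π p (S.gen X p) = S'.gen X (π p) := by
    intro X p hp
    rw [hπ' p hp, hPΦ X p hp.1]
    exact (hPconst X _ hp.2).symm
  have hlift : ∀ w ∈ S'.dom, ∃ p ∈ W, π p = w := by
    intro w hw
    have h1 := hslicemem w hw
    refine ⟨Φ.symm (slice w), ⟨Φ.map_target (hballT h1), ?_⟩, ?_⟩
    · rw [mem_preimage, Φ.right_inv (hballT h1)]; exact h1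
    · simp only [π, Φ.right_inv (hballT h1)]
      rfl
  have hπmem : ∀ p ∈ W, π p ∈ S'.dom := fun p hp => hdropmem _ hp.2
  have hgd' : ∀ X, ∀ w ∈ S'.dom, DifferentiableAt ℝ (S'.gen X) w := fun X w hw =>
    ((hgen X).hasFDerivAt_of_isOpen Metric.isOpen_ball hw).differentiableAt
  have hfd' : ∀ w ∈ S'.dom, DifferentiableAt ℝ S'.field w := fun w hw =>
    (hfield'.hasFDerivAt_of_isOpen Metric.isOpen_ball hw).differentiableAt
  have hS' : S'.IsSymmetric := by
    refine ⟨Metric.isOpen_ball, hrhs, hgen, fun X Y w hw => ?_, fun c X w hw => ?_,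
      fun X Y w hw => ?_, fun X w hw => ?_⟩
    · obtain ⟨p, hp, rfl⟩ := hlift w hw
      simp only [← hπgen _ p hp, hS.add X Y p (hsource hp.1), map_add]
    · obtain ⟨p, hp, rfl⟩ := hlift w hw
      simp only [← hπgen _ p hp, hS.smul c X p (hsource hp.1), map_smul]
    · obtain ⟨p, hp, rfl⟩ := hlift w hw
      rw [← fderiv_lieBracket_of_related hW hπ hp (hgd X p hp.1) (hgd Y p hp.1)
        (hgd' X _ hw) (hgd' Y _ hw) (hπgen X) (hπgen Y), hS.lie X Y p (hsource hp.1), hπgen _ p hp]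
    · obtain ⟨p, hp, rfl⟩ := hlift w hw
      -- Only the rescaled operator is related to the reduced one. Its bracket with a symmetry is
      -- still a multiple of the operator, and after projection `lieBracket_field_eq` identifies the
      -- factor.
      let a : Phase N → ℝ := fun q => (A (Φ q)).1⁻¹
      have ha : ContDiffOn ℝ ∞ a W :=
        ((hA.mono hballT).fst.inv hA0).comp (hsmooth.mono inter_subset_left) fun q hq => hq.2
      have had := (ha.hasFDerivAt_of_isOpen hW hp).differentiableAt
      have hrel : ∀ q ∈ W, fderiv ℝ π q (a q • S.field q) = S'.field (π q) := by
        intro q hq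
        rw [hπ' q hq, map_smul, hAΦ q hq.1]
        exact (hfieldA' _ hq.2).symm
      have h1 := fderiv_lieBracket_of_related hW hπ hp (hgd X p hp.1) (had.smul (hfd p hp.1))
        (hgd' X _ hw) (hfd' _ hw) (hπgen X) hrel
      have h2 := VectorField.lieBracket_smul_right (V := S.gen X) had (hfd p hp.1)
      have hane : a p ≠ 0 := inv_ne_zero (hA0 _ hp.2)
      have h3 : S.field p = (a p)⁻¹ • (a p • S.field p) := by
        rw [smul_smul, inv_mul_cancel₀ hane, one_smul]
      have h4 : VectorField.lieBracket ℝ (S.gen X) (fun q => a q • S.field q) p =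
          ((fderiv ℝ a p (S.gen X p) +
            a p * -(fderiv ℝ (fun q => (S.gen X q).1) p (S.field p))) * (a p)⁻¹) •
            (a p • S.field p) := by
        rw [h2, hS.symm X p (hsource hp.1), mul_smul, ← h3, add_smul, mul_smul]
      have h5 := congrArg (fderiv ℝ π p) h4
      rw [map_smul, hrel p hp] at h5
      exact SymSystem.lieBracket_field_eq (hgd' X _ hw) (hfd' _ hw) (h1.symm.trans h5)
  refine ⟨ε, hε, hballT, F, S', hS', rfl, hle, hb, hbasis, rfl, hsmooth.mono inter_subset_left,
    hsymm.mono inter_subset_left, hA's.snd.fst, ?_, fun i p hp => hnormal i p hp.1, ?_, ?_⟩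
  · change _ = dropNormal '' (Φ.target ∩ Metric.ball (Φ p₀) ε)
    rw [inter_eq_self_of_subset_right hballT, dropNormal_image_ball _ hε]
  · intro p hp
    refine ⟨(A (Φ p)).1, hA0 _ hp.2, ?_⟩
    change fderiv ℝ Φ p (S.field p) = (A (Φ p)).1 • ((1, (A' (slice (dropNormal (Φ p)))).2.1,
      (A' (slice (dropNormal (Φ p)))).2.2) : T)
    rw [hAΦ p hp.1, hA'const _ hp.2, ← hA'1 _ hp.2]
    exact hA'eq _ hp.2
  · intro X p hp
    exact (hπgen X p hp).symm.trans (hπ' p hp _)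

end Reduction

/-! ### Curves with velocity along the operator are graphs of solutions -/

section Reparametrization

variable {F : Type*} [NormedAddCommGroup F] [NormedSpace ℝ F]

/-- The first component has positive derivative, so it is strictly increasing with open image.
Composing the curve with its inverse divides the velocity by `c`. -/
theorem exists_graph_of_hasDerivAt_of_pos {f : ℝ × F → F} {γ : ℝ → ℝ × F} {I : Set ℝ}
    (hI : IsOpenInterval I) {c : ℝ → ℝ} (hc : ∀ t ∈ I, 0 < c t)
    (hγ : ∀ t ∈ I, HasDerivAt γ (c t • (1, f (γ t))) t) :
    ∃ (J : Set ℝ) (u : ℝ → F), IsOpenInterval J ∧ (∀ x ∈ J, HasDerivAt u (f (x, u x)) x) ∧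
      (fun x => (x, u x)) '' J = γ '' I := by
  obtain ⟨hIo, hIc, t₀, ht₀⟩ := hI
  let x : ℝ → ℝ := fun t => (γ t).1
  have hx : ∀ t ∈ I, HasDerivAt x (c t) t := by
    intro t ht
    have := (hγ t ht).hasFDerivAt.fst.hasDerivAt
    simpa using this
  have hxc : ContinuousOn x I := fun t ht => (hx t ht).continuousAt.continuousWithinAt
  have hmono : StrictMonoOn x I := strictMonoOn_of_deriv_pos hIc.convex hxc fun t ht => by
    rw [(hx t (interior_subset ht)).deriv]
    exact hc t (interior_subset ht)
  let g : ℝ → ℝ := Function.invFunOn x I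
  have hg : ∀ y ∈ x '' I, g y ∈ I ∧ x (g y) = y := fun y hy =>
    ⟨Function.invFunOn_mem hy, Function.invFunOn_eq hy⟩
  have hgx : ∀ t ∈ I, g (x t) = t := fun t ht =>
    hmono.injOn (hg _ (mem_image_of_mem x ht)).1 ht (hg _ (mem_image_of_mem x ht)).2
  have hopen : IsOpen (x '' I) := by
    rw [isOpen_iff_mem_nhds]
    rintro _ ⟨t, ht, rfl⟩
    obtain ⟨ε, hε, hball⟩ := Metric.isOpen_iff.1 hIo t ht
    have hsub : Icc (t - ε / 2) (t + ε / 2) ⊆ I := by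
      refine Subset.trans ?_ hball
      rw [← Real.closedBall_eq_Icc]
      exact Metric.closedBall_subset_ball (by linarith)
    have ha : t - ε / 2 ∈ I := hsub ⟨le_rfl, by linarith⟩
    have hb : t + ε / 2 ∈ I := hsub ⟨by linarith, le_rfl⟩
    refine Filter.mem_of_superset (Icc_mem_nhds (hmono ha ht (by linarith))
      (hmono ht hb (by linarith))) ?_
    exact (intermediate_value_Icc (by linarith) (hxc.mono hsub)).trans (image_mono hsub)
  have hgmono : StrictMonoOn g (x '' I) := by
    rintro _ ⟨a, ha, rfl⟩ _ ⟨b, hb, rfl⟩ hab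
    rw [hgx a ha, hgx b hb]
    exact (hmono.lt_iff_lt ha hb).1 hab
  have hgimage : g '' (x '' I) = I := by
    rw [image_image]
    ext t
    constructor
    · rintro ⟨s, hs, rfl⟩
      simpa only [hgx s hs] using hs
    · exact fun ht => ⟨t, ht, hgx t ht⟩
  have hgc : ∀ y ∈ x '' I, ContinuousAt g y := fun y hy =>
    hgmono.continuousAt_of_image_mem_nhds (hopen.mem_nhds hy) (by
      rw [hgimage]; exact hIo.mem_nhds (hg y hy).1)
  have hgd : ∀ y ∈ x '' I, HasDerivAt g (c (g y))⁻¹ y := fun y hy =>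
    HasDerivAt.of_local_left_inverse (hgc y hy) (hx _ (hg y hy).1) (hc _ (hg y hy).1).ne'
      (Filter.eventually_of_mem (hopen.mem_nhds hy) fun z hz => (hg z hz).2)
  have hpair : ∀ y ∈ x '' I, γ (g y) = (y, (γ (g y)).2) := fun y hy =>
    Prod.ext (hg y hy).2 rfl
  refine ⟨x '' I, fun y => (γ (g y)).2, ⟨hopen, ?_, ⟨x t₀, mem_image_of_mem x ht₀⟩⟩, ?_, ?_⟩
  · exact (hIc.isPreconnected.image x hxc).ordConnected
  · intro y hy
    have h1 := (hγ _ (hg y hy).1).scomp y (hgd y hy)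
    rw [smul_smul, inv_mul_cancel₀ (hc _ (hg y hy).1).ne', one_smul, hpair y hy] at h1
    simpa using h1.hasFDerivAt.snd.hasDerivAt
  · ext p
    constructor
    · rintro ⟨y, hy, rfl⟩
      exact ⟨g y, (hg y hy).1, hpair y hy⟩
    · rintro ⟨t, ht, rfl⟩
      refine ⟨x t, mem_image_of_mem x ht, ?_⟩
      simp only [hgx t ht]
      rfl

/-- A curve whose velocity is a nowhere zero multiple of `(1, f)` is the graph of a solution of
`u' = f (x, u)`. -/
theorem exists_graph_of_hasDerivAt {f : ℝ × F → F} {γ : ℝ → ℝ × F} {I : Set ℝ}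
    (hI : IsOpenInterval I) {c : ℝ → ℝ} (hc : ∀ t ∈ I, c t ≠ 0)
    (hγ : ∀ t ∈ I, HasDerivAt γ (c t • (1, f (γ t))) t) :
    ∃ (J : Set ℝ) (u : ℝ → F), IsOpenInterval J ∧ (∀ x ∈ J, HasDerivAt u (f (x, u x)) x) ∧
      (fun x => (x, u x)) '' J = γ '' I := by
  have hx : ∀ t ∈ I, HasDerivWithinAt (fun t => (γ t).1) (c t) I t := by
    intro t ht
    have := (hγ t ht).hasFDerivAt.fst.hasDerivAt
    exact HasDerivAt.hasDerivWithinAt (by simpa using this)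
  -- By Darboux's theorem a derivative without zeros on an interval has constant sign; no continuity
  -- of `c` is needed. The negative case is reduced to the positive one by reversing time.
  rcases hasDerivWithinAt_forall_lt_or_forall_gt_of_forall_ne hI.2.1.convex hx hc with h | h
  · have hI' : IsOpenInterval (Neg.neg ⁻¹' I) := by
      refine ⟨hI.1.preimage continuous_neg, ?_, ?_⟩
      · exact hI.2.1.preimage_anti fun a b hab => neg_le_neg hab
      · obtain ⟨t, ht⟩ := hI.2.2
        exact ⟨-t, by simpa using ht⟩
    obtain ⟨J, u, hJ, hu, him⟩ := exists_graph_of_hasDerivAt_of_pos hI' (f := f)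
      (γ := fun t => γ (-t)) (c := fun t => -c (-t)) (fun t ht => neg_pos.2 (h _ ht))
      (fun t ht => by
        have := (hγ (-t) ht).scomp t (hasDerivAt_neg t)
        rw [smul_smul, neg_one_mul] at this
        exact this)
    refine ⟨J, u, hJ, hu, him.trans ?_⟩
    ext p
    constructor
    · rintro ⟨t, ht, rfl⟩
      exact ⟨-t, ht, rfl⟩
    · rintro ⟨t, ht, rfl⟩
      exact ⟨-t, by simpa using ht, by simp⟩
  · exact exists_graph_of_hasDerivAt_of_pos hI h hγ

theorem image_graph_injective {F : Type*} {I J : Set ℝ} {u v : ℝ → F}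
    (h : (fun x => (x, u x)) '' I = (fun x => (x, v x)) '' J) : I = J ∧ ∀ x ∈ I, u x = v x := by
  have key : ∀ {I J : Set ℝ} {u v : ℝ → F}, (fun x => (x, u x)) '' I = (fun x => (x, v x)) '' J →
      ∀ x ∈ I, x ∈ J ∧ u x = v x := by
    intro I J u v h x hx
    obtain ⟨y, hy, hxy⟩ := h ▸ mem_image_of_mem (fun x => (x, u x)) hx
    obtain ⟨rfl, h2⟩ := Prod.mk.inj hxy
    exact ⟨hy, h2.symm⟩
  exact ⟨Subset.antisymm (fun x hx => (key h x hx).1) fun x hx => (key h.symm x hx).1,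
    fun x hx => (key h x hx).2⟩

end Reparametrization

namespace SymSystem

variable {L : Type*} {N : ℕ}

/-- The curve `G` is the graph of a solution of the system on an open interval. -/
def IsSolutionGraph (S : SymSystem L N) (G : Set (Phase N)) : Prop :=
  ∃ (I : Set ℝ) (w : ℝ → Fin N → ℝ),
    IsOpenInterval I ∧ S.IsSolution I w ∧ G = (fun t => (t, w t)) '' I

end SymSystem

/-! ### Solutions through quadratures -/

section Curves

variable {L : Type*} [LieRing L] [LieAlgebra ℝ L] {N d e : ℕ}

/-- The solutions of the original system are obtained from those of the reduced system by
quadratures. -/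
theorem IsFirstIntegration.isSolutionGraph_iff {h h' : Submodule ℝ L} {S : SymSystem L N}
    {b : Fin d → L} {Φ : OpenPartialHomeomorph (Phase N) (ℝ × (Fin d → ℝ) × (Fin e → ℝ))}
    {F : Phase e → Fin d → ℝ} {S' : SymSystem L e} (H : IsFirstIntegration h h' S b Φ F S')
    (G : Set (Phase N)) :
    S.IsSolutionGraph G ↔
      ∃ (I : Set ℝ) (w : ℝ → Fin e → ℝ) (t₀ : ℝ) (c : Fin d → ℝ) (s : ℝ → Fin d → ℝ),
        IsOpenInterval I ∧ t₀ ∈ I ∧ S'.IsSolutionGraph ((fun t => (t, w t)) '' I) ∧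
        (∀ t i, s t i = c i + ∫ τ in t₀..t, F (τ, w τ) i) ∧
        (∀ t ∈ I, (t, s t, w t) ∈ Φ.target) ∧
        G = (fun t => Φ.symm (t, s t, w t)) '' I := by
  have hFc : ∀ {I : Set ℝ} {w : ℝ → Fin e → ℝ}, S'.IsSolution I w → ∀ i,
      ContinuousOn (fun τ => F (τ, w τ) i) I := by
    intro I w hw i
    refine (continuous_apply i).comp_continuousOn (H.smooth_quad.continuousOn.comp
      (f := fun τ => (τ, w τ)) (continuousOn_id.prodMk ?_) fun t ht => (hw t ht).1)
    exact fun t ht => (hw t ht).2.continuousAt.continuousWithinAt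
  constructor
  · rintro ⟨I, w, hI, hw, rfl⟩
    have hmem : ∀ t ∈ I, (t, w t) ∈ Φ.source := fun t ht => H.source ▸ (hw t ht).1
    -- The factor is chosen for every real `t`; its value outside `I` is irrelevant.
    have hsplit : ∀ t, ∃ c : ℝ, t ∈ I → c ≠ 0 ∧ fderiv ℝ Φ (t, w t) (S.field (t, w t)) =
        c • ((1, F (dropNormal (Φ (t, w t))), S'.rhs (dropNormal (Φ (t, w t)))) :
          ℝ × (Fin d → ℝ) × (Fin e → ℝ)) := by
      intro t
      by_cases ht : t ∈ I
      · obtain ⟨c, hc⟩ := H.split _ (hw t ht).1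
        exact ⟨c, fun _ => hc⟩
      · exact ⟨0, fun h => absurd h ht⟩
    choose c hc using hsplit
    obtain ⟨J, u, hJ, hu, him⟩ := exists_graph_of_hasDerivAt hI
      (f := fun z : ℝ × (Fin d → ℝ) × (Fin e → ℝ) => (F (dropNormal z), S'.rhs (dropNormal z)))
      (γ := fun t => Φ (t, w t)) (c := c) (fun t ht => (hc t ht).1) (fun t ht => by
        have h1 : HasDerivAt (fun t => (t, w t)) (S.field (t, w t)) t :=
          (hasDerivAt_id t).prodMk (hw t ht).2
        have h2 := (OpenPartialHomeomorph.hasFDerivAt_of_smooth H.smooth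
          (hmem t ht)).comp_hasDerivAt t h1
        rw [(hc t ht).2] at h2
        exact h2)
    have hgraph : ∀ t ∈ J, (t, u t) ∈ Φ.target := by
      intro t ht
      have : (t, u t) ∈ (fun t => Φ (t, w t)) '' I := him ▸ mem_image_of_mem _ ht
      obtain ⟨t', ht', h⟩ := this
      rw [← h]
      exact Φ.map_source (hmem t' ht')
    have hsol : S'.IsSolution J (fun t => (u t).2) := by
      intro t ht
      refine ⟨?_, by simpa [dropNormal] using (hu t ht).hasFDerivAt.snd.hasDerivAt⟩
      rw [H.dom]
      exact ⟨_, hgraph t ht, rfl⟩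
    obtain ⟨t₀, ht₀⟩ := hJ.2.2
    have hs : ∀ t ∈ J, (fun i => (u t₀).1 i + ∫ τ in t₀..t, F (τ, (u τ).2) i) = (u t).1 := by
      intro t ht
      funext i
      have hsub : uIcc t₀ t ⊆ J := hJ.2.1.uIcc_subset ht₀ ht
      have hder : ∀ τ ∈ uIcc t₀ t, HasDerivAt (fun τ => (u τ).1 i) (F (τ, (u τ).2) i) τ := by
        intro τ hτ
        have h1 : HasDerivAt (fun τ => (u τ).1) (F (τ, (u τ).2)) τ := by
          simpa [dropNormal] using (hu τ (hsub hτ)).hasFDerivAt.fst.hasDerivAt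
        exact (hasDerivAt_pi.1 h1) i
      rw [intervalIntegral.integral_eq_sub_of_hasDerivAt hder
        ((hFc hsol i).mono hsub).intervalIntegrable]
      ring
    -- The `s`-part is the integral formula itself, since that formula is required for all real `t`;
    -- it agrees with the `s`-part of `u` on `J` only.
    refine ⟨J, fun t => (u t).2, t₀, (u t₀).1,
      fun t i => (u t₀).1 i + ∫ τ in t₀..t, F (τ, (u τ).2) i, hJ, ht₀,
      ⟨J, _, hJ, hsol, rfl⟩, fun _ _ => rfl, fun t ht => ?_, ?_⟩
    · have h1 := hgraph t ht
      rw [← Prod.mk.eta (p := u t), ← hs t ht] at h1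
      exact h1
    · have h1 : (fun t => (t, w t)) '' I = Φ.symm '' ((fun t => Φ (t, w t)) '' I) := by
        rw [image_image]
        exact image_congr fun t ht => (Φ.left_inv (hmem t ht)).symm
      rw [h1, ← him, image_image]
      refine image_congr fun t ht => ?_
      have h2 : u t = ((u t).1, (u t).2) := rfl
      rw [h2, ← hs t ht]
  · rintro ⟨I, w, t₀, c, s, hI, ht₀, ⟨I', w', -, hw', hgraph⟩, hs, hmem, rfl⟩
    -- The produced curve is a mere set, so its parametrization as a solution must first be
    -- identified with `w` on `I`.
    obtain ⟨rfl, hww'⟩ := image_graph_injective hgraph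
    have hw : S'.IsSolution I w := by
      intro t ht
      rw [hww' t ht]
      refine ⟨(hw' t ht).1, (hw' t ht).2.congr_of_eventuallyEq ?_⟩
      filter_upwards [hI.1.mem_nhds ht] with τ hτ using hww' τ hτ
    have hsd : ∀ t ∈ I, HasDerivAt s (F (t, w t)) t := by
      intro t ht
      rw [hasDerivAt_pi]
      intro i
      simp only [hs]
      have hsub : uIcc t₀ t ⊆ I := hI.2.1.uIcc_subset ht₀ ht
      exact (intervalIntegral.integral_hasDerivAt_right
        ((hFc hw i).mono hsub).intervalIntegrable
        ((hFc hw i).stronglyMeasurableAtFilter hI.1 t ht)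
        ((hFc hw i).continuousAt (hI.1.mem_nhds ht))).const_add _
    have hsplit : ∀ t, ∃ c : ℝ, t ∈ I → c ≠ 0 ∧
        fderiv ℝ Φ.symm (t, s t, w t) (1, F (t, w t), S'.rhs (t, w t)) =
          c • S.field (Φ.symm (t, s t, w t)) := by
      intro t
      by_cases ht : t ∈ I
      · have hp := Φ.map_target (hmem t ht)
        obtain ⟨c, hc0, hc⟩ := H.split _ (H.source ▸ hp)
        have h1 := OpenPartialHomeomorph.fderiv_symm_fderiv H.smooth H.smooth_symm hp
          (S.field (Φ.symm (t, s t, w t)))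
        rw [hc, Φ.right_inv (hmem t ht), map_smul] at h1
        refine ⟨c⁻¹, fun _ => ⟨inv_ne_zero hc0, ?_⟩⟩
        rw [← h1, smul_smul, inv_mul_cancel₀ hc0, one_smul]
        rfl
      · exact ⟨0, fun h => absurd h ht⟩
    choose a ha using hsplit
    obtain ⟨J, u, hJ, hu, him⟩ := exists_graph_of_hasDerivAt hI (f := S.rhs)
      (γ := fun t => Φ.symm (t, s t, w t)) (c := a) (fun t ht => (ha t ht).1) (fun t ht => by
        have h1 : HasDerivAt (fun t => (t, s t, w t)) (1, F (t, w t), S'.rhs (t, w t)) t :=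
          (hasDerivAt_id t).prodMk ((hsd t ht).prodMk (hw t ht).2)
        have h2 := (OpenPartialHomeomorph.hasFDerivAt_of_smooth (Φ := Φ.symm) H.smooth_symm
          (hmem t ht)).comp_hasDerivAt t h1
        rw [(ha t ht).2] at h2
        exact h2)
    refine ⟨J, u, hJ, fun t ht => ⟨?_, hu t ht⟩, him.symm⟩
    have : (t, u t) ∈ (fun t => Φ.symm (t, s t, w t)) '' I := him ▸ mem_image_of_mem _ ht
    obtain ⟨t', ht', h⟩ := this
    rw [← h, ← H.source]
    exact Φ.map_target (hmem t' ht')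

namespace FirstIntegrationChain

variable {h : ℕ → Submodule ℝ L}

theorem isSymmetric {j : ℕ} {S : SymSystem L N} : FirstIntegrationChain h S j → S.IsSymmetric
  | done _ hS => hS
  | step _ hS _ _ _ _ _ _ => hS

/-- The curves produced by a chain of integrations are the solution curves of the system. -/
theorem produces_iff {N j : ℕ} {S : SymSystem L N} (C : FirstIntegrationChain h S j) :
    ∀ G, C.Produces G ↔ S.IsSolutionGraph G := by
  induction C with
  | done S hS => exact fun G => Iff.rfl
  | step S hS b Φ F S' hstep tail ih =>
    intro G
    rw [hstep.isSolutionGraph_iff]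
    simp only [← ih]
    rfl

end FirstIntegrationChain

end Curves

/-! ### Solutions of the mixed order system and of its first order form -/

section JetSolutions

theorem ContDiffOn.hasDerivAt_iteratedDeriv {f : ℝ → ℝ} {I : Set ℝ} (hI : IsOpen I) {n j : ℕ}
    (hf : ContDiffOn ℝ n f I) (hj : j < n) {x : ℝ} (hx : x ∈ I) :
    HasDerivAt (iteratedDeriv j f) (iteratedDeriv (j + 1) f x) x := by
  obtain ⟨n, rfl⟩ : ∃ m, n = m + 1 := ⟨n - 1, by omega⟩
  induction j generalizing f n with
  | zero =>
    rw [zero_add, iteratedDeriv_zero, iteratedDeriv_one]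
    exact ((hf.contDiffAt (hI.mem_nhds hx)).differentiableAt (by simp)).hasDerivAt
  | succ j ih =>
    obtain ⟨n, rfl⟩ : ∃ m, n = m + 1 := ⟨n - 1, by omega⟩
    rw [iteratedDeriv_succ', iteratedDeriv_succ' (n := j + 1)]
    refine ih n ?_ (by omega)
    rw [Nat.cast_succ, contDiffOn_succ_iff_deriv_of_isOpen hI] at hf
    exact hf.2.2

variable {k : ℕ} {ord : Fin k → ℕ} {U : Set (Phase (∑ ν, ord ν))}
  {Ω : Phase (∑ ν, ord ν) → Fin k → ℝ} {L : Type*} [LieRing L] [LieAlgebra ℝ L]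
  {ρ : L →ₗ[ℝ] (Phase k → Phase k)}

/-- The solution curves of the equivalent first order system are those of the original system. -/
theorem isSolutionGraph_odeSymSystem_iff (hord : ∀ μ, 1 ≤ ord μ) (hΩ : ContDiffOn ℝ ∞ Ω U)
    {W : Set (Phase (∑ ν, ord ν))} (hWU : W ⊆ U) (G : Set (Phase (∑ ν, ord ν))) :
    (odeSymSystem ord Ω ρ W).IsSolutionGraph G ↔ G ⊆ W ∧ ∃ (I : Set ℝ) (y : ℝ → Fin k → ℝ),
      IsOpenInterval I ∧ IsODESolution ord U Ω I y ∧ G = jetOf ord y '' I := by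
  constructor
  · rintro ⟨I, w, hI, hw, rfl⟩
    let c : (μ : Fin k) → ℕ → ℝ → ℝ := fun μ j x => jetCoord ord μ j (x, w x)
    have hp : ∀ x ∈ I, HasDerivAt (fun x => (x, w x)) (odeField ord Ω (x, w x)) x := fun x hx =>
      (hasDerivAt_id x).prodMk (hw x hx).2
    have hc : ∀ μ j, j < ord μ → ∀ x ∈ I,
        HasDerivAt (c μ j) (if j + 1 < ord μ then c μ (j + 1) x else Ω (x, w x) μ) x := by
      intro μ j hj x hx
      have := (jetCoordL ord μ j).hasFDerivAt.comp_hasDerivAt x (hp x hx)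
      rw [coe_jetCoordL, jetCoord_odeField _ _ _ _ hj] at this
      exact this
    have hiter : ∀ μ j, j < ord μ → ∀ x ∈ I, iteratedDeriv j (fun t => c μ 0 t) x = c μ j x := by
      intro μ j
      induction j with
      | zero => intro _ x _; rw [iteratedDeriv_zero]
      | succ j ih =>
        intro hj x hx
        -- Iterated derivatives are taken on the whole line, where `w` is arbitrary outside `I`;
        -- agreement near `x` is what counts, and `I` is open.
        have heq : iteratedDeriv j (fun t => c μ 0 t) =ᶠ[𝓝 x] c μ j :=
          Filter.eventually_of_mem (hI.1.mem_nhds hx) (ih (by omega))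
        rw [iteratedDeriv_succ, heq.deriv_eq, (hc μ j (by omega) x hx).deriv, if_pos hj]
    have hjet : ∀ x ∈ I, jetOf ord (fun x μ => c μ 0 x) x = (x, w x) := by
      intro x hx
      refine Prod.ext rfl (funext fun a => ?_)
      have := hiter (finSigmaFinEquiv.symm a).1 (finSigmaFinEquiv.symm a).2
        (finSigmaFinEquiv.symm a).2.2 x hx
      rw [show c (finSigmaFinEquiv.symm a).1 (finSigmaFinEquiv.symm a).2 x = w x a from
        jetCoord_finSigmaFinEquiv_symm ord a (x, w x)] at this
      exact this
    have hwW : ∀ x ∈ I, (x, w x) ∈ W := fun x hx => (hw x hx).1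
    refine ⟨?_, I, fun x μ => c μ 0 x, hI, ⟨fun μ => ?_, fun x hx => ?_, fun x hx μ => ?_⟩, ?_⟩
    · rintro _ ⟨x, hx, rfl⟩
      exact hwW x hx
    -- Regularity is gained downwards: the highest coordinate is `C¹` because its derivative is the
    -- continuous function `Ω`, and each lower coordinate has the next one as derivative.
    · have hsmooth : ∀ i j, j + i + 1 = ord μ → ContDiffOn ℝ ((i + 1 : ℕ) : WithTop ℕ∞)
          (c μ j) I := by
        intro i
        induction i with
        | zero =>
          intro j hj
          rw [Nat.cast_succ, contDiffOn_succ_iff_deriv_of_isOpen hI.1]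
          refine ⟨fun x hx => (hc μ j (by omega) x hx).differentiableAt.differentiableWithinAt,
            by simp, ?_⟩
          rw [Nat.cast_zero, contDiffOn_zero]
          have h1 : ContinuousOn (fun x => Ω (x, w x) μ) I :=
            (continuous_apply μ).comp_continuousOn (hΩ.continuousOn.comp
              (fun x hx => (hp x hx).continuousAt.continuousWithinAt) fun x hx => hWU (hwW x hx))
          refine h1.congr fun x hx => ?_
          rw [(hc μ j (by omega) x hx).deriv, if_neg (by omega)]
        | succ i ih =>
          intro j hj
          rw [Nat.cast_succ, contDiffOn_succ_iff_deriv_of_isOpen hI.1]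
          refine ⟨fun x hx => (hc μ j (by omega) x hx).differentiableAt.differentiableWithinAt,
            by simp, (ih (j + 1) (by omega)).congr fun x hx => ?_⟩
          rw [(hc μ j (by omega) x hx).deriv, if_pos (by omega)]
      have := hord μ
      have h1 := hsmooth (ord μ - 1) 0 (by omega)
      rwa [Nat.sub_add_cancel this] at h1
    · rw [hjet x hx]
      exact hWU (hwW x hx)
    · have h1 := hord μ
      obtain ⟨m, hm⟩ : ∃ m, ord μ = m + 1 := ⟨ord μ - 1, by omega⟩
      rw [hjet x hx, hm]
      have heq : iteratedDeriv m (fun t => c μ 0 t) =ᶠ[𝓝 x] c μ m :=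
        Filter.eventually_of_mem (hI.1.mem_nhds hx) (hiter μ m (by omega))
      rw [iteratedDeriv_succ, heq.deriv_eq, (hc μ m (by omega) x hx).deriv, if_neg (by omega)]
    · exact image_congr fun x hx => (hjet x hx).symm
  · rintro ⟨hGW, I, y, hI, hy, rfl⟩
    refine ⟨I, fun x => (jetOf ord y x).2, hI, fun x hx => ⟨hGW (mem_image_of_mem _ hx), ?_⟩, rfl⟩
    rw [hasDerivAt_pi]
    intro a
    have hlt := (finSigmaFinEquiv.symm a).2.2
    have h1 := ContDiffOn.hasDerivAt_iteratedDeriv hI.1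
      (hy.contDiff (finSigmaFinEquiv.symm a).1) hlt hx
    convert! h1 using 1
    change (if ((finSigmaFinEquiv.symm a).2 : ℕ) + 1 < ord (finSigmaFinEquiv.symm a).1 then
      jetCoord ord (finSigmaFinEquiv.symm a).1 ((finSigmaFinEquiv.symm a).2 + 1) (jetOf ord y x)
      else Ω (jetOf ord y x) (finSigmaFinEquiv.symm a).1) = _
    split_ifs with h
    · exact jetCoord_mk ord x (fun μ j => iteratedDeriv j (fun t => y t μ) x) _ h
    · rw [← hy.eq x hx]
      congr 1
      omega

end JetSolutions

/-! ### The minimal number of steps -/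

section LowerBound

variable {L : Type*} [LieRing L] [LieAlgebra ℝ L] {N : ℕ} {h : ℕ → Submodule ℝ L}

/-- The generators that vanish on the system are exactly those that have been used, and each coset
of a chain of integrations is commutative modulo the generators used before. -/
theorem FirstIntegrationChain.mem_and_lie_mem {S : SymSystem L N} {j : ℕ}
    (C : FirstIntegrationChain h S j) (hne : S.dom.Nonempty)
    (hz : ∀ X ∈ h j, ∀ p ∈ S.dom, S.gen X p = 0) (h0 : h 0 = ⊤) :
    (∀ X, (∀ p ∈ S.dom, S.gen X p = 0) → X ∈ h j) ∧
      ∀ i < j, ∀ X ∈ h i, ∀ Y ∈ h i, ⁅X, Y⁆ ∈ h (i + 1) := by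
  induction C with
  | done S hS => exact ⟨fun X _ => h0 ▸ Submodule.mem_top, fun i hi => absurd hi (by omega)⟩
  | @step N d e j S hS b Φ F S' H tail ih =>
    have hsrc : ∀ {p}, p ∈ S.dom → p ∈ Φ.source := fun hp => H.source ▸ hp
    have hne' : S'.dom.Nonempty := by
      rw [H.dom]
      obtain ⟨p, hp⟩ := hne
      exact ⟨_, mem_image_of_mem _ (Φ.map_source (hsrc hp))⟩
    obtain ⟨ih1, ih2⟩ := ih hne' fun X hX w hw => H.gen_eq_zero hS hz hX hw
    -- A generator vanishing on `S` vanishes on the reduced system, hence lies in `h j` by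
    -- induction. Its components along the independent `∂_{s_i}` are zero, which leaves `h (j + 1)`.
    have hker : ∀ X, (∀ p ∈ S.dom, S.gen X p = 0) → X ∈ h (j + 1) := by
      intro X hX
      have hXj : X ∈ h j := by
        refine ih1 X fun w hw => ?_
        rw [H.dom] at hw
        obtain ⟨z, hz', rfl⟩ := hw
        have hp : Φ.symm z ∈ S.dom := H.source ▸ Φ.map_target hz'
        have := H.reduced X _ hp
        rw [Φ.right_inv hz', hX _ hp, map_zero] at this
        exact this
      obtain ⟨c, hc, -⟩ := H.basis X hXj
      obtain ⟨p, hp⟩ := hne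
      have h1 := hS.gen_eq_sum hz hc hp
      rw [hX p hp] at h1
      have h2 := congrArg (fderiv ℝ Φ p) h1
      rw [map_zero, map_sum] at h2
      simp only [map_smul, H.normal _ _ hp, sum_smul_single] at h2
      have h3 : c = 0 := (congrArg (fun z => z.2.1) h2).symm
      simpa [h3] using hc
    refine ⟨hker, fun i hi X hX Y hY => ?_⟩
    rcases Nat.lt_succ_iff_lt_or_eq.1 hi with hi | rfl
    · exact ih2 i hi X hX Y hY
    -- All elements of the coset become constant fields, so their brackets vanish on `S` and lie in
    -- the kernel found above.
    · have hnormal : ∀ X ∈ h i, ∃ c : Fin d → ℝ, ∀ p ∈ S.dom,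
          fderiv ℝ Φ p (S.gen X p) = (0, c, 0) := by
        intro X hX
        obtain ⟨c, hc, -⟩ := H.basis X hX
        refine ⟨c, fun p hp => ?_⟩
        rw [hS.gen_eq_sum hz hc hp, map_sum]
        simp only [map_smul, H.normal _ _ hp, sum_smul_single]
      obtain ⟨cX, hcX⟩ := hnormal X hX
      obtain ⟨cY, hcY⟩ := hnormal Y hY
      refine hker _ fun p hp => ?_
      have hd : ∀ X, DifferentiableAt ℝ (S.gen X) p := fun X =>
        ((hS.smooth_gen X).hasFDerivAt_of_isOpen hS.isOpen hp).differentiableAt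
      have h1 := fderiv_lieBracket_of_related hS.isOpen (H.source ▸ H.smooth) hp (hd X) (hd Y)
        (V' := fun _ => (0, cX, 0)) (W' := fun _ => (0, cY, 0)) (differentiableAt_const _)
        (differentiableAt_const _) hcX hcY
      rw [hS.lie X Y p hp] at h1
      rw [← OpenPartialHomeomorph.fderiv_symm_fderiv H.smooth H.smooth_symm (hsrc hp)
        (S.gen ⁅X, Y⁆ p), h1]
      simp [VectorField.lieBracket]

/-- A chain of integrations that uses all generators has at least as many steps as the derived
series. -/
theorem FirstIntegrationChain.derivedLength_le {S : SymSystem L N} {l : ℕ}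
    (C : FirstIntegrationChain h S l) (hne : S.dom.Nonempty) (h0 : h 0 = ⊤) (hl : h l = ⊥) :
    LieAlgebra.derivedLength ℝ L ≤ l := by
  have hz : ∀ X ∈ h l, ∀ p ∈ S.dom, S.gen X p = 0 := by
    intro X hX p hp
    rw [hl, Submodule.mem_bot] at hX
    rw [hX, C.isSymmetric.gen_zero hp]
  have key := (C.mem_and_lie_mem hne hz h0).2
  have hder : ∀ i ≤ l, (LieAlgebra.derivedSeries ℝ L i).toSubmodule ≤ h i := by
    intro i
    induction i with
    | zero => intro _; rw [h0]; exact le_top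
    | succ i ih =>
      intro hi
      rw [LieAlgebra.derivedSeries_def, LieAlgebra.derivedSeriesOfIdeal_succ,
        LieSubmodule.lieIdeal_oper_eq_linear_span', Submodule.span_le]
      rintro _ ⟨X, hX, Y, hY, rfl⟩
      exact key i (by omega) X (ih (by omega) hX) Y (ih (by omega) hY)
  refine Nat.sInf_le ?_
  change LieAlgebra.derivedSeriesOfIdeal ℝ L l ⊤ = ⊥
  rw [← LieSubmodule.toSubmodule_eq_bot, eq_bot_iff, ← hl]
  exact hder l le_rfl

end LowerBound

/-! ### Bases modulo a subspace and complementary frames -/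

section LinearAlgebra

/-- Elements of `h'` that form a basis modulo `h`. -/
theorem Submodule.exists_basis_mod {L : Type*} [AddCommGroup L] [Module ℝ L]
    [FiniteDimensional ℝ L] {h h' : Submodule ℝ L} (hle : h ≤ h') :
    ∃ (d : ℕ) (b : Fin d → L), (∀ i, b i ∈ h') ∧
      (∀ X ∈ h', ∃! c : Fin d → ℝ, X - ∑ i, c i • b i ∈ h) ∧
      d + Module.finrank ℝ h = Module.finrank ℝ h' := by
  let Q := h'.map h.mkQ
  let bQ := Module.finBasis ℝ Q
  have hlift : ∀ i, ∃ X ∈ h', h.mkQ X = bQ i := fun i => (Submodule.mem_map).1 (bQ i).2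
  choose b hb hbQ using hlift
  refine ⟨Module.finrank ℝ Q, b, hb, fun X hX => ?_, ?_⟩
  · let x : Q := ⟨h.mkQ X, Submodule.mem_map_of_mem hX⟩
    have hiff : ∀ c : Fin (Module.finrank ℝ Q) → ℝ,
        X - ∑ i, c i • b i ∈ h ↔ ∑ i, c i • bQ i = x := by
      intro c
      have h1 : X - ∑ i, c i • b i ∈ h ↔ h.mkQ (X - ∑ i, c i • b i) = 0 :=
        (Submodule.Quotient.mk_eq_zero h).symm
      rw [h1, map_sub, sub_eq_zero, map_sum, Subtype.ext_iff, eq_comm]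
      simp only [map_smul, hbQ, AddSubmonoidClass.coe_finsetSum, Submodule.coe_smul, x]
    refine ⟨bQ.equivFun x, (hiff _).2 (bQ.sum_equivFun x), fun c hc => ?_⟩
    rw [← (hiff c).1 hc, ← bQ.equivFun_symm_apply, LinearEquiv.apply_symm_apply]
  · have h1 := LinearMap.finrank_range_add_finrank_ker (h.mkQ.domRestrict h')
    have h2 : LinearMap.range (h.mkQ.domRestrict h') = Q := LinearMap.range_domRestrict _ _
    have h3 : Module.finrank ℝ (LinearMap.ker (h.mkQ.domRestrict h')) = Module.finrank ℝ h := by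
      rw [LinearMap.ker_domRestrict, Submodule.ker_mkQ]
      exact (Submodule.comapSubtypeEquivOfLe hle).finrank_eq
    rw [h2, h3] at h1
    exact h1

theorem exists_complementary_frame {V : Type*} [NormedAddCommGroup V] [NormedSpace ℝ V]
    [FiniteDimensional ℝ V] {d : ℕ} (Z : Fin d → V) (A : V)
    (hind : ∀ (s : Fin d → ℝ) (t : ℝ), ∑ i, s i • Z i + t • A = 0 → s = 0 ∧ t = 0) :
    ∃ (e : ℕ) (κ : (Fin e → ℝ) →L[ℝ] V), Module.finrank ℝ V = d + e + 1 ∧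
      ∀ (s : Fin d → ℝ) (t : ℝ) (v : Fin e → ℝ),
        ∑ i, s i • Z i + t • A + κ v = 0 → s = 0 ∧ t = 0 ∧ v = 0 := by
  let f : (Fin d → ℝ) × ℝ →ₗ[ℝ] V :=
    (Fintype.linearCombination ℝ Z).coprod (LinearMap.toSpanSingleton ℝ V A)
  have hf : ∀ s t, f (s, t) = ∑ i, s i • Z i + t • A := fun s t => by
    simp [f, Fintype.linearCombination_apply]
  have hfinj : Function.Injective f := by
    rw [injective_iff_map_eq_zero]
    rintro ⟨s, t⟩ h
    rw [hf] at h
    exact Prod.ext (hind s t h).1 (hind s t h).2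
  obtain ⟨M, hM⟩ := Submodule.exists_isCompl (LinearMap.range f)
  let bM := Module.finBasis ℝ M
  refine ⟨Module.finrank ℝ M, (M.subtype.comp bM.equivFun.symm.toLinearMap).toContinuousLinearMap,
    ?_, fun s t v h => ?_⟩
  · have h1 := Submodule.finrank_add_eq_of_isCompl hM
    rw [LinearMap.finrank_range_of_inj hfinj] at h1
    simp only [Module.finrank_prod, Module.finrank_self, Module.finrank_fintype_fun_eq_card,
      Fintype.card_fin] at h1
    omega
  · have hκ : f (s, t) + (bM.equivFun.symm v : V) = 0 := by rw [hf]; exact h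
    have h0 : (bM.equivFun.symm v : V) = 0 := by
      have h1 : (bM.equivFun.symm v : V) ∈ LinearMap.range f :=
        ⟨-(s, t), by rw [map_neg]; exact neg_eq_of_add_eq_zero_right hκ⟩
      have := hM.disjoint.le_bot ⟨h1, (bM.equivFun.symm v).2⟩
      simpa using this
    rw [h0, add_zero, hf] at hκ
    have hv : bM.equivFun.symm v = 0 := Subtype.ext h0
    exact ⟨(hind s t hκ).1, (hind s t hκ).2, (LinearEquiv.map_eq_zero_iff bM.equivFun.symm).1 hv⟩

end LinearAlgebra

/-! ### Straightening coordinates from pointwise independence -/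

section Coordinates

universe u

variable {E : Type u} [NormedAddCommGroup E] [NormedSpace ℝ E] [FiniteDimensional ℝ E] {d : ℕ}

/-- Straightening coordinates near a point where the commuting fields are independent of each other
and of a further vector, which becomes `∂_t`. -/
theorem exists_straightening_of_independent {Z : Fin d → E → E} {O : Set E} (hO : IsOpen O)
    (hZ : ∀ i, ContDiffOn ℝ ∞ (Z i) O)
    (hcomm : ∀ i j, ∀ p ∈ O, VectorField.lieBracket ℝ (Z i) (Z j) p = 0) {p₀ : E} (hp₀ : p₀ ∈ O)
    {A : E} (hind : ∀ (s : Fin d → ℝ) (t : ℝ), ∑ i, s i • Z i p₀ + t • A = 0 → s = 0 ∧ t = 0) :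
    ∃ (e : ℕ) (Φ : OpenPartialHomeomorph E (ℝ × (Fin d → ℝ) × (Fin e → ℝ))),
      Module.finrank ℝ E = d + e + 1 ∧ p₀ ∈ Φ.source ∧ Φ.source ⊆ O ∧
      ContDiffOn ℝ ∞ Φ Φ.source ∧ ContDiffOn ℝ ∞ Φ.symm Φ.target ∧
      (∀ i, ∀ p ∈ Φ.source, fderiv ℝ Φ p (Z i p) = (0, Pi.single i 1, 0)) ∧
      Φ p₀ = 0 ∧ fderiv ℝ Φ p₀ A = (1, 0, 0) := by
  obtain ⟨e, κ, hdim, hκ⟩ := exists_complementary_frame (fun i => Z i p₀) A hind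
  -- The transversal is an affine subspace through `p₀` with `A` as its `t`-direction, so that `A`
  -- becomes `∂_t` at `p₀`.
  let ℓ : Phase e →L[ℝ] E := (ContinuousLinearMap.toSpanSingleton ℝ A).coprod κ
  have hℓ : ∀ a : Phase e, ℓ a = a.1 • A + κ a.2 := fun a => by simp [ℓ]
  have hσ' : HasFDerivAt (fun a => p₀ + ℓ a) ℓ 0 := ℓ.hasFDerivAt.const_add p₀
  have hσ0 : p₀ + ℓ 0 = p₀ := by rw [map_zero, add_zero]
  obtain ⟨Φ, h1, h2, h3, h4, h5, h6, -, h7⟩ := exists_straightening hO hZ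
    (fun i j p hp => sub_eq_zero.1 (hcomm j i p hp)) isOpen_univ
    (σ := fun a => p₀ + ℓ a) (contDiff_const.add ℓ.contDiff).contDiffOn (mem_univ 0)
    (by rwa [hσ0]) (fun s a h => by
      simp only [hσ0] at h
      rw [hσ'.fderiv, hℓ, ← add_assoc] at h
      obtain ⟨hs, ht, hv⟩ := hκ s a.1 a.2 h
      exact ⟨hs, Prod.ext ht hv⟩) hdim
  simp only [hσ0] at h1 h6 h7
  refine ⟨e, Φ, hdim, h1, h2, h3, h4, h5, h6, ?_⟩
  have := h7 (1, 0)
  rwa [hσ'.fderiv, hℓ, one_smul, map_zero, add_zero] at this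

end Coordinates

/-! ### Chains along the derived series -/

section Existence

variable {L : Type*} [LieRing L] [LieAlgebra ℝ L]

variable (L) in
/-- The derived series as a sequence of subspaces. -/
abbrev derivedSubmodule (i : ℕ) : Submodule ℝ L := (LieAlgebra.derivedSeries ℝ L i).toSubmodule

theorem derivedSubmodule_antitone : Antitone (derivedSubmodule L) := fun _ _ hij =>
  LieAlgebra.derivedSeriesOfIdeal_antitone _ hij

theorem lie_mem_derivedSubmodule_succ {i : ℕ} {X Y : L} (hX : X ∈ derivedSubmodule L i)
    (hY : Y ∈ derivedSubmodule L i) : ⁅X, Y⁆ ∈ derivedSubmodule L (i + 1) := by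
  change ⁅X, Y⁆ ∈ LieAlgebra.derivedSeriesOfIdeal ℝ L (i + 1) ⊤
  rw [LieAlgebra.derivedSeriesOfIdeal_succ]
  exact LieSubmodule.lie_mem_lie hX hY

theorem lie_mem_derivedSubmodule {i : ℕ} {X : L} (hX : X ∈ derivedSubmodule L i) (Y : L) :
    ⁅X, Y⁆ ∈ derivedSubmodule L i :=
  lie_mem_left ℝ L (LieAlgebra.derivedSeries ℝ L i) X Y hX

variable {N d e : ℕ} {S : SymSystem L N}

/-- Transitivity of the remaining cosets is inherited by the reduced system. -/
theorem IsFirstIntegration.cosetsTransitiveAt {j : ℕ} {b : Fin d → L}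
    {Φ : OpenPartialHomeomorph (Phase N) (ℝ × (Fin d → ℝ) × (Fin e → ℝ))}
    {F : Phase e → Fin d → ℝ} {S' : SymSystem L e}
    (H : IsFirstIntegration (derivedSubmodule L (j + 1)) (derivedSubmodule L j) S b Φ F S')
    {p : Phase N} (hp : p ∈ S.dom) (htrans : S.CosetsTransitiveAt (j + 1) p) :
    S'.CosetsTransitiveAt j (dropNormal (Φ p)) := by
  intro i hi X hX hspan
  refine htrans i (by omega) X hX ?_
  set M := Submodule.span ℝ ({S.field p} ∪
    (fun Y => S.gen Y p) '' (LieAlgebra.derivedSeries ℝ L (i + 1) : Set L)) with hM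
  let ℓ : Phase N →ₗ[ℝ] Phase e := ((dropNormalL d e).comp (fderiv ℝ Φ p)).toLinearMap
  have hgen : ∀ Y, S'.gen Y (dropNormal (Φ p)) = ℓ (S.gen Y p) := fun Y => H.reduced Y p hp
  have hle : Submodule.span ℝ ({S'.field (dropNormal (Φ p))} ∪
      (fun Y => S'.gen Y (dropNormal (Φ p))) ''
        (LieAlgebra.derivedSeries ℝ L (i + 1) : Set L)) ≤ M.map ℓ := by
    rw [Submodule.span_le]
    rintro _ (rfl | ⟨Y, hY, rfl⟩)
    · obtain ⟨c, hc, hsplit⟩ := H.split p hp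
      refine ⟨c⁻¹ • S.field p, M.smul_mem _ (Submodule.subset_span (Or.inl rfl)), ?_⟩
      rw [map_smul]
      change c⁻¹ • dropNormalL d e (fderiv ℝ Φ p (S.field p)) = _
      rw [hsplit, map_smul, smul_smul, inv_mul_cancel₀ hc, one_smul]
      rfl
    · exact ⟨S.gen Y p, Submodule.subset_span (Or.inr ⟨Y, hY, rfl⟩), (hgen Y).symm⟩
  obtain ⟨m, hm, hmX⟩ := hle hspan
  rw [hgen] at hmX
  have hsrc : p ∈ Φ.source := H.source ▸ hp
  -- `S.gen X p - m` dies in the reduced system, so it is a combination of the values of the `b i`.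
  -- These lie in `g^(j) ⊆ g^(i+1)`, as `i < j`, and were already admitted in the span upstairs.
  set s : Fin d → ℝ := (fderiv ℝ Φ p (S.gen X p - m)).2.1
  have h1 : fderiv ℝ Φ p (S.gen X p - m) = (0, s, 0) := by
    have h0 : dropNormal (fderiv ℝ Φ p (S.gen X p - m)) = 0 := by
      have : ℓ (S.gen X p - m) = 0 := by rw [map_sub, hmX, sub_self]
      exact this
    exact Prod.ext (congrArg (fun a : Phase e => a.1) h0)
      (Prod.ext rfl (congrArg (fun a : Phase e => a.2) h0))
  have h2 : S.gen X p - m = ∑ i, s i • S.gen (b i) p := by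
    rw [← OpenPartialHomeomorph.fderiv_symm_fderiv H.smooth H.smooth_symm hsrc (S.gen X p - m), h1,
      ← OpenPartialHomeomorph.fderiv_symm_fderiv H.smooth H.smooth_symm hsrc
        (∑ i, s i • S.gen (b i) p), map_sum]
    simp only [map_smul, H.normal _ p hp, sum_smul_single]
  rw [sub_eq_iff_eq_add] at h2
  rw [h2]
  refine M.add_mem (M.sum_mem fun l _ => M.smul_mem _ ?_) hm
  exact Submodule.subset_span (Or.inr ⟨b l, derivedSubmodule_antitone (by omega : i + 1 ≤ j)
    (H.mem l), rfl⟩)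

/-- A relation places a combination of the `b i` in the direction of the operator, so transitivity
of the top coset puts it in `g^(j+1)`, where uniqueness of coefficients gives `s = 0`. The operator
itself is nonzero because its first component is `1`. -/
theorem independent_of_cosetsTransitiveAt (hS : S.IsSymmetric) {j : ℕ} {b : Fin d → L}
    (hb : ∀ i, b i ∈ derivedSubmodule L j)
    (hbasis : ∀ X ∈ derivedSubmodule L j,
      ∃! c : Fin d → ℝ, X - ∑ i, c i • b i ∈ derivedSubmodule L (j + 1))
    {p : Phase N} (hp : p ∈ S.dom) (htrans : S.CosetsTransitiveAt (j + 1) p)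
    (s : Fin d → ℝ) (t : ℝ) (h : ∑ i, s i • S.gen (b i) p + t • S.field p = 0) :
    s = 0 ∧ t = 0 := by
  rw [← hS.gen_sum hp] at h
  have hmem : ∑ i, s i • b i ∈ derivedSubmodule L j :=
    Submodule.sum_mem _ fun i _ => Submodule.smul_mem _ _ (hb i)
  have h1 : ∑ i, s i • b i ∈ derivedSubmodule L (j + 1) := by
    refine htrans j (by omega) _ hmem ?_
    rw [eq_neg_of_add_eq_zero_left h, ← neg_smul]
    exact Submodule.smul_mem _ _ (Submodule.subset_span (Or.inl rfl))
  have hs : s = 0 := by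
    refine (hbasis 0 (Submodule.zero_mem _)).unique ?_ ?_
    · rw [zero_sub]; exact Submodule.neg_mem _ h1
    · simp
  refine ⟨hs, ?_⟩
  subst hs
  simp only [Pi.zero_apply, zero_smul, Finset.sum_const_zero, hS.gen_zero hp, zero_add] at h
  have := congrArg Prod.fst h
  simpa [SymSystem.field] using this

variable (L) in
/-- Near every point of a system with `j` transitive cosets left there is a chain of `j` steps. -/
def HasChains (j : ℕ) : Prop :=
  ∀ {N : ℕ} (S : SymSystem L N), S.IsSymmetric →
    (∀ X ∈ derivedSubmodule L j, ∀ p ∈ S.dom, S.gen X p = 0) → ∀ p ∈ S.dom,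
    S.CosetsTransitiveAt j p → ∃ W, IsOpen W ∧ p ∈ W ∧ W ⊆ S.dom ∧
      ∃ C : FirstIntegrationChain (derivedSubmodule L) (S.restrict W) j,
        C.quadratures + Module.finrank ℝ (derivedSubmodule L j) = Module.finrank ℝ L ∧
        C.finalDim + C.quadratures = N

/-- A chain of integrations whose first step uses given coordinates. -/
theorem HasChains.exists_step {j : ℕ} (hchains : HasChains L j) (hS : S.IsSymmetric)
    (hz : ∀ X ∈ derivedSubmodule L (j + 1), ∀ p ∈ S.dom, S.gen X p = 0)
    {b : Fin d → L} (hb : ∀ i, b i ∈ derivedSubmodule L j)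
    (hbasis : ∀ X ∈ derivedSubmodule L j,
      ∃! c : Fin d → ℝ, X - ∑ i, c i • b i ∈ derivedSubmodule L (j + 1))
    (hd : d + Module.finrank ℝ (derivedSubmodule L (j + 1)) =
      Module.finrank ℝ (derivedSubmodule L j)) (hN : d + e = N)
    {Φ : OpenPartialHomeomorph (Phase N) (ℝ × (Fin d → ℝ) × (Fin e → ℝ))}
    (hsource : Φ.source ⊆ S.dom) (hsmooth : ContDiffOn ℝ ∞ Φ Φ.source)
    (hsymm : ContDiffOn ℝ ∞ Φ.symm Φ.target)
    (hnormal : ∀ i, ∀ p ∈ Φ.source, fderiv ℝ Φ p (S.gen (b i) p) = (0, Pi.single i 1, 0))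
    {p : Phase N} (hp : p ∈ Φ.source) (ht : (fderiv ℝ Φ p (S.field p)).1 ≠ 0)
    (htrans : S.CosetsTransitiveAt (j + 1) p) :
    ∃ (W : Set (Phase N)) (ε : ℝ), 0 < ε ∧ Metric.ball (Φ p) ε ⊆ Φ.target ∧ IsOpen W ∧ p ∈ W ∧
      W ⊆ Φ.source ∩ Φ ⁻¹' Metric.ball (Φ p) ε ∧
      ∃ C : FirstIntegrationChain (derivedSubmodule L) (S.restrict W) (j + 1),
        C.quadratures + Module.finrank ℝ (derivedSubmodule L (j + 1)) = Module.finrank ℝ L ∧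
        C.finalDim + C.quadratures = N ∧
        ∀ {k m : ℕ} (ρ : L → Phase k → Phase k) (π : Phase N → Phase k)
          (Ψ : OpenPartialHomeomorph (Phase k) (ℝ × (Fin d → ℝ) × (Fin m → ℝ)))
          (a : Fin m → Fin e),
          ContDiffOn ℝ ∞ Ψ Ψ.source → ContDiffOn ℝ ∞ Ψ.symm Ψ.target → Function.Injective a →
          (∀ i, ∀ q ∈ Ψ.source, fderiv ℝ Ψ q (ρ (b i) q) = (0, Pi.single i 1, 0)) →
          (∀ q ∈ W, π q ∈ Ψ.source ∧ (Φ q).1 = (Ψ (π q)).1 ∧ (Φ q).2.1 = (Ψ (π q)).2.1 ∧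
            ∀ l, (Φ q).2.2 (a l) = (Ψ (π q)).2.2 l) →
          C.StartsWithPointTransformation ρ π := by
  obtain ⟨ε, hε, hball, F, S', hS', hdom', H⟩ := exists_isFirstIntegration
    (derivedSubmodule_antitone (Nat.le_succ j)) (fun X hX Y => lie_mem_derivedSubmodule hX Y)
    hS hz hb hbasis hsource hsmooth hsymm hnormal hp ht
  set W₁ := Φ.source ∩ Φ ⁻¹' Metric.ball (Φ p) ε with hW₁
  have hW₁o : IsOpen W₁ :=
    hsmooth.continuousOn.isOpen_inter_preimage Φ.open_source Metric.isOpen_ball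
  have hpW₁ : p ∈ W₁ := ⟨hp, Metric.mem_ball_self hε⟩
  have hW₁S : W₁ ⊆ S.dom := inter_subset_left.trans hsource
  have hS₁ : (S.restrict W₁).IsSymmetric := hS.restrict hW₁o hW₁S
  have hz₁ : ∀ X ∈ derivedSubmodule L (j + 1), ∀ q ∈ (S.restrict W₁).dom,
      (S.restrict W₁).gen X q = 0 := fun X hX q hq => hz X hX q (hW₁S hq)
  have hp' : dropNormal (Φ p) ∈ S'.dom := by rw [hdom']; exact Metric.mem_ball_self hε
  -- The later steps exist only over `W'`, so the first step is cut down to the preimage of `W'`,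
  -- which makes its reduced system live exactly there.
  obtain ⟨W', hW', hpW', hW'S', C', hC'q, hC'd⟩ := hchains S' hS'
    (fun X hX w hw => H.gen_eq_zero hS₁ hz₁ hX hw) _ hp' (H.cosetsTransitiveAt hpW₁ htrans)
  have hWo' : IsOpen (dropNormal (d := d) (e := e) ⁻¹' W') :=
    hW'.preimage contDiff_dropNormal.continuous
  have H' := H.restrict hW'S' hWo'
  let W : Set (Phase N) := W₁ ∩ Φ ⁻¹' (dropNormal ⁻¹' W')
  have hWo : IsOpen W :=
    (hsmooth.continuousOn.mono inter_subset_left).isOpen_inter_preimage hW₁o hWo'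
  have hWS : (S.restrict W).IsSymmetric := hS.restrict hWo (inter_subset_left.trans hW₁S)
  refine ⟨W, ε, hε, hball, hWo, ⟨hpW₁, hpW'⟩, inter_subset_left,
    FirstIntegrationChain.step (S.restrict W) hWS b _ F (S'.restrict W') H' C', ?_, ?_, ?_⟩
  · change d + C'.quadratures + _ = _
    omega
  · change C'.finalDim + (d + C'.quadratures) = N
    omega
  · intro k m ρ π Ψ a h1 h2 h3 h4 h5
    exact ⟨m, Ψ, a, h1, h2, h3, h4, h5⟩

/-- Induction on the number of cosets left. The fields `b i` commute on the system because their
brackets lie in `g^(j+1)`, which acts as zero, so the straightening theorem supplies the coordinates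
of the next step. -/
theorem hasChains [FiniteDimensional ℝ L] (j : ℕ) : HasChains L j := by
  induction j with
  | zero =>
    intro N S hS hz p hp _
    refine ⟨S.dom, hS.isOpen, hp, Subset.rfl, FirstIntegrationChain.done _ hS, ?_, rfl⟩
    change 0 + _ = _
    rw [zero_add]
    exact finrank_top ℝ L
  | succ j ih =>
    intro N S hS hz p hp htrans
    obtain ⟨d, b, hb, hbasis, hd⟩ := Submodule.exists_basis_mod
      (derivedSubmodule_antitone (L := L) (Nat.le_succ j))
    obtain ⟨e, Φ, hdim, hpΦ, hsource, hsmooth, hsymm, hnormal, -, hA⟩ :=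
      exists_straightening_of_independent hS.isOpen (Z := fun i => S.gen (b i))
        (fun i => hS.smooth_gen (b i)) (fun i l q hq => by
          rw [hS.lie _ _ q hq]
          exact hz _ (lie_mem_derivedSubmodule_succ (hb i) (hb l)) q hq) hp
        (independent_of_cosetsTransitiveAt hS hb hbasis hp htrans)
    have hN : d + e = N := by
      simp only [Module.finrank_prod, Module.finrank_self, Module.finrank_fintype_fun_eq_card,
        Fintype.card_fin] at hdim
      omega
    obtain ⟨W, ε, -, -, hW, hpW, hWsub, C, hq, hdim', -⟩ := ih.exists_step hS hz hb hbasis hd hN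
      hsource hsmooth hsymm hnormal hpΦ (by rw [hA]; exact one_ne_zero) htrans
    exact ⟨W, hW, hpW, fun q hq => hsource (hWsub hq).1, C, hq, hdim'⟩

end Existence

/-! ### Splitting a surjective linear map -/

section Lift

variable {V : Type*} [NormedAddCommGroup V] [NormedSpace ℝ V] [FiniteDimensional ℝ V]
  {W : Type*} [NormedAddCommGroup W] [NormedSpace ℝ W] [FiniteDimensional ℝ W]

theorem ContinuousLinearMap.exists_splitting {π : V →L[ℝ] W} (hπ : Function.Surjective π) :
    ∃ (n : ℕ) (κ : (Fin n → ℝ) →L[ℝ] V) (ι : W →L[ℝ] V),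
      Module.finrank ℝ V = Module.finrank ℝ W + n ∧ (∀ v, π (κ v) = 0) ∧
      Function.Injective κ ∧ ∀ w, π (ι w) = w := by
  obtain ⟨ι, hι⟩ := π.toLinearMap.exists_rightInverse_of_surjective (LinearMap.range_eq_top.2 hπ)
  let b := Module.finBasis ℝ (LinearMap.ker π.toLinearMap)
  refine ⟨_, ((LinearMap.ker π.toLinearMap).subtype.comp
    b.equivFun.symm.toLinearMap).toContinuousLinearMap, ι.toContinuousLinearMap, ?_,
    fun v => (b.equivFun.symm v).2,
    Subtype.val_injective.comp b.equivFun.symm.injective, fun w => LinearMap.congr_fun hι w⟩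
  have := LinearMap.finrank_range_add_finrank_ker π.toLinearMap
  rw [LinearMap.range_eq_top.2 hπ, finrank_top] at this
  exact this.symm

end Lift

/-! ### Straightening coordinates adapted to a projection -/

section Coordinates

universe u

variable {V : Type u} [NormedAddCommGroup V] [NormedSpace ℝ V] [FiniteDimensional ℝ V]
  {W : Type*} [NormedAddCommGroup W] [NormedSpace ℝ W] [FiniteDimensional ℝ W] {d m : ℕ}

/-- Straightening coordinates for fields that project to a space on which straightening coordinates
are given can be chosen so as to extend the latter. -/
theorem exists_straightening_over {π : V →L[ℝ] W} (hπ : Function.Surjective π) {O : Set V}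
    (hO : IsOpen O) {Z : Fin d → V → V} (hZ : ∀ i, ContDiffOn ℝ ∞ (Z i) O)
    (hcomm : ∀ i j, ∀ p ∈ O, VectorField.lieBracket ℝ (Z i) (Z j) p = 0)
    {Y : Fin d → W → W} (hZY : ∀ i, ∀ p ∈ O, π (Z i p) = Y i (π p))
    {Ψ : OpenPartialHomeomorph W (ℝ × (Fin d → ℝ) × (Fin m → ℝ))}
    (hΨ : ContDiffOn ℝ ∞ Ψ Ψ.source) (hΨ' : ContDiffOn ℝ ∞ Ψ.symm Ψ.target)
    (hY : ∀ i, ∀ q ∈ Ψ.source, fderiv ℝ Ψ q (Y i q) = (0, Pi.single i 1, 0))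
    (hdim : Module.finrank ℝ W = d + m + 1) {p₀ : V} (hp₀ : p₀ ∈ O) (hπp₀ : π p₀ ∈ Ψ.source)
    (hΨ0 : Ψ (π p₀) = 0) :
    ∃ (n : ℕ) (Φ : OpenPartialHomeomorph V (ℝ × (Fin d → ℝ) × (Fin (m + n) → ℝ))),
      Module.finrank ℝ V = d + (m + n) + 1 ∧ p₀ ∈ Φ.source ∧ Φ.source ⊆ O ∧
      (∀ p ∈ Φ.source, π p ∈ Ψ.source) ∧
      ContDiffOn ℝ ∞ Φ Φ.source ∧ ContDiffOn ℝ ∞ Φ.symm Φ.target ∧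
      (∀ i, ∀ p ∈ Φ.source, fderiv ℝ Φ p (Z i p) = (0, Pi.single i 1, 0)) ∧
      (∀ ε, Metric.ball (Φ p₀) ε ⊆ Φ.target → ∀ p ∈ Φ.source, Φ p ∈ Metric.ball (Φ p₀) ε →
        (Φ p).1 = (Ψ (π p)).1 ∧ (Φ p).2.1 = (Ψ (π p)).2.1 ∧
          ∀ l, (Φ p).2.2 (Fin.castAdd n l) = (Ψ (π p)).2.2 l) ∧
      ∀ w, (fderiv ℝ Φ p₀ w).1 = (fderiv ℝ Ψ (π p₀) (π w)).1 := by
  obtain ⟨n, κ, ι, hdimV, hπκ, hκ, hπι⟩ := ContinuousLinearMap.exists_splitting hπ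
  let P : (Fin (m + n) → ℝ) →L[ℝ] (Fin m → ℝ) :=
    (LinearMap.funLeft ℝ ℝ (Fin.castAdd n)).toContinuousLinearMap
  let R : (Fin (m + n) → ℝ) →L[ℝ] (Fin n → ℝ) :=
    (LinearMap.funLeft ℝ ℝ (Fin.natAdd m)).toContinuousLinearMap
  have hPR : ∀ v, P v = 0 → R v = 0 → v = 0 := fun v h1 h2 =>
    funext fun i => Fin.addCases (fun i => congrFun h1 i) (fun i => congrFun h2 i) i
  let emb : Phase (m + n) →L[ℝ] ℝ × (Fin d → ℝ) × (Fin m → ℝ) :=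
    (ContinuousLinearMap.fst ℝ ℝ _).prod
      ((0 : Phase (m + n) →L[ℝ] (Fin d → ℝ)).prod (P.comp (ContinuousLinearMap.snd ℝ ℝ _)))
  have hemb : ∀ a, emb a = (a.1, 0, P a.2) := fun _ => rfl
  let R' : Phase (m + n) →L[ℝ] V := κ.comp (R.comp (ContinuousLinearMap.snd ℝ ℝ _))
  -- The transversal lies over the slice `s = 0` of `Ψ`, with the `n` additional coordinates running
  -- along the kernel of `π`.
  let σ : Phase (m + n) → V := fun a => p₀ + (ι (Ψ.symm (emb a) - π p₀) + R' a)
  have hπσ : ∀ a, π (σ a) = Ψ.symm (emb a) := fun a => by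
    change π (p₀ + (ι (Ψ.symm (emb a) - π p₀) + κ (R a.2))) = _
    rw [map_add, map_add, hπκ, hπι]; abel
  have hsymm0 : Ψ.symm 0 = π p₀ := by rw [← hΨ0, Ψ.left_inv hπp₀]
  have hσ0 : σ 0 = p₀ := by simp [σ, hsymm0]
  have h0 : (0 : ℝ × (Fin d → ℝ) × (Fin m → ℝ)) ∈ Ψ.target := hΨ0 ▸ Ψ.map_source hπp₀
  have hσ' : HasFDerivAt σ (ι.comp ((fderiv ℝ Ψ.symm 0).comp emb) + R') 0 := by
    have h1 : HasFDerivAt Ψ.symm (fderiv ℝ Ψ.symm 0) (emb 0) := by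
      rw [map_zero]
      exact OpenPartialHomeomorph.hasFDerivAt_of_smooth (Φ := Ψ.symm) hΨ' h0
    exact ((ι.hasFDerivAt.comp 0 ((h1.comp 0 emb.hasFDerivAt).sub_const (π p₀))).add
      R'.hasFDerivAt).const_add p₀
  have hσs : ContDiffOn ℝ ∞ σ (emb ⁻¹' Ψ.target) :=
    contDiffOn_const.add ((ι.contDiff.comp_contDiffOn
      ((hΨ'.comp emb.contDiff.contDiffOn Subset.rfl).sub contDiffOn_const)).add
      R'.contDiff.contDiffOn)
  obtain ⟨Φ, h1, h2, h3, h4, h5, h6, h7, -⟩ := exists_straightening (O := O ∩ π ⁻¹' Ψ.source)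
    (hO.inter (Ψ.open_source.preimage π.continuous)) (fun i => (hZ i).mono inter_subset_left)
    (fun i j p hp => sub_eq_zero.1 (hcomm j i p hp.1))
    (Ψ.open_target.preimage emb.continuous) hσs (a₀ := 0) (by rwa [mem_preimage, map_zero])
    (by rw [hσ0]; exact ⟨hp₀, hπp₀⟩) (fun s a h => by
      rw [hσ0, hσ'.fderiv] at h
      have hπh := congrArg π h
      have hb : ∑ i, s i • Y i (π p₀) + fderiv ℝ Ψ.symm 0 (emb a) = 0 := by
        simpa [map_sum, hZY _ p₀ hp₀, hπι, R', hπκ] using hπh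
      have hb' := congrArg (fderiv ℝ Ψ (π p₀)) hb
      rw [map_add, map_sum, ← hΨ0, OpenPartialHomeomorph.fderiv_fderiv_symm hΨ hΨ' hπp₀,
        map_zero] at hb'
      simp only [map_smul, hY _ _ hπp₀, sum_smul_single, hemb, Prod.mk_add_mk, zero_add,
        add_zero] at hb'
      have hs : s = 0 := congrArg (fun z => z.2.1) hb'
      have ha1 : a.1 = 0 := congrArg Prod.fst hb'
      have hPa : P a.2 = 0 := congrArg (fun z => z.2.2) hb'
      have hea : emb a = 0 := by rw [hemb, ha1, hPa]; rfl
      have hRa : κ (R a.2) = 0 := by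
        simpa [hs, hea, R'] using h
      exact ⟨hs, Prod.ext ha1 (hPR _ hPa ((map_eq_zero_iff κ hκ).1 hRa))⟩)
    (by omega)
  rw [hσ0] at h1 h6
  have hΦ0 : Φ p₀ = 0 := h6
  have hadapt : ∀ ε, Metric.ball (Φ p₀) ε ⊆ Φ.target → ∀ p ∈ Φ.source,
      Φ p ∈ Metric.ball (Φ p₀) ε →
        (Φ p).1 = (Ψ (π p)).1 ∧ (Φ p).2.1 = (Ψ (π p)).2.1 ∧
          ∀ l, (Φ p).2.2 (Fin.castAdd n l) = (Ψ (π p)).2.2 l := by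
    intro ε hε p hp hpε
    let E := ℝ × (Fin d → ℝ) × (Fin (m + n) → ℝ)
    let pr : E →L[ℝ] ℝ × (Fin d → ℝ) × (Fin m → ℝ) :=
      (0 : E →L[ℝ] ℝ).prod (((ContinuousLinearMap.fst ℝ _ _).comp
        (ContinuousLinearMap.snd ℝ ℝ _)).prod 0)
    have hpr : ∀ z, pr z = (0, z.2.1, 0) := fun _ => rfl
    -- Flowing along `Z i` upstairs covers flowing along `Y i` downstairs, and both increase `s_i`
    -- at unit rate. So `g` does not depend on `s`, and its value is known on the slice `s = 0`. The
    -- hypothesis on the ball keeps the segment to that slice inside the target.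
    let g : E → ℝ × (Fin d → ℝ) × (Fin m → ℝ) := fun z => Ψ (π (Φ.symm z)) - pr z
    have hg : ∀ z ∈ Φ.target, HasFDerivAt g ((fderiv ℝ Ψ (π (Φ.symm z))).comp
        (π.comp (fderiv ℝ Φ.symm z)) - pr) z := fun z hz =>
      ((OpenPartialHomeomorph.hasFDerivAt_of_smooth hΨ (h2 (Φ.map_target hz)).2).comp z
        (π.hasFDerivAt.comp z (OpenPartialHomeomorph.hasFDerivAt_of_smooth (Φ := Φ.symm) h4
          hz))).sub pr.hasFDerivAt
    have hg0 : ∀ z ∈ Φ.target, ∀ i, fderiv ℝ g z (0, Pi.single i 1, 0) = 0 := by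
      intro z hz i
      have hq := Φ.map_target hz
      have hzi : fderiv ℝ Φ.symm z (0, Pi.single i 1, 0) = Z i (Φ.symm z) := by
        have := OpenPartialHomeomorph.fderiv_symm_fderiv h3 h4 hq (Z i (Φ.symm z))
        rwa [h5 i _ hq, Φ.right_inv hz] at this
      rw [(hg z hz).fderiv]
      change fderiv ℝ Ψ (π (Φ.symm z)) (π (fderiv ℝ Φ.symm z (0, Pi.single i 1, 0))) -
        (0, Pi.single i 1, 0) = 0
      rw [hzi, hZY i _ (h2 hq).1, hY i _ (h2 hq).2, sub_self]
    have hmem : ∀ (t : ℝ) (s : Fin d → ℝ) (v : Fin (m + n) → ℝ),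
        (t, s, v) ∈ Metric.ball (Φ p₀) ε ↔
          t ∈ Metric.ball 0 ε ∧ s ∈ Metric.ball 0 ε ∧ v ∈ Metric.ball 0 ε := by
      intro t s v
      rw [hΦ0]
      simp only [Metric.mem_ball, dist_zero_right, Prod.norm_def, sup_lt_iff]
    obtain ⟨ht, hs, hv⟩ := (hmem (Φ p).1 (Φ p).2.1 (Φ p).2.2).1 hpε
    have hε0 : 0 < ε := Metric.pos_of_mem_ball ht
    have hbox : ∀ s ∈ Metric.ball (0 : Fin d → ℝ) ε, ((Φ p).1, s, (Φ p).2.2) ∈ Φ.target :=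
      fun s hs => hε ((hmem _ _ _).2 ⟨ht, hs, hv⟩)
    have hc := eq_of_fderiv_normal_eq_zero (g := g) (convex_ball (0 : Fin d → ℝ) ε) (Φ p).1
      (Φ p).2.2 (fun s hs => (hg _ (hbox s hs)).differentiableAt)
      (fun s hs i => hg0 _ (hbox s hs) i) hs (Metric.mem_ball_self hε0)
    obtain ⟨hQ, hσe⟩ := h7 _ _ (hbox 0 (Metric.mem_ball_self hε0))
    have hr : g ((Φ p).1, 0, (Φ p).2.2) = ((Φ p).1, 0, P (Φ p).2.2) := by
      change Ψ (π (Φ.symm ((Φ p).1, 0, (Φ p).2.2))) - (0, 0, 0) = _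
      rw [hσe, hπσ, Ψ.right_inv hQ, hemb]
      exact sub_zero _
    have hl : g ((Φ p).1, (Φ p).2.1, (Φ p).2.2) = Ψ (π p) - (0, (Φ p).2.1, 0) := by
      change Ψ (π (Φ.symm (Φ p))) - _ = _
      rw [Φ.left_inv hp]; rfl
    rw [hr, hl, sub_eq_iff_eq_add] at hc
    rw [hc]
    refine ⟨(add_zero _).symm, (zero_add _).symm, fun l => ?_⟩
    exact (add_zero (P (Φ p).2.2 l)).symm
  refine ⟨n, Φ, by omega, h1, fun p hp => (h2 hp).1, fun p hp => (h2 hp).2, h3, h4, h5, hadapt,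
    fun w => ?_⟩
  obtain ⟨ε, hε, hball⟩ := Metric.isOpen_iff.1 Φ.open_target _ (Φ.map_source h1)
  have hΦp := OpenPartialHomeomorph.hasFDerivAt_of_smooth h3 h1
  have hev : (fun p => (Φ p).1) =ᶠ[𝓝 p₀] fun p => (Ψ (π p)).1 := by
    filter_upwards [Φ.open_source.mem_nhds h1,
      hΦp.continuousAt.preimage_mem_nhds (Metric.ball_mem_nhds _ hε)] with p hp hpε
    exact (hadapt ε hball p hp hpε).1
  have hΨp := ((OpenPartialHomeomorph.hasFDerivAt_of_smooth hΨ hπp₀).comp p₀ π.hasFDerivAt).fst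
  exact congrArg (fun A => A w) (hΦp.fst.unique (hΨp.congr_of_eventuallyEq hev))

end Coordinates

theorem derivedSubmodule_derivedLength {L : Type*} [LieRing L] [LieAlgebra ℝ L]
    [LieAlgebra.IsSolvable L] :
    derivedSubmodule L (LieAlgebra.derivedLength ℝ L) = ⊥ := by
  have : LieAlgebra.derivedSeries ℝ L (LieAlgebra.derivedLength ℝ L) = ⊥ :=
    Nat.sInf_mem (s := {i | LieAlgebra.derivedSeriesOfIdeal ℝ L i ⊤ = ⊥})
      (LieAlgebra.IsSolvable.solvable ℝ L)
  rw [derivedSubmodule, this, LieSubmodule.bot_toSubmodule]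

/-! ### Starting with a point transformation -/

section Systems

variable {k : ℕ} {ord : Fin k → ℕ} {U : Set (Phase (∑ ν, ord ν))}
  {Ω : Phase (∑ ν, ord ν) → Fin k → ℝ} {L : Type*} [LieRing L] [LieAlgebra ℝ L]
  [FiniteDimensional ℝ L] {D : Set (Phase k)} {ρ : L →ₗ[ℝ] (Phase k → Phase k)}

theorem baseProjL_surjective (hord : ∀ μ, 1 ≤ ord μ) : Function.Surjective (baseProjL ord) := by
  intro q
  refine ⟨(q.1, fun a => q.2 (finSigmaFinEquiv.symm a).1), ?_⟩
  rw [coe_baseProjL]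
  refine Prod.ext rfl (funext fun μ => ?_)
  have h : 0 < ord μ := hord μ
  simp [baseProj, jetCoord, h]

/-- Generators that act transitively on the space of the original variables are brought to their
normal form by a point transformation. -/
theorem exists_chain_of_transitive (hord : ∀ μ, 1 ≤ ord μ) (hU : IsOpen U)
    (hΩ : ContDiffOn ℝ ∞ Ω U) (hD : IsOpen D) (hUD : MapsTo (baseProj ord) U D)
    (hρ : IsPointSymmetryAlgebra ord U Ω D ρ) {j : ℕ} (hbot : derivedSubmodule L (j + 1) = ⊥)
    {p₀ : Phase (∑ ν, ord ν)} (hp₀ : p₀ ∈ U)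
    (htrans : (odeSymSystem ord Ω ρ U).CosetsTransitiveAt (j + 1) p₀)
    (hpoint : ∀ X ∈ derivedSubmodule L j, ρ X (baseProj ord p₀) ∈
      Submodule.span ℝ {baseProj ord (odeField ord Ω p₀)} → X = 0) :
    ∃ W, IsOpen W ∧ p₀ ∈ W ∧ W ⊆ U ∧
      ∃ C : FirstIntegrationChain (derivedSubmodule L) (odeSymSystem ord Ω ρ W) (j + 1),
        C.quadratures + Module.finrank ℝ (derivedSubmodule L (j + 1)) = Module.finrank ℝ L ∧
        C.finalDim + C.quadratures = ∑ ν, ord ν ∧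
        C.StartsWithPointTransformation (fun X => ρ X) (baseProj ord) := by
  have hS := hρ.isSymmetric hord hU hΩ hD hUD
  set S := odeSymSystem ord Ω ρ U with hSdef
  obtain ⟨d, b, hb, hbasis, hd⟩ := Submodule.exists_basis_mod
    (derivedSubmodule_antitone (L := L) (Nat.le_succ j))
  -- In the last nonzero derived algebra brackets vanish in `L` itself, so the unprolonged fields
  -- commute as well.
  have hbr : ∀ i l, ⁅b i, b l⁆ = 0 := fun i l => by
    have := lie_mem_derivedSubmodule_succ (hb i) (hb l)
    rwa [hbot, Submodule.mem_bot] at this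
  have hz : ∀ X ∈ derivedSubmodule L (j + 1), ∀ p ∈ S.dom, S.gen X p = 0 := by
    intro X hX p hp
    rw [hbot, Submodule.mem_bot] at hX
    rw [hX, hS.gen_zero hp]
  have hind : ∀ (s : Fin d → ℝ) (t : ℝ), ∑ i, s i • ρ (b i) (baseProj ord p₀) +
      t • baseProj ord (odeField ord Ω p₀) = 0 → s = 0 ∧ t = 0 := by
    intro s t h
    have hsum : ρ (∑ i, s i • b i) (baseProj ord p₀) = ∑ i, s i • ρ (b i) (baseProj ord p₀) := by
      simp [map_sum, Finset.sum_apply]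
    have h1 : ∑ i, s i • b i = 0 := by
      refine hpoint _ (Submodule.sum_mem _ fun i _ => Submodule.smul_mem _ _ (hb i)) ?_
      rw [hsum, eq_neg_of_add_eq_zero_left h, ← neg_smul]
      exact Submodule.smul_mem _ _ (Submodule.mem_span_singleton_self _)
    have hs : s = 0 := by
      refine (hbasis 0 (Submodule.zero_mem _)).unique ?_ ?_
      · rw [h1, sub_zero]; exact Submodule.zero_mem _
      · simp
    refine ⟨hs, ?_⟩
    rw [← hsum, h1, map_zero, Pi.zero_apply, zero_add] at h
    have := congrArg Prod.fst h
    simpa [baseProj, odeField] using this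
  obtain ⟨m, Ψ, hdimk, hqΨ, hΨD, hΨ, hΨ', hΨn, hΨ0, hΨA⟩ :=
    exists_straightening_of_independent hD (Z := fun i => ρ (b i)) (fun i => hρ.smooth (b i))
      (fun i l q hq => by rw [hρ.lie _ _ q hq, hbr, map_zero]; rfl) (hUD hp₀) hind
  obtain ⟨n, Φ, hdim, hpΦ, hΦU, hΦΨ, hΦ, hΦ', hΦn, hadapt, hfst⟩ :=
    exists_straightening_over (baseProjL_surjective hord) hU (Z := fun i => S.gen (b i))
      (fun i => hS.smooth_gen (b i))
      (fun i l q hq => by rw [hS.lie _ _ q hq, hbr, hS.gen_zero hq]) (Y := fun i => ρ (b i))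
      (fun i p _ => by rw [coe_baseProjL]; exact baseProj_prolong hord (ρ (b i)) p)
      hΨ hΨ' hΨn hdimk hp₀ (by rwa [coe_baseProjL]) (by rwa [coe_baseProjL])
  rw [coe_baseProjL] at hΦΨ hadapt hfst
  have hN : d + (m + n) = ∑ ν, ord ν := by
    simp only [Module.finrank_prod, Module.finrank_self, Module.finrank_fintype_fun_eq_card,
      Fintype.card_fin] at hdim
    omega
  obtain ⟨W, ε, hε, hball, hW, hpW, hWsub, C, hq, hdim', hstart⟩ :=
    HasChains.exists_step (hasChains j) hS hz hb hbasis hd hN hΦU hΦ hΦ' hΦn hpΦ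
      (by
        -- The coordinate `t` is pulled back from `Ψ`, where the projection of the operator is
        -- `∂_t`.
        have : (fderiv ℝ Φ p₀ (odeField ord Ω p₀)).1 = 1 := by rw [hfst, hΨA]
        change (fderiv ℝ Φ p₀ (odeField ord Ω p₀)).1 ≠ 0
        rw [this]; exact one_ne_zero) htrans
  refine ⟨W, hW, hpW, fun q hq => hΦU (hWsub hq).1, C, hq, hdim', ?_⟩
  exact hstart (fun X => ρ X) (baseProj ord) Ψ (Fin.castAdd n) hΨ hΨ' (Fin.castAdd_injective m n)
    hΨn fun q hq => ⟨hΦΨ q (hWsub hq).1, hadapt ε hball q (hWsub hq).1 (hWsub hq).2⟩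

end Systems

end

/-! ### The theorem -/

theorem theorem5 {k : ℕ} (ord : Fin k → ℕ) (hord : ∀ μ, 1 ≤ ord μ)
    -- the system of differential equations
    (U : Set (Phase (∑ ν, ord ν))) (hU : IsOpen U)
    (Ω : Phase (∑ ν, ord ν) → Fin k → ℝ) (hΩ : ContDiffOn ℝ ∞ Ω U)
    -- its `n`-level solvable symmetry algebra, of dimension `r`
    {L : Type*} [LieRing L] [LieAlgebra ℝ L] [FiniteDimensional ℝ L] [LieAlgebra.IsSolvable L]
    (n r : ℕ) (hn : LieAlgebra.derivedLength ℝ L = n) (hr : Module.finrank ℝ L = r)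
    (D : Set (Phase k)) (hD : IsOpen D) (hUD : Set.MapsTo (baseProj ord) U D)
    (ρ : L →ₗ[ℝ] (Phase k → Phase k)) (hρ : IsPointSymmetryAlgebra ord U Ω D ρ)
    (hN : r ≤ systemDim ord)
    (p₀ : Phase (∑ ν, ord ν)) (hp₀ : p₀ ∈ U)
    (htrans : (odeSymSystem ord Ω ρ U).CosetsTransitiveAt n p₀) :
    -- near `p₀` there are `n` steps along the cosets of the derived series
    (∃ W : Set (Phase (∑ ν, ord ν)), IsOpen W ∧ p₀ ∈ W ∧ W ⊆ U ∧
      ∃ C : FirstIntegrationChain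
          (fun i => (LieAlgebra.derivedSeries ℝ L i).toSubmodule) (odeSymSystem ord Ω ρ W) n,
        C.finalDim = systemDim ord - r ∧
        C.quadratures = r ∧
        (∀ G : Set (Phase (∑ ν, ord ν)),
          C.Produces G ↔ G ⊆ W ∧ ∃ (I : Set ℝ) (y : ℝ → Fin k → ℝ),
            IsOpenInterval I ∧ IsODESolution ord U Ω I y ∧ G = jetOf ord y '' I) ∧
        -- if the first coset acts transitively already on the space of the original variables,
        -- then the first step uses a point transformation
        ((∀ X ∈ LieAlgebra.derivedSeries ℝ L (n - 1),
            ρ X (baseProj ord p₀) ∈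
              Submodule.span ℝ {baseProj ord (odeField ord Ω p₀)} → X = 0) →
          C.StartsWithPointTransformation (fun X => ρ X) (baseProj ord))) ∧
    -- no chain that uses all the generators has fewer than `n` steps
    (∀ W : Set (Phase (∑ ν, ord ν)), W ⊆ U → W.Nonempty →
      ∀ (l : ℕ) (h : ℕ → Submodule ℝ L), h 0 = ⊤ → h l = ⊥ →
        Nonempty (FirstIntegrationChain h (odeSymSystem ord Ω ρ W) l) → n ≤ l) := by
  have hS := hρ.isSymmetric hord hU hΩ hD hUD
  have hbot : derivedSubmodule L n = ⊥ := hn ▸ derivedSubmodule_derivedLength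
  have hbot0 : Module.finrank ℝ (derivedSubmodule L n) = 0 := by rw [hbot, finrank_bot]
  refine ⟨?_, fun W hWU hne l h h0 hl ⟨C⟩ => hn ▸ C.derivedLength_le hne h0 hl⟩
  obtain ⟨W, hW, hpW, hWU, C, hq, hdim, hstart⟩ :
      ∃ W, IsOpen W ∧ p₀ ∈ W ∧ W ⊆ U ∧
        ∃ C : FirstIntegrationChain (derivedSubmodule L) (odeSymSystem ord Ω ρ W) n,
          C.quadratures + Module.finrank ℝ (derivedSubmodule L n) = Module.finrank ℝ L ∧
          C.finalDim + C.quadratures = ∑ ν, ord ν ∧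
          ((∀ X ∈ LieAlgebra.derivedSeries ℝ L (n - 1), ρ X (baseProj ord p₀) ∈
              Submodule.span ℝ {baseProj ord (odeField ord Ω p₀)} → X = 0) →
            C.StartsWithPointTransformation (fun X => ρ X) (baseProj ord)) := by
    have hgeneral := hasChains n (odeSymSystem ord Ω ρ U) hS (fun X hX p hp => by
      rw [hbot, Submodule.mem_bot] at hX
      rw [hX, hS.gen_zero hp]) p₀ hp₀ htrans
    obtain ⟨W, hW, hpW, hWU, C, hq, hdim⟩ := hgeneral
    -- For `n = 0` the chain has no step and the claim on point transformations is trivial; the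
    -- truncated `n - 1` matters only here.
    cases n with
    | zero =>
      refine ⟨W, hW, hpW, hWU, C, hq, hdim, fun _ => ?_⟩
      cases C
      trivial
    | succ j =>
      -- One chain must serve both claims: the adapted chain is taken when the condition on the
      -- first coset holds, and otherwise the general chain satisfies the implication vacuously.
      by_cases hpoint : ∀ X ∈ LieAlgebra.derivedSeries ℝ L j, ρ X (baseProj ord p₀) ∈
          Submodule.span ℝ {baseProj ord (odeField ord Ω p₀)} → X = 0
      · obtain ⟨W, hW, hpW, hWU, C, hq, hdim, hstart⟩ := exists_chain_of_transitive hord hU hΩ hD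
          hUD hρ hbot hp₀ htrans hpoint
        exact ⟨W, hW, hpW, hWU, C, hq, hdim, fun _ => hstart⟩
      · exact ⟨W, hW, hpW, hWU, C, hq, hdim, fun h => absurd h hpoint⟩
  refine ⟨W, hW, hpW, hWU, C, ?_, ?_, fun G => ?_, hstart⟩
  · rw [systemDim_eq_sum]
    omega
  · omega
  · exact (C.produces_iff G).trans (isSolutionGraph_odeSymSystem_iff hord hΩ hWU G)
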